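/- **Setting.** For each sample size $n$ one observes $n$ i.i.d. copies $(Y_i,A_i,L_i)$ of $(Y,A,L)$ with $Y\in\mathbb R$ integrable, $A\in\{0,1\}$ and $L\in\mathbb R^{p}$, where $p=p_n$ is an arbitrary sequence. Let $\mathrm{expit}(x)=1/(1+e^{-x})$, $\pi(L;\gamma)=\mathrm{expit}(\gamma^TL)$, $w=\pi(1-\pi)$, let $g$ be the identity or the log link, and put $H(\psi)=Y-\psi A$ (identity) or $H(\psi)=Y\exp(-\psi A)$ (log). Let $m(L;\beta)$, $\beta\in\mathbb R^p$, be a working model (possibly depending on $n$, possibly misspecified) for $E(Y\mid A=0,L)$, measurable in $L$ and twice continuously differentiable in $\beta$; write $d=\partial m/\partial\beta$. For each $n$ let $\mathcal P'_n$ be a nonempty class of laws $P$ with parameters $\psi_0,\gamma_0,\beta_0$ (which may vary with $P$ and $n$) such that * (model $\mathcal M$) $g\{E(Y\mid A=a,L=l)\}-g\{E(Y\mid A=0,L=l)\}=\psi_0a$ (for the log link these conditional means are positive); * (model $\mathcal A$) $E(A\mid L)=\pi(L;\gamma_0)$; * $\beta_0$ solves $E[w(L;\gamma_0)\{H(\psi_0)-m(L;\beta_0)\}L]=0$.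 **Estimators.** For $\lambda_\gamma,\lambda_\beta>0$ with $\lambda_\beta=O(\sqrt{\log(p\vee n)/n})$, let $\hat\gamma$ minimise $n^{-1}\sum_i[\log\{1+\exp(\gamma^TL_i)\}-A_i\gamma^TL_i]+\lambda_\gamma\|\gamma\|_1$ and, for each $\psi$, let $\hat\beta(\psi)$ be a limit, as $\delta\to1+$, of solutions of the weighted bridge equations $$0=-\frac1n\sum_{i=1}^n w(L_i;\hat\gamma)\{H_i(\psi)-m(L_i;\beta)\}L_i+\lambda_\beta\,\delta|\beta|^{\delta-1}\circ\mathrm{sign}(\beta),$$ the value $\delta=1$ (weighted Lasso) being allowed, with $\mathrm{sign}(0)$ then replaced by some number in $[-1,1]$. Both are measurable functions of the data, $\hat\gamma$ of $(A_i,L_i)_{i\le n}$ only. Let $U_i\{\psi,\hat\eta(\psi)\}=\{A_i-\pi(L_i;\hat\gamma)\}[H_i(\psi)-m\{L_i;\hat\beta(\psi)\}]$, let $\hat V(\psi)$ be their empirical variance, centred or uncentred, let $\alpha\in(0,1)$, let $\chi^2_1(\alpha)$ be the upper $\alpha$ critical value of $\chi^2_1$, and let $$[\hat l_s,\hat u_s]=\Big\{\psi:\Big[\frac1n\sum_{i=1}^nU_i\{\psi,\hat\eta(\psi)\}\Big]^2-\frac{\chi^2_1(\alpha)}n\hat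 V(\psi)\le0\Big\}$$ be the set of values that the score test does not reject. **Assumptions.** Let $s_\gamma,s_\beta$ be the numbers of non-zero entries of $\gamma_0,\beta_0$, $s^*=s_\gamma\vee s_\beta$, and $\varepsilon=H(\psi_0)-m(L;\beta_0)$. There are constants $0<c<C<\infty$ and $4<r<\infty$, the same for all $n$ and all laws, such that for every sequence $P_n\in\mathcal P'_n$: 1. with probability tending to one, $E_{P_n}[\varepsilon^4\mid A,L]<C$, $E_{P_n}[\{A-\pi(L;\gamma_0)\}^2\mid L]>c$ and $E_{P_n}[\varepsilon^2\mid A,L]>c$ at all $n$ sampled points, and $E_{P_n}|\varepsilon|^r<C$ for every $n$; 2. $\|n^{-1/2}\sum_i\{A_i-\pi(L_i;\gamma_0)\}d(L_i;\beta_0)\|_\infty=O_{P_n}(\sqrt{\log(p\vee n)})$; 3. $\|\hat\gamma-\gamma_0\|_1=O_{P_n}(s_\gamma\sqrt{\log(p\vee n)/n})$, $\|\hat\gamma-\gamma_0\|_2=O_{P_n}(\sqrt{s_\gamma\log(p\vee n)/n})$, $\|\hat\beta(\psi_0)-\beta_0\|_1=O_{P_n}(s^*\sqrt{\log(p\vee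 n)/n})$, $\|\hat\beta(\psi_0)-\beta_0\|_2=O_{P_n}(\sqrt{s^*\log(p\vee n)/n})$; 4. $n^{-1}\sum_i\{\pi(L_i;\gamma_0)-\pi(L_i;\hat\gamma)\}^2=O_{P_n}(s_\gamma\log(p\vee n)/n)$ and $n^{-1}\sum_i[m(L_i;\beta_0)-m\{L_i;\hat\beta(\psi_0)\}]^2=O_{P_n}(s^*\log(p\vee n)/n)$; 5. (smoothness of $m$; automatic if $m$ is linear in $\beta$) with $v=\hat\beta(\psi_0)-\beta_0$, $\sup_{t\in[0,1]}n^{-1}\sum_i\big|v^T\tfrac{\partial^2m}{\partial\beta\,\partial\beta^T}(L_i;\beta_0+tv)\,v\big|=O_{P_n}(\|v\|_2^2)$; 6. (ultra-sparsity) $(s_\gamma^2+s_\beta^2)\log^2(p\vee n)=o(n)$. **Theorem.** Then, for either choice of $\hat V$, the confidence interval is uniformly valid: $$\lim_{n\to\infty}\ \sup_{P_n\in\mathcal P'_n}\big|\mathbb P_{P_n}(\psi_0\in[\hat l_s,\hat u_s])-(1-\alpha)\big|=0 .$$ -/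

import Mathlib

open MeasureTheory ProbabilityTheory Filter Topology Asymptotics
open scoped BigOperators Matrix

namespace ScoreCI

/-- One observation `(Y, A, L)`: outcome, exposure, and `p` covariates. -/
abbrev Obs (p : ℕ) : Type := ℝ × ℝ × (Fin p → ℝ)

/-- The outcome `Y`. -/
def outcome {p : ℕ} (o : Obs p) : ℝ := o.1

/-- The exposure `A`. -/
def exposure {p : ℕ} (o : Obs p) : ℝ := o.2.1

/-- The covariates `L`. -/
def covar {p : ℕ} (o : Obs p) : Fin p → ℝ := o.2.2

/-- The σ-algebra generated by `(A, L)`. -/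
abbrev sigmaAL (p : ℕ) : MeasurableSpace (Obs p) :=
  MeasurableSpace.comap (fun o : Obs p => (exposure o, covar o)) inferInstance

/-- The σ-algebra generated by `L`. -/
abbrev sigmaL (p : ℕ) : MeasurableSpace (Obs p) :=
  MeasurableSpace.comap (fun o : Obs p => covar o) inferInstance

/-! ### Vectors -/

/-- The `ℓ₁` norm. -/
noncomputable def l1 {p : ℕ} (v : Fin p → ℝ) : ℝ := ∑ j, |v j|

/-- The Euclidean norm. -/
noncomputable def l2 {p : ℕ} (v : Fin p → ℝ) : ℝ := Real.sqrt (∑ j, v j ^ 2)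

/-- The number of non-zero entries. -/
noncomputable def sparsity {p : ℕ} (v : Fin p → ℝ) : ℕ := (Function.support v).ncard

/-! ### The semiparametric model -/

/-- The two link functions. -/
inductive Link where
  | identity
  | log

/-- The link function `g`. -/
noncomputable def Link.g : Link → ℝ → ℝ
  | .identity, x => x
  | .log, x => Real.log x

/-- The set of conditional means on which the link is meant to be used. -/
def Link.domain : Link → Set ℝ
  | .identity => Set.univ
  | .log => Set.Ioi 0

/-- `H(ψ)`: the outcome with the effect of the exposure removed. -/
noncomputable def Link.blip {p : ℕ} : Link → ℝ → Obs p → ℝ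
  | .identity, ψ, o => outcome o - ψ * exposure o
  | .log, ψ, o => outcome o * Real.exp (-(ψ * exposure o))

/-- `π(l; γ) = expit(γᵀ l)`. -/
noncomputable def propensity {p : ℕ} (γ l : Fin p → ℝ) : ℝ := Real.sigmoid (γ ⬝ᵥ l)

/-- `w(l; γ) = expit(γᵀ l) (1 - expit(γᵀ l))`. -/
noncomputable def weight {p : ℕ} (γ l : Fin p → ℝ) : ℝ :=
  propensity γ l * (1 - propensity γ l)

/-- A law of one observation, together with its parameters `ψ₀`, `γ₀`, `β₀`. -/
structure Dgp (p : ℕ) where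
  /-- the law of `(Y, A, L)` -/
  law : Measure (Obs p)
  /-- the law is a probability measure -/
  isProb : IsProbabilityMeasure law
  /-- the treatment effect `ψ₀` -/
  psi : ℝ
  /-- the parameter `γ₀` of the exposure model -/
  gam : Fin p → ℝ
  /-- the parameter `β₀` of the working outcome model -/
  bet : Fin p → ℝ

/-- The joint law of `n` independent observations. -/
noncomputable def Dgp.sampleLaw {p : ℕ} (P : Dgp p) (n : ℕ) : Measure (Fin n → Obs p) :=
  Measure.pi fun _ => P.law

/-- The residual `H(ψ₀) - m(L; β₀)`. -/
noncomputable def Dgp.resid {p : ℕ} (P : Dgp p) (link : Link)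
    (m : (Fin p → ℝ) → (Fin p → ℝ) → ℝ) (o : Obs p) : ℝ :=
  link.blip P.psi o - m (covar o) P.bet

/-- The conditional mean `f(a, l) = E(Y | A = a, L = l)` satisfies
`g(f(a, l)) - g(f(0, l)) = ψ₀ a`. -/
def Dgp.OutcomeEffectModel {p : ℕ} (P : Dgp p) (link : Link) : Prop :=
  Integrable outcome P.law ∧
  ∃ f : ℝ → (Fin p → ℝ) → ℝ, Measurable (Function.uncurry f) ∧
    (P.law[outcome | sigmaAL p] =ᵐ[P.law] fun o => f (exposure o) (covar o)) ∧
    ∀ᵐ o ∂P.law,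
      f (exposure o) (covar o) ∈ link.domain ∧ f 0 (covar o) ∈ link.domain ∧
      link.g (f (exposure o) (covar o)) - link.g (f 0 (covar o)) = P.psi * exposure o

/-- The exposure is binary and follows the logistic model with parameter `γ₀`. -/
def Dgp.LogisticExposureModel {p : ℕ} (P : Dgp p) : Prop :=
  (∀ᵐ o ∂P.law, exposure o = 0 ∨ exposure o = 1) ∧
  P.law[exposure | sigmaL p] =ᵐ[P.law] fun o => propensity P.gam (covar o)

/-- `β₀` solves the unpenalised population equations
`E[w(L; γ₀) {H(ψ₀) - m(L; β₀)} L] = 0`. -/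
def Dgp.PopulationEquation {p : ℕ} (P : Dgp p) (link : Link)
    (m : (Fin p → ℝ) → (Fin p → ℝ) → ℝ) : Prop :=
  ∀ j, Integrable (fun o => weight P.gam (covar o) * P.resid link m o * covar o j) P.law ∧
    ∫ o, weight P.gam (covar o) * P.resid link m o * covar o j ∂P.law = 0

/-! ### The nuisance estimators -/

/-- The criterion of the `ℓ₁`-penalised logistic regression of `A` on `L`. -/
noncomputable def logisticLassoObjective {n p : ℕ} (lam : ℝ)
    (D : Fin n → ℝ × (Fin p → ℝ)) (γ : Fin p → ℝ) : ℝ :=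
  (1 / (n : ℝ)) * ∑ i, (Real.log (1 + Real.exp (γ ⬝ᵥ (D i).2)) - (D i).1 * (γ ⬝ᵥ (D i).2))
    + lam * l1 γ

/-- The (sub)differential of `b ↦ |b|^δ` at `b`, for `δ ≥ 1`: the number `δ |b|^(δ-1) sign b`,
except for `δ = 1` and `b = 0`, where it is `[-1, 1]`. -/
noncomputable def bridgeSubgradient (δ b : ℝ) : Set ℝ :=
  open Classical in
  if δ = 1 ∧ b = 0 then Set.Icc (-1) 1 else {δ * |b| ^ (δ - 1) * Real.sign b}

/-- `β` solves the weighted bridge estimating equations with exponent `δ`: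
`0 = - n⁻¹ ∑ w(Lᵢ; γ) {Hᵢ(ψ) - m(Lᵢ; β)} Lᵢ + lam δ |β|^(δ-1) ∘ sign β`. -/
def IsBridgeSolution {n p : ℕ} (link : Link) (m : (Fin p → ℝ) → (Fin p → ℝ) → ℝ)
    (lam δ ψ : ℝ) (D : Fin n → Obs p) (γ β : Fin p → ℝ) : Prop :=
  ∀ j, ∃ z ∈ bridgeSubgradient δ (β j),
    0 = -((1 / (n : ℝ)) * ∑ i, weight γ (covar (D i))
          * (link.blip ψ (D i) - m (covar (D i)) β) * covar (D i) j)
        + lam * z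

/-- `β` is a limit of bridge solutions as the exponent `δ ≥ 1` tends to one. Since `δ = 1` is
allowed along the way, the weighted Lasso solutions are included. -/
def IsBridgeLimit {n p : ℕ} (link : Link) (m : (Fin p → ℝ) → (Fin p → ℝ) → ℝ)
    (lam ψ : ℝ) (D : Fin n → Obs p) (γ β : Fin p → ℝ) : Prop :=
  ∃ (δ : ℕ → ℝ) (b : ℕ → Fin p → ℝ), (∀ k, 1 ≤ δ k) ∧
    Tendsto δ atTop (𝓝 1) ∧ Tendsto b atTop (𝓝 β) ∧
    ∀ k, IsBridgeSolution link m lam (δ k) ψ D γ (b k)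

/-- Measurable estimators of the nuisance parameters from a sample of size `n`: an estimator of
`γ₀` that uses the `(Aᵢ, Lᵢ)`, and for every `ψ` an estimator of `β₀`. -/
structure NuisanceEstimator (n p : ℕ) where
  /-- `γ̂` as a function of the exposures and covariates -/
  gam : (Fin n → ℝ × (Fin p → ℝ)) → Fin p → ℝ
  /-- `β̂(ψ)` as a function of the sample -/
  bet : ℝ → (Fin n → Obs p) → Fin p → ℝ
  /-- `γ̂` is measurable -/
  measurable_gam : Measurable gam
  /-- `β̂(ψ)` is measurable -/
  measurable_bet : ∀ ψ, Measurable (bet ψ)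

/-- `γ̂` evaluated at a sample. -/
def NuisanceEstimator.gamHat {n p : ℕ} (est : NuisanceEstimator n p) (D : Fin n → Obs p) :
    Fin p → ℝ :=
  est.gam fun i => (exposure (D i), covar (D i))

/-- Under `P`, almost surely `γ̂` minimises the Lasso criterion and, for each `ψ`, `β̂(ψ)` is the
bridge estimate (exponent tending to one) with weights `w(L; γ̂)`. -/
def NuisanceEstimator.IsLassoBridge {n p : ℕ} (est : NuisanceEstimator n p) (link : Link)
    (m : (Fin p → ℝ) → (Fin p → ℝ) → ℝ) (lamγ lamβ : ℝ) (P : Dgp p) : Prop :=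
  (∀ᵐ D ∂(P.sampleLaw n), ∀ γ : Fin p → ℝ,
    logisticLassoObjective lamγ (fun i => (exposure (D i), covar (D i))) (est.gamHat D)
      ≤ logisticLassoObjective lamγ (fun i => (exposure (D i), covar (D i))) γ) ∧
  ∀ ψ : ℝ, ∀ᵐ D ∂(P.sampleLaw n),
    IsBridgeLimit link m lamβ ψ D (est.gamHat D) (est.bet ψ D)

/-! ### The score test and the confidence set -/

/-- The score `U(ψ, η) = {A - π(L; γ)} {H(ψ) - m(L; β)}` of one observation. -/
noncomputable def score {p : ℕ} (link : Link) (m : (Fin p → ℝ) → (Fin p → ℝ) → ℝ)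
    (ψ : ℝ) (γ β : Fin p → ℝ) (o : Obs p) : ℝ :=
  (exposure o - propensity γ (covar o)) * (link.blip ψ o - m (covar o) β)

/-- The estimated scores `Uᵢ{ψ, η̂(ψ)}`. -/
noncomputable def NuisanceEstimator.scores {n p : ℕ} (est : NuisanceEstimator n p) (link : Link)
    (m : (Fin p → ℝ) → (Fin p → ℝ) → ℝ) (ψ : ℝ) (D : Fin n → Obs p) (i : Fin n) : ℝ :=
  score link m ψ (est.gamHat D) (est.bet ψ D) (D i)

/-- The sample mean. -/
noncomputable def sampleMean {n : ℕ} (u : Fin n → ℝ) : ℝ := (1 / (n : ℝ)) * ∑ i, u i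

/-- The centred empirical variance. -/
noncomputable def centredVariance {n : ℕ} (u : Fin n → ℝ) : ℝ :=
  sampleMean fun i => (u i - sampleMean u) ^ 2

/-- The uncentred empirical variance, appropriate for scores with mean zero. -/
noncomputable def uncentredVariance {n : ℕ} (u : Fin n → ℝ) : ℝ :=
  sampleMean fun i => u i ^ 2

/-- The chi-squared distribution with one degree of freedom. -/
noncomputable def chiSqOne : Measure ℝ := (gaussianReal 0 1).map fun x => x ^ 2

/-- The upper `α` critical value of the chi-squared distribution with one degree of freedom. -/
noncomputable def chiSqCrit (α : ℝ) : ℝ := sInf {c : ℝ | chiSqOne.real (Set.Ioi c) ≤ α}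

/-- The values of `ψ` that the score test of level `α` does not reject. The function `V` computes
the variance estimate from the estimated scores. -/
def NuisanceEstimator.confidenceSet {n p : ℕ} (est : NuisanceEstimator n p) (link : Link)
    (m : (Fin p → ℝ) → (Fin p → ℝ) → ℝ) (V : (Fin n → ℝ) → ℝ) (α : ℝ)
    (D : Fin n → Obs p) : Set ℝ :=
  {ψ | sampleMean (est.scores link m ψ D) ^ 2
        - chiSqCrit α / (n : ℝ) * V (est.scores link m ψ D) ≤ 0}

/-- The coverage probability `P(ψ₀ ∈ CI)` under `P`. -/
noncomputable def NuisanceEstimator.coverage {n p : ℕ} (est : NuisanceEstimator n p)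
    (link : Link) (m : (Fin p → ℝ) → (Fin p → ℝ) → ℝ) (V : (Fin n → ℝ) → ℝ) (α : ℝ)
    (P : Dgp p) : ℝ :=
  (P.sampleLaw n).real {D | P.psi ∈ est.confidenceSet link m V α D}

/-! ### Stochastic orders -/

/-- `X n = O_P(R n)` with respect to the measures `μ n`. -/
def IsBigOP {Ω : ℕ → Type} [∀ n, MeasurableSpace (Ω n)] (μ : ∀ n, Measure (Ω n))
    (X R : ∀ n, Ω n → ℝ) : Prop :=
  ∀ ε : ℝ, 0 < ε → ∃ M : ℝ, ∀ᶠ n in atTop, (μ n).real {ω | M * R n ω < |X n ω|} ≤ ε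

/-- The events `E n` hold with probability approaching one. -/
def WithProbToOne {Ω : ℕ → Type} [∀ n, MeasurableSpace (Ω n)] (μ : ∀ n, Measure (Ω n))
    (E : ∀ n, Set (Ω n)) : Prop :=
  Tendsto (fun n => (μ n).real (E n)) atTop (𝓝 1)

/-! ### Conditions along a sequence of laws -/

section Conditions

variable {p : ℕ → ℕ}

/-- `log (p ∨ n)`. -/
noncomputable def logDim (p : ℕ → ℕ) (n : ℕ) : ℝ := Real.log ((max (p n) n : ℕ) : ℝ)

/-- `s_γ`. -/
noncomputable def sGam (P : ∀ n, Dgp (p n)) (n : ℕ) : ℝ := (sparsity (P n).gam : ℝ)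

/-- `s_β`. -/
noncomputable def sBet (P : ∀ n, Dgp (p n)) (n : ℕ) : ℝ := (sparsity (P n).bet : ℝ)

/-- `s* = s_γ ∨ s_β`. -/
noncomputable def sStar (P : ∀ n, Dgp (p n)) (n : ℕ) : ℝ := max (sGam P n) (sBet P n)

/-- Moment conditions with constants `c`, `C`, `r`. The bounds on conditional moments hold at all
sampled points simultaneously, with probability approaching one. -/
def MomentConditions (link : Link) (m : ∀ n, (Fin (p n) → ℝ) → (Fin (p n) → ℝ) → ℝ)
    (c C r : ℝ) (P : ∀ n, Dgp (p n)) : Prop :=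
  WithProbToOne (fun n => (P n).sampleLaw n)
    (fun n => {D | ∀ i, (P n).law[fun o => (P n).resid link (m n) o ^ 4 | sigmaAL (p n)] (D i)
      < C}) ∧
  (∀ n, Integrable (fun o => |(P n).resid link (m n) o| ^ r) (P n).law ∧
    ∫ o, |(P n).resid link (m n) o| ^ r ∂(P n).law < C) ∧
  WithProbToOne (fun n => (P n).sampleLaw n)
    (fun n => {D | ∀ i, c <
      (P n).law[fun o => (exposure o - propensity (P n).gam (covar o)) ^ 2 | sigmaL (p n)] (D i)}) ∧
  WithProbToOne (fun n => (P n).sampleLaw n)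
    (fun n => {D | ∀ i, c <
      (P n).law[fun o => (P n).resid link (m n) o ^ 2 | sigmaAL (p n)] (D i)})

/-- `d(l; β) = ∂ m(l; β) / ∂ β`. -/
noncomputable def gradM {q : ℕ} (m : (Fin q → ℝ) → (Fin q → ℝ) → ℝ) (l β : Fin q → ℝ)
    (j : Fin q) : ℝ :=
  fderiv ℝ (m l) β (Pi.single j 1)

/-- The second derivative `vᵀ {∂² m(l; β) / ∂ β ∂ βᵀ} v` in the direction `v`. -/
noncomputable def curvM {q : ℕ} (m : (Fin q → ℝ) → (Fin q → ℝ) → ℝ) (l β v : Fin q → ℝ) : ℝ :=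
  iteratedFDeriv ℝ 2 (m l) β ![v, v]

/-- Concentration bound:
`‖n^(-1/2) ∑ {Aᵢ - π(Lᵢ; γ₀)} d(Lᵢ; β₀)‖_∞ = O_P(√(log (p ∨ n)))`.
The norm of `Fin q → ℝ` is the maximum norm. -/
def ConcentrationBound (m : ∀ n, (Fin (p n) → ℝ) → (Fin (p n) → ℝ) → ℝ)
    (P : ∀ n, Dgp (p n)) : Prop :=
  IsBigOP (fun n => (P n).sampleLaw n)
    (fun n D => ‖fun j => (1 / Real.sqrt n) * ∑ i,
      (exposure (D i) - propensity (P n).gam (covar (D i)))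
        * gradM (m n) (covar (D i)) (P n).bet j‖)
    (fun n _ => Real.sqrt (logDim p n))

/-- Rates of convergence of the parameter estimates. -/
def EstimationRates (est : ∀ n, NuisanceEstimator n (p n)) (P : ∀ n, Dgp (p n)) : Prop :=
  IsBigOP (fun n => (P n).sampleLaw n)
    (fun n D => l1 ((est n).gamHat D - (P n).gam))
    (fun n _ => sGam P n * Real.sqrt (logDim p n / n)) ∧
  IsBigOP (fun n => (P n).sampleLaw n)
    (fun n D => l2 ((est n).gamHat D - (P n).gam))
    (fun n _ => Real.sqrt (sGam P n * logDim p n / n)) ∧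
  IsBigOP (fun n => (P n).sampleLaw n)
    (fun n D => l1 ((est n).bet (P n).psi D - (P n).bet))
    (fun n _ => sStar P n * Real.sqrt (logDim p n / n)) ∧
  IsBigOP (fun n => (P n).sampleLaw n)
    (fun n D => l2 ((est n).bet (P n).psi D - (P n).bet))
    (fun n _ => Real.sqrt (sStar P n * logDim p n / n))

/-- Rates of convergence of the predictions. -/
def PredictionRates (m : ∀ n, (Fin (p n) → ℝ) → (Fin (p n) → ℝ) → ℝ)
    (est : ∀ n, NuisanceEstimator n (p n)) (P : ∀ n, Dgp (p n)) : Prop :=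
  IsBigOP (fun n => (P n).sampleLaw n)
    (fun n D => sampleMean fun i =>
      (propensity (P n).gam (covar (D i)) - propensity ((est n).gamHat D) (covar (D i))) ^ 2)
    (fun n _ => sGam P n * logDim p n / n) ∧
  IsBigOP (fun n => (P n).sampleLaw n)
    (fun n D => sampleMean fun i =>
      (m n (covar (D i)) (P n).bet - m n (covar (D i)) ((est n).bet (P n).psi D)) ^ 2)
    (fun n _ => sStar P n * logDim p n / n)

/-- Smoothness of the working outcome model at the scale of the estimation error: with
`v = β̂(ψ₀) - β₀`, the sample mean of `|vᵀ {∂² m(Lᵢ; β) / ∂ β ∂ βᵀ} v|` is, uniformly over `β` on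
the segment from `β₀` to `β̂(ψ₀)`, of order `O_P(‖v‖₂²)`. It holds trivially if `m` is linear
in `β`. The supremum is over a compact interval and, for `m` of class `C²`, of a continuous
function. -/
def QuadraticSmoothness (m : ∀ n, (Fin (p n) → ℝ) → (Fin (p n) → ℝ) → ℝ)
    (est : ∀ n, NuisanceEstimator n (p n)) (P : ∀ n, Dgp (p n)) : Prop :=
  IsBigOP (fun n => (P n).sampleLaw n)
    (fun n D => ⨆ t : Set.Icc (0 : ℝ) 1, sampleMean fun i =>
      |curvM (m n) (covar (D i))
        ((P n).bet + (t : ℝ) • ((est n).bet (P n).psi D - (P n).bet))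
        ((est n).bet (P n).psi D - (P n).bet)|)
    (fun n D => l2 ((est n).bet (P n).psi D - (P n).bet) ^ 2)

/-- Ultra-sparsity: `(s_γ² + s_β²) log² (p ∨ n) = o(n)`. -/
def UltraSparsity (P : ∀ n, Dgp (p n)) : Prop :=
  (fun n => (sGam P n ^ 2 + sBet P n ^ 2) * logDim p n ^ 2) =o[atTop] fun n : ℕ => (n : ℝ)

end Conditions

end ScoreCI

open ScoreCI

/-!
The proof follows one sequence of laws at a time (`RegularSequence`); uniformity over the classes of
laws is recovered in `tendsto_iSup_of_forall_seq` by choosing laws that nearly attain the suprema.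
Convergence in probability is convergence along the filter `inProb`.

Along a sequence, the mean of the scores at the estimated nuisance parameters differs from the mean
of the scores at the true ones by `o_P(n^(-1/2))` (`tendsto_sqrt_mul_sampleMean_scores_sub`).
Let `a = A - π(L; γ₀)`, `δ = π(L; γ̂) - π(L; γ₀)`, and let `μ` be the error of the fitted prediction,
so that the estimated score is `(a - δ) (ε - μ)`.
* The mean of `a μ` is controlled by a Taylor expansion of `m` in `β`: the gradient term is at most
  the product of a maximum norm and an `ℓ₁` error, the curvature term is quadratic.
* Write `δ = w(L; γ̂) (γ̂ - γ₀)ᵀ L + R`. The mean of the linear part times `ε - μ` is a combination of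
  the estimating equations that `β̂` solves, hence at most `λ_β ‖γ̂ - γ₀‖₁`
  (`NuisanceEstimator.abs_sampleMean_linear_le`); this is why those equations are weighted by `w`.
* The remainder satisfies `|R| ≤ δ² / c` (`abs_sigmoid_sub_sub_le`), without any bound on `L`. Its
  product with `μ` is handled by the Cauchy-Schwarz inequality. Its product with `ε` is split:
  `E(ε | A, L)` is bounded, and `ε - E(ε | A, L)` is centred given the exposures and covariates, of
  which `γ̂` is a function, so that the summands are uncorrelated and a second moment bound suffices
  (`NuisanceEstimator.integral_sq_truncRemainder_le`).

Every bound is of order `s* log(p ∨ n) / √n`, up to a constant and apart from the last one, which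
vanishes by consistency of `π(L; γ̂)` alone.

The scores at the true parameters have mean zero even if `m` is misspecified
(`Dgp.integral_noise_mul_resid`), bounded fourth moments, and variances bounded away from zero.
Hence their studentised means are asymptotically normal
(`tendsto_measure_abs_sqrt_mul_sampleMean_le`), and both variance estimators are consistent. The
event that the test does not reject is then squeezed between events of the limiting form
(`tendsto_measure_of_squeeze`), whose limiting probabilities are given by the Gaussian law and
depend continuously on the threshold.
-/

namespace ScoreCI

/-! ### Convergence in probability as convergence along a filter -/

section InProb

variable {Ω : ℕ → Type} [∀ n, MeasurableSpace (Ω n)]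

/-- The filter of events whose probability under `μ n` tends to one, for a sequence of probability
spaces `Ω n`. Convergence in probability of `X n : Ω n → ℝ` is convergence of
`fun x => X x.1 x.2` along this filter. Events need not be measurable: the filter is
defined by complements of vanishing outer measure. -/
def inProb (μ : ∀ n, Measure (Ω n)) [∀ n, IsProbabilityMeasure (μ n)] : Filter (Σ n, Ω n) where
  sets := {S | Tendsto (fun n => (μ n).real {ω | (⟨n, ω⟩ : Σ n, Ω n) ∉ S}) atTop (𝓝 0)}
  univ_sets := by simp
  sets_of_superset {S T} hS hST := by
    refine squeeze_zero (fun n => measureReal_nonneg) (fun n => ?_) hS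
    exact measureReal_mono (fun ω hω hS => hω (hST hS))
  inter_sets {S T} hS hT := by
    have h := Tendsto.add (Set.mem_ofPred_eq ▸ hS) (Set.mem_ofPred_eq ▸ hT)
    rw [add_zero] at h
    refine squeeze_zero (fun n => measureReal_nonneg) (fun n => ?_) h
    refine (measureReal_mono ?_).trans (measureReal_union_le _ _)
    intro ω hω
    simp only [Set.mem_inter_iff, Set.mem_ofPred_eq, Set.mem_union] at hω ⊢
    tauto

variable {μ : ∀ n, Measure (Ω n)} [∀ n, IsProbabilityMeasure (μ n)]

lemma eventually_inProb {Q : ∀ n, Ω n → Prop} :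
    (∀ᶠ x in inProb μ, Q x.1 x.2) ↔
      Tendsto (fun n => (μ n).real {ω | ¬ Q n ω}) atTop (𝓝 0) := Iff.rfl

lemma eventually_inProb_of_ae {Q : ∀ n, Ω n → Prop} (h : ∀ n, ∀ᵐ ω ∂μ n, Q n ω) :
    ∀ᶠ x in inProb μ, Q x.1 x.2 := by
  rw [eventually_inProb]
  have : ∀ n, (μ n).real {ω | ¬ Q n ω} = 0 := fun n => by
    rw [measureReal_def, ae_iff.mp (h n)]; rfl
  simp [this]

lemma tendsto_fst_inProb : Tendsto (fun x : Σ n, Ω n => x.1) (inProb μ) atTop := by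
  refine tendsto_atTop.mpr fun N => ?_
  refine (eventually_inProb (μ := μ) (Q := fun n _ => N ≤ n)).mpr ?_
  refine tendsto_const_nhds.congr' ?_
  filter_upwards [eventually_ge_atTop N] with n hn
  simp [hn]

lemma WithProbToOne.eventually {E : ∀ n, Set (Ω n)} (hE : WithProbToOne μ E)
    (hmeas : ∀ n, MeasurableSet (E n)) : ∀ᶠ x in inProb μ, x.2 ∈ E x.1 := by
  refine (eventually_inProb (μ := μ) (Q := fun n ω => ω ∈ E n)).mpr ?_
  have : ∀ n, (μ n).real {ω | ¬ ω ∈ E n} = 1 - (μ n).real (E n) := fun n =>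
    probReal_compl_eq_one_sub (hmeas n)
  simp only [this]
  simpa using (tendsto_const_nhds (x := (1 : ℝ))).sub hE

lemma tendsto_zero_inProb_iff {X : ∀ n, Ω n → ℝ} :
    Tendsto (fun x : Σ n, Ω n => X x.1 x.2) (inProb μ) (𝓝 0) ↔
      ∀ η > 0, Tendsto (fun n => (μ n).real {ω | η < |X n ω|}) atTop (𝓝 0) := by
  constructor
  · intro h η hη
    have h1 : ∀ᶠ x in inProb μ, |X x.1 x.2| ≤ η := by
      filter_upwards [(Metric.tendsto_nhds.mp h) η hη] with x hx
      rw [Real.dist_eq, sub_zero] at hx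
      exact hx.le
    simpa using (eventually_inProb (Q := fun n ω => |X n ω| ≤ η)).mp h1
  · intro h
    refine Metric.tendsto_nhds.mpr fun η hη => ?_
    have h1 : ∀ᶠ x in inProb μ, |X x.1 x.2| ≤ η / 2 := by
      refine (eventually_inProb (Q := fun n ω => |X n ω| ≤ η / 2)).mpr ?_
      simpa using h (η / 2) (by positivity)
    filter_upwards [h1] with x hx
    rw [Real.dist_eq, sub_zero]
    linarith

/-- Convergence in mean implies convergence in probability. -/
lemma tendsto_zero_inProb_of_integral {X : ∀ n, Ω n → ℝ} (hint : ∀ n, Integrable (X n) (μ n))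
    (hnn : ∀ n ω, 0 ≤ X n ω) (h : Tendsto (fun n => ∫ ω, X n ω ∂μ n) atTop (𝓝 0)) :
    Tendsto (fun x : Σ n, Ω n => X x.1 x.2) (inProb μ) (𝓝 0) := by
  rw [tendsto_zero_inProb_iff]
  intro η hη
  have h2 : Tendsto (fun n => (∫ ω, X n ω ∂μ n) / η) atTop (𝓝 0) := by simpa using h.div_const η
  refine squeeze_zero (fun n => measureReal_nonneg) (fun n => ?_) h2
  rw [le_div_iff₀ hη, mul_comm]
  refine le_trans ?_ (mul_meas_ge_le_integral_of_nonneg (ae_of_all _ (hnn n)) (hint n) η)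
  refine mul_le_mul_of_nonneg_left (measureReal_mono fun ω hω => ?_) hη.le
  simp only [Set.mem_ofPred_eq, abs_of_nonneg (hnn n ω)] at hω ⊢
  exact hω.le

/-- Convergence in mean square implies convergence in probability. -/
lemma tendsto_zero_inProb_of_integral_sq {X : ∀ n, Ω n → ℝ}
    (hint : ∀ n, Integrable (fun ω => X n ω ^ 2) (μ n))
    (h : Tendsto (fun n => ∫ ω, X n ω ^ 2 ∂μ n) atTop (𝓝 0)) :
    Tendsto (fun x : Σ n, Ω n => X x.1 x.2) (inProb μ) (𝓝 0) := by
  have h1 := (tendsto_zero_inProb_of_integral hint (fun n ω => sq_nonneg _) h).sqrt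
  simp only [Real.sqrt_zero, Real.sqrt_sq_eq_abs] at h1
  exact (tendsto_zero_iff_abs_tendsto_zero _).mpr h1

/-- Bounded variables that converge to zero in probability converge to zero in mean. -/
lemma tendsto_integral_of_tendsto_inProb {X : ∀ n, Ω n → ℝ} (hmeas : ∀ n, Measurable (X n))
    (h0 : ∀ n ω, 0 ≤ X n ω) (h1 : ∀ n ω, X n ω ≤ 1)
    (h : Tendsto (fun x : Σ n, Ω n => X x.1 x.2) (inProb μ) (𝓝 0)) :
    Tendsto (fun n => ∫ ω, X n ω ∂μ n) atTop (𝓝 0) := by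
  rw [tendsto_zero_inProb_iff] at h
  have hint : ∀ n, Integrable (X n) (μ n) := fun n =>
    Integrable.of_bound (hmeas n).aestronglyMeasurable 1 (ae_of_all _ fun ω => by
      rw [Real.norm_eq_abs, abs_of_nonneg (h0 n ω)]; exact h1 n ω)
  refine Metric.tendsto_nhds.mpr fun η hη => ?_
  have := (h (η / 2) (by positivity)).eventually (gt_mem_nhds (show (0 : ℝ) < η / 2 by positivity))
  filter_upwards [this] with n hn
  rw [Real.dist_eq, sub_zero, abs_of_nonneg (integral_nonneg (h0 n))]
  have hms : MeasurableSet {ω | η / 2 < |X n ω|} := measurableSet_lt measurable_const (hmeas n).abs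
  have hle : ∀ ω, X n ω ≤ η / 2 + Set.indicator {ω | η / 2 < |X n ω|} (fun _ => (1 : ℝ)) ω := by
    intro ω
    by_cases hω : η / 2 < |X n ω|
    · rw [Set.indicator_of_mem (by exact hω)]
      linarith [h1 n ω]
    · rw [Set.indicator_of_notMem (by exact hω), add_zero]
      exact (le_abs_self _).trans (not_lt.mp hω)
  calc ∫ ω, X n ω ∂μ n
      ≤ ∫ ω, (η / 2 + Set.indicator {ω | η / 2 < |X n ω|} (fun _ => (1 : ℝ)) ω) ∂μ n :=
        integral_mono (hint n) ((integrable_const _).add ((integrable_const _).indicator hms)) hle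
    _ = η / 2 + (μ n).real {ω | η / 2 < |X n ω|} := by
        rw [integral_add (integrable_const _) ((integrable_const _).indicator hms),
          integral_indicator_const _ hms]
        simp
    _ < η := by linarith

lemma IsBigOP.tendsto_zero {X : ∀ n, Ω n → ℝ} {ρ : ℕ → ℝ}
    (hX : IsBigOP μ X (fun n _ => ρ n)) (hρ : Tendsto ρ atTop (𝓝 0)) :
    Tendsto (fun x : Σ n, Ω n => X x.1 x.2) (inProb μ) (𝓝 0) := by
  rw [tendsto_zero_inProb_iff]
  intro η hη
  refine Metric.tendsto_nhds.mpr fun ε hε => ?_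
  obtain ⟨M, hM⟩ := hX (ε / 2) (by positivity)
  have h1 : Tendsto (fun n => M * ρ n) atTop (𝓝 0) := by simpa using hρ.const_mul M
  filter_upwards [hM, h1.eventually (gt_mem_nhds hη)] with n hn hn2
  rw [Real.dist_eq, sub_zero, abs_of_nonneg measureReal_nonneg]
  refine lt_of_le_of_lt ((measureReal_mono fun ω hω => ?_).trans hn) (by linarith)
  exact hn2.trans hω

lemma IsBigOP.mul {X Y R S : ∀ n, Ω n → ℝ} (hX : IsBigOP μ X R) (hY : IsBigOP μ Y S)
    (hR : ∀ n ω, 0 ≤ R n ω) (hS : ∀ n ω, 0 ≤ S n ω) :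
    IsBigOP μ (fun n ω => X n ω * Y n ω) (fun n ω => R n ω * S n ω) := by
  intro ε hε
  obtain ⟨M, hM⟩ := hX (ε / 2) (by positivity)
  obtain ⟨N, hN⟩ := hY (ε / 2) (by positivity)
  refine ⟨max M 0 * max N 0, ?_⟩
  filter_upwards [hM, hN] with n h1 h2
  have hsub : {ω | max M 0 * max N 0 * (R n ω * S n ω) < |X n ω * Y n ω|} ⊆
      {ω | M * R n ω < |X n ω|} ∪ {ω | N * S n ω < |Y n ω|} := by
    intro ω hω
    simp only [Set.mem_ofPred_eq, Set.mem_union] at hω ⊢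
    by_contra! hcon
    have h3 : |X n ω| ≤ max M 0 * R n ω :=
      hcon.1.trans (mul_le_mul_of_nonneg_right (le_max_left _ _) (hR n ω))
    have h4 : |Y n ω| ≤ max N 0 * S n ω :=
      hcon.2.trans (mul_le_mul_of_nonneg_right (le_max_left _ _) (hS n ω))
    rw [abs_mul] at hω
    have := mul_le_mul h3 h4 (abs_nonneg _) (mul_nonneg (le_max_right _ _) (hR n ω))
    linarith [mul_mul_mul_comm (max M 0) (max N 0) (R n ω) (S n ω)]
  linarith [(measureReal_mono (μ := μ n) hsub).trans (measureReal_union_le _ _)]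

lemma IsBigOP.trans {X R S : ∀ n, Ω n → ℝ} (hX : IsBigOP μ X R) (hR : IsBigOP μ R S)
    (hR0 : ∀ n ω, 0 ≤ R n ω) : IsBigOP μ X S := by
  intro ε hε
  obtain ⟨M, hM⟩ := hX (ε / 2) (by positivity)
  obtain ⟨N, hN⟩ := hR (ε / 2) (by positivity)
  refine ⟨max M 0 * N, ?_⟩
  filter_upwards [hM, hN] with n h1 h2
  have hsub : {ω | max M 0 * N * S n ω < |X n ω|} ⊆
      {ω | M * R n ω < |X n ω|} ∪ {ω | N * S n ω < |R n ω|} := by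
    intro ω hω
    simp only [Set.mem_ofPred_eq, Set.mem_union] at hω ⊢
    by_contra! hcon
    rw [abs_of_nonneg (hR0 n ω)] at hcon
    have h3 := mul_le_mul_of_nonneg_right (le_max_left M 0) (hR0 n ω)
    have h4 := mul_le_mul_of_nonneg_left hcon.2 (le_max_right M 0)
    linarith [hcon.1]
  linarith [(measureReal_mono (μ := μ n) hsub).trans (measureReal_union_le _ _)]

lemma isBigOP_of_isBigO {μ : ∀ n, Measure (Ω n)} {f ρ : ℕ → ℝ} (h : f =O[atTop] ρ)
    (hρ : ∀ n, 0 ≤ ρ n) :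
    IsBigOP μ (fun n _ => f n) (fun n _ => ρ n) := by
  intro ε hε
  obtain ⟨M, hM⟩ := h.bound
  refine ⟨M, ?_⟩
  filter_upwards [hM] with n hn
  rw [Real.norm_eq_abs, Real.norm_eq_abs, abs_of_nonneg (hρ n)] at hn
  simp [not_lt.mpr hn, hε.le]

/-- Variables with bounded means are bounded in probability. -/
lemma isBigOP_one_of_integral_le {X : ∀ n, Ω n → ℝ} (hint : ∀ n, Integrable (X n) (μ n))
    (hnn : ∀ n ω, 0 ≤ X n ω) {K : ℝ} (h : ∀ᶠ n in atTop, ∫ ω, X n ω ∂μ n ≤ K) :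
    IsBigOP μ X (fun _ _ => 1) := by
  intro ε hε
  refine ⟨(|K| + 1) / ε, ?_⟩
  filter_upwards [h] with n hn
  have hpos : 0 < (|K| + 1) / ε := by positivity
  have h1 := mul_meas_ge_le_integral_of_nonneg (ae_of_all _ (hnn n)) (hint n) ((|K| + 1) / ε)
  have h2 : (μ n).real {ω | (|K| + 1) / ε * 1 < |X n ω|} ≤
      (μ n).real {ω | (|K| + 1) / ε ≤ X n ω} := by
    refine measureReal_mono fun ω hω => ?_
    simp only [Set.mem_ofPred_eq, abs_of_nonneg (hnn n ω), mul_one] at hω ⊢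
    exact hω.le
  have h3 : (|K| + 1) / ε * (μ n).real {ω | (|K| + 1) / ε ≤ X n ω} ≤ |K| + 1 := by
    linarith [le_abs_self K]
  refine h2.trans ?_
  rw [div_mul_eq_mul_div, div_le_iff₀ hε] at h3
  have : 0 < |K| + 1 := by positivity
  nlinarith

end InProb

/-! ### Deterministic expansions -/

lemma log_sigmoid_div (x : ℝ) : Real.log (Real.sigmoid x / (1 - Real.sigmoid x)) = x := by
  rw [← Real.sigmoid_neg, ← Real.sigmoid_mul_rexp_neg,
    div_mul_cancel_left₀ (Real.sigmoid_pos x).ne',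
    ← Real.exp_neg, neg_neg, Real.log_exp]

/-- The error of the linearisation of the sigmoid around `y` is quadratic in the difference of the
values, not only in the difference of the arguments, with a constant that depends on `x`
alone. Both bounds are instances of `1 - 1 / t ≤ log t ≤ t - 1`, applied to the logits. -/
lemma abs_sigmoid_sub_sub_le {c x : ℝ} (hc : 0 < c)
    (hx : c ≤ Real.sigmoid x * (1 - Real.sigmoid x)) (y : ℝ) :
    |Real.sigmoid y - Real.sigmoid x - Real.sigmoid y * (1 - Real.sigmoid y) * (y - x)|
      ≤ (Real.sigmoid y - Real.sigmoid x) ^ 2 / c := by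
  have hu0 := Real.sigmoid_pos x
  have hu1 := Real.sigmoid_lt_one x
  have hv0 := Real.sigmoid_pos y
  have hv1 := Real.sigmoid_lt_one y
  have hxy : y - x = Real.log (Real.sigmoid y / Real.sigmoid x)
      - Real.log ((1 - Real.sigmoid y) / (1 - Real.sigmoid x)) := by
    have h1 := log_sigmoid_div x
    have h2 := log_sigmoid_div y
    rw [Real.log_div (by linarith) (by linarith)] at h1 h2 ⊢
    rw [Real.log_div (by linarith) (by linarith)]
    linarith
  rw [hxy]
  generalize Real.sigmoid x = u at *
  generalize Real.sigmoid y = v at *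
  have hu' : 0 < 1 - u := by linarith
  have hv' : 0 < 1 - v := by linarith
  have hcu : c ≤ u := by nlinarith
  have hcu' : c ≤ 1 - u := by nlinarith
  have a1 := Real.log_le_sub_one_of_pos (div_pos hv0 hu0)
  have a2 := Real.one_sub_inv_le_log_of_pos (div_pos hv0 hu0)
  have a3 := Real.log_le_sub_one_of_pos (div_pos hv' hu')
  have a4 := Real.one_sub_inv_le_log_of_pos (div_pos hv' hu')
  rw [inv_div] at a2 a4
  have hvv : 0 < v * (1 - v) := mul_pos hv0 hv'
  have lo := mul_le_mul_of_nonneg_left (sub_le_sub a2 a3) hvv.le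
  have hi := mul_le_mul_of_nonneg_left (sub_le_sub a1 a4) hvv.le
  have e1 : v * (1 - v) * (1 - u / v - ((1 - v) / (1 - u) - 1))
      = (v - u) - v * ((v - u) ^ 2 / (1 - u)) := by
    field_simp
    ring
  have e2 : v * (1 - v) * (v / u - 1 - (1 - (1 - u) / (1 - v)))
      = (v - u) + (1 - v) * ((v - u) ^ 2 / u) := by
    field_simp
    ring
  rw [e1] at lo
  rw [e2] at hi
  have b1 : (v - u) ^ 2 / (1 - u) ≤ (v - u) ^ 2 / c :=
    div_le_div_of_nonneg_left (sq_nonneg _) hc hcu'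
  have b2 : (v - u) ^ 2 / u ≤ (v - u) ^ 2 / c := div_le_div_of_nonneg_left (sq_nonneg _) hc hcu
  have b3 : 0 ≤ (v - u) ^ 2 / (1 - u) := by positivity
  have b4 : 0 ≤ (v - u) ^ 2 / u := by positivity
  rw [abs_le]
  constructor <;> nlinarith

/-- The estimating equations of a bridge limit hold up to the penalty level: the exponents tend to
one and the solutions stay bounded, so `δ |b|^(δ-1)` is asymptotically at most one. -/
lemma IsBridgeLimit.abs_equation_le {n q : ℕ} {link : Link} {m : (Fin q → ℝ) → (Fin q → ℝ) → ℝ}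
    (hm : ∀ l, Continuous (m l)) {lam ψ : ℝ} (hlam : 0 ≤ lam) {D : Fin n → Obs q}
    {γ β : Fin q → ℝ} (h : IsBridgeLimit link m lam ψ D γ β) (j : Fin q) :
    |(1 / (n : ℝ)) * ∑ i, weight γ (covar (D i))
          * (link.blip ψ (D i) - m (covar (D i)) β) * covar (D i) j| ≤ lam := by
  obtain ⟨δ, b, hδ1, hδ, hb, hsol⟩ := h
  have hcont : Continuous fun β : Fin q → ℝ => |(1 / (n : ℝ)) * ∑ i, weight γ (covar (D i))
      * (link.blip ψ (D i) - m (covar (D i)) β) * covar (D i) j| := by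
    refine (continuous_const.mul (continuous_finsetSum _ fun i _ => ?_)).abs
    exact (continuous_const.mul (continuous_const.sub (hm _))).mul continuous_const
  have hl := (hcont.tendsto β).comp hb
  have hbj : Tendsto (fun k => max |b k j| 1) atTop (𝓝 (max |β j| 1)) :=
    (((tendsto_pi_nhds.mp hb) j).abs).max tendsto_const_nhds
  have hpow : Tendsto (fun k => lam * (δ k * max |b k j| 1 ^ (δ k - 1))) atTop (𝓝 lam) := by
    have h1 := hbj.rpow (hδ.sub_const 1) (Or.inl (by positivity))
    simpa using (hδ.mul h1).const_mul lam
  refine le_of_tendsto_of_tendsto' hl hpow fun k => ?_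
  obtain ⟨z, hz, he⟩ := hsol k j
  have hd : 0 ≤ δ k - 1 := by linarith [hδ1 k]
  have hone : 1 ≤ max |b k j| 1 ^ (δ k - 1) := Real.one_le_rpow (le_max_right _ _) hd
  have hz' : |z| ≤ δ k * max |b k j| 1 ^ (δ k - 1) := by
    unfold bridgeSubgradient at hz
    split_ifs at hz with hcase
    · have := _root_.abs_le.mpr hz
      nlinarith [hδ1 k]
    · rw [Set.mem_singleton_iff] at hz
      have hs : |Real.sign (b k j)| ≤ 1 := by
        rcases Real.sign_apply_eq (b k j) with h | h | h <;> simp [h]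
      rw [hz, abs_mul, abs_mul, abs_of_nonneg (by linarith [hδ1 k] : 0 ≤ δ k),
        abs_of_nonneg (Real.rpow_nonneg (abs_nonneg _) _)]
      have h2 : |b k j| ^ (δ k - 1) ≤ max |b k j| 1 ^ (δ k - 1) :=
        Real.rpow_le_rpow (abs_nonneg _) (le_max_left _ _) hd
      have h3 : 0 ≤ δ k * |b k j| ^ (δ k - 1) :=
        mul_nonneg (by linarith [hδ1 k]) (Real.rpow_nonneg (abs_nonneg _) _)
      calc _ ≤ δ k * |b k j| ^ (δ k - 1) * 1 := mul_le_mul_of_nonneg_left hs h3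
        _ ≤ _ := by
          rw [mul_one]
          exact mul_le_mul_of_nonneg_left h2 (by linarith [hδ1 k])
  have he' : (1 / (n : ℝ)) * ∑ i, weight γ (covar (D i))
      * (link.blip ψ (D i) - m (covar (D i)) (b k)) * covar (D i) j = lam * z := by linarith
  simp only [Function.comp_apply]
  rw [he', abs_mul, abs_of_nonneg hlam]
  exact mul_le_mul_of_nonneg_left hz' hlam

/-- A second order Taylor bound along a segment. -/
lemma abs_sub_sub_fderiv_le {q : ℕ} {F : (Fin q → ℝ) → ℝ} (hF : ContDiff ℝ 2 F) (b v : Fin q → ℝ)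
    {B : ℝ} (hB : ∀ t ∈ Set.Icc (0 : ℝ) 1, |iteratedFDeriv ℝ 2 F (b + t • v) ![v, v]| ≤ B) :
    |F (b + v) - F b - fderiv ℝ F b v| ≤ B := by
  have hline : ∀ t : ℝ, HasDerivAt (fun t : ℝ => b + t • v) v t := fun t => by
    simpa using ((hasDerivAt_id t).smul_const v).const_add b
  have hd1 : ∀ t : ℝ, HasDerivAt (fun t : ℝ => F (b + t • v)) (fderiv ℝ F (b + t • v) v) t :=
    fun t => ((hF.differentiable (by norm_num)).differentiableAt.hasFDerivAt).comp_hasDerivAt t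
      (hline t)
  have hF' : ContDiff ℝ 1 (fderiv ℝ F) := hF.fderiv_right (by norm_num)
  have hd2 : ∀ t : ℝ, HasDerivAt (fun t : ℝ => fderiv ℝ F (b + t • v) v)
      (iteratedFDeriv ℝ 2 F (b + t • v) ![v, v]) t := fun t => by
    have h1 := ((hF'.differentiable (by norm_num)).differentiableAt
      (x := b + t • v)).hasFDerivAt.comp_hasDerivAt t (hline t)
    have h2 := h1.clm_apply (hasDerivAt_const t v)
    simpa [iteratedFDeriv_two_apply] using h2
  have hB0 : 0 ≤ B := (abs_nonneg _).trans (hB 0 (by simp))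
  have hfirst : ∀ t ∈ Set.Icc (0 : ℝ) 1, |fderiv ℝ F (b + t • v) v - fderiv ℝ F b v| ≤ B := by
    intro t ht
    have := (convex_Icc (0 : ℝ) 1).norm_image_sub_le_of_norm_hasDerivWithin_le
      (fun s _ => (hd2 s).hasDerivWithinAt) hB (by simp : (0 : ℝ) ∈ Set.Icc (0 : ℝ) 1) ht
    simp only [zero_smul, add_zero, sub_zero, Real.norm_eq_abs, abs_of_nonneg ht.1] at this
    nlinarith [ht.2]
  have := (convex_Icc (0 : ℝ) 1).norm_image_sub_le_of_norm_hasDerivWithin_le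
    (f := fun t : ℝ => F (b + t • v) - t * fderiv ℝ F b v)
    (fun s _ => ((hd1 s).sub ((hasDerivAt_id s).mul_const _)).hasDerivWithinAt)
    (fun s hs => by simpa using hfirst s hs) (by simp : (0 : ℝ) ∈ Set.Icc (0 : ℝ) 1)
    (by simp : (1 : ℝ) ∈ Set.Icc (0 : ℝ) 1)
  simp only [zero_smul, add_zero, sub_zero, Real.norm_eq_abs, one_smul, one_mul, zero_mul,
    abs_one, mul_one] at this
  convert this using 2
  ring

/-! ### Sample means -/

section SampleMean

variable {n : ℕ}

lemma sampleMean_add (u v : Fin n → ℝ) :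
    (sampleMean fun i => u i + v i) = sampleMean u + sampleMean v := by
  simp only [sampleMean, Finset.sum_add_distrib, mul_add]

lemma sampleMean_sub (u v : Fin n → ℝ) :
    (sampleMean fun i => u i - v i) = sampleMean u - sampleMean v := by
  simp only [sampleMean, Finset.sum_sub_distrib, mul_sub]

lemma sampleMean_const_mul (k : ℝ) (u : Fin n → ℝ) :
    (sampleMean fun i => k * u i) = k * sampleMean u := by
  simp only [sampleMean, ← Finset.mul_sum]
  ring

lemma sampleMean_mono {u v : Fin n → ℝ} (h : ∀ i, u i ≤ v i) : sampleMean u ≤ sampleMean v :=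
  mul_le_mul_of_nonneg_left (Finset.sum_le_sum fun i _ => h i) (by positivity)

lemma sampleMean_nonneg {u : Fin n → ℝ} (h : ∀ i, 0 ≤ u i) : 0 ≤ sampleMean u :=
  mul_nonneg (by positivity) (Finset.sum_nonneg fun i _ => h i)

lemma sampleMean_const_le {k : ℝ} (hk : 0 ≤ k) : (sampleMean fun _ : Fin n => k) ≤ k := by
  rcases Nat.eq_zero_or_pos n with rfl | hn
  · simpa [sampleMean] using hk
  · have : (n : ℝ) ≠ 0 := by positivity
    simp [sampleMean, this]

lemma abs_sampleMean_le (u : Fin n → ℝ) : |sampleMean u| ≤ sampleMean fun i => |u i| := by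
  unfold sampleMean
  rw [abs_mul, abs_of_nonneg (by positivity : (0 : ℝ) ≤ 1 / n)]
  exact mul_le_mul_of_nonneg_left (Finset.abs_sum_le_sum_abs _ _) (by positivity)

/-- The Cauchy-Schwarz inequality for sample means. -/
lemma sampleMean_abs_mul_le (u v : Fin n → ℝ) :
    (sampleMean fun i => |u i * v i|)
      ≤ √(sampleMean fun i => u i ^ 2) * √(sampleMean fun i => v i ^ 2) := by
  rw [← Real.sqrt_mul (sampleMean_nonneg fun i => sq_nonneg _)]
  refine Real.le_sqrt_of_sq_le ?_
  have h := Finset.sum_mul_sq_le_sq_mul_sq Finset.univ (fun i => |u i|) (fun i => |v i|)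
  simp only [sq_abs] at h
  simp only [sampleMean, abs_mul]
  have h2 := mul_le_mul_of_nonneg_left h (show (0 : ℝ) ≤ (1 / n) ^ 2 by positivity)
  nlinarith [h2]

lemma measurable_sampleMean {Ω : Type*} [MeasurableSpace Ω] {f : Ω → Fin n → ℝ}
    (hf : ∀ i, Measurable fun ω => f ω i) : Measurable fun ω => sampleMean (f ω) :=
  (Finset.measurable_fun_sum _ fun i _ => hf i).const_mul _

lemma centredVariance_eq (hn : 0 < n) (u : Fin n → ℝ) :
    centredVariance u = uncentredVariance u - sampleMean u ^ 2 := by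
  have h : (fun i => (u i - sampleMean u) ^ 2)
      = fun i => (u i ^ 2 - 2 * sampleMean u * u i) + sampleMean u ^ 2 := by
    funext i
    ring
  have hc : (sampleMean fun _ : Fin n => sampleMean u ^ 2) = sampleMean u ^ 2 := by
    have : (n : ℝ) ≠ 0 := by positivity
    conv_lhs => rw [sampleMean]
    simp [this]
  unfold centredVariance uncentredVariance
  rw [h, sampleMean_add, sampleMean_sub, sampleMean_const_mul, hc]
  ring

lemma iteratedFDeriv_two_sum_mul_apply {q : ℕ} {f : Fin n → (Fin q → ℝ) → ℝ}
    (hf : ∀ i, ContDiff ℝ 2 (f i)) (k : Fin n → ℝ) (x : Fin q → ℝ) (w : Fin 2 → Fin q → ℝ) :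
    iteratedFDeriv ℝ 2 (fun β => ∑ i, k i * f i β) x w
      = ∑ i, k i * iteratedFDeriv ℝ 2 (f i) x w := by
  have h1 : iteratedFDeriv ℝ 2 (fun β => ∑ i, k i * f i β) x
      = ∑ i, iteratedFDeriv ℝ 2 (fun β => k i * f i β) x :=
    iteratedFDeriv_fun_sum_apply (fun i _ => (contDiff_const.mul (hf i)).contDiffAt)
  have h2 : ∀ i, iteratedFDeriv ℝ 2 (fun β => k i * f i β) x
      = k i • iteratedFDeriv ℝ 2 (f i) x := fun i =>
    iteratedFDeriv_const_smul_apply' (a := k i) (f := f i) ((hf i).contDiffAt)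
  rw [h1]
  simp only [h2, _root_.sum_apply, _root_.smul_apply, smul_eq_mul]

/-- Second order expansion of a weighted sample mean of predictions: the gradient term is bounded
by the duality between the maximum norm and the `ℓ₁` norm. -/
lemma sqrt_mul_abs_sampleMean_prediction_le {q : ℕ} {m : (Fin q → ℝ) → (Fin q → ℝ) → ℝ}
    (hm : ∀ l, ContDiff ℝ 2 (m l)) (L : Fin n → Fin q → ℝ) {a : Fin n → ℝ} (ha : ∀ i, |a i| ≤ 1)
    (b b' : Fin q → ℝ) :
    √n * |sampleMean fun i => a i * (m (L i) b' - m (L i) b)|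
      ≤ ‖fun j => (1 / √n) * ∑ i, a i * gradM m (L i) b j‖ * l1 (b' - b)
        + √n * ⨆ t : Set.Icc (0 : ℝ) 1, sampleMean fun i =>
            |curvM m (L i) (b + (t : ℝ) • (b' - b)) (b' - b)| := by
  set v := b' - b with hv
  set F : (Fin q → ℝ) → ℝ := fun β => ∑ i, (1 / (n : ℝ) * a i) * m (L i) β with hFdef
  have hF : ContDiff ℝ 2 F := ContDiff.sum fun i _ => contDiff_const.mul (hm _)
  have hFeq : (sampleMean fun i => a i * (m (L i) b' - m (L i) b)) = F (b + v) - F b := by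
    simp only [hFdef, hv, add_sub_cancel, sampleMean, Finset.mul_sum, ← Finset.sum_sub_distrib]
    exact Finset.sum_congr rfl fun i _ => by ring
  have hgrad : fderiv ℝ F b v = ∑ j, (1 / (n : ℝ) * ∑ i, a i * gradM m (L i) b j) * v j := by
    have h1 : HasFDerivAt F (∑ i, (1 / (n : ℝ) * a i) • fderiv ℝ (m (L i)) b) b :=
      HasFDerivAt.fun_sum fun i _ =>
        (((hm (L i)).differentiable (by norm_num)).differentiableAt.hasFDerivAt).const_mul _
    have h2 : ∀ i, fderiv ℝ (m (L i)) b v = ∑ j, gradM m (L i) b j * v j := fun i => by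
      conv_lhs => rw [pi_eq_sum_univ' v, map_sum]
      exact Finset.sum_congr rfl fun j _ => by rw [map_smul, smul_eq_mul, gradM, mul_comm]
    rw [h1.fderiv]
    simp only [_root_.sum_apply, _root_.smul_apply, smul_eq_mul, h2,
      Finset.mul_sum, Finset.sum_mul]
    rw [Finset.sum_comm]
    exact Finset.sum_congr rfl fun j _ => Finset.sum_congr rfl fun i _ => by ring
  have hcurv : ∀ x, iteratedFDeriv ℝ 2 F x ![v, v]
      = ∑ i, (1 / (n : ℝ) * a i) * curvM m (L i) x v := fun x =>
    iteratedFDeriv_two_sum_mul_apply (fun i => hm (L i)) _ x _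
  have hcont : Continuous fun t : ℝ => sampleMean fun i => |curvM m (L i) (b + t • v) v| := by
    refine continuous_const.mul (continuous_finsetSum _ fun i _ => ?_)
    have h1 : Continuous fun x => iteratedFDeriv ℝ 2 (m (L i)) x :=
      (hm (L i)).continuous_iteratedFDeriv (by norm_num)
    have h2 : Continuous fun t : ℝ => b + t • v := by fun_prop
    exact ((h1.comp h2).eval_const ![v, v]).abs
  have hbdd : BddAbove (Set.range fun t : Set.Icc (0 : ℝ) 1 =>
      sampleMean fun i => |curvM m (L i) (b + (t : ℝ) • v) v|) :=
    (isCompact_range (hcont.comp continuous_subtype_val)).bddAbove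
  have hT := abs_sub_sub_fderiv_le hF b v
    (B := ⨆ t : Set.Icc (0 : ℝ) 1, sampleMean fun i => |curvM m (L i) (b + (t : ℝ) • v) v|)
    (fun t ht => by
      refine le_trans ?_ (le_ciSup hbdd ⟨t, ht⟩)
      rw [hcurv]
      refine (Finset.abs_sum_le_sum_abs _ _).trans ?_
      rw [sampleMean, Finset.mul_sum]
      refine Finset.sum_le_sum fun i _ => ?_
      rw [abs_mul, abs_mul, abs_of_nonneg (by positivity : (0 : ℝ) ≤ 1 / n)]
      exact mul_le_mul_of_nonneg_right
        (mul_le_of_le_one_right (by positivity) (ha i)) (abs_nonneg _))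
  have hlin : √n * |fderiv ℝ F b v|
      ≤ ‖fun j => (1 / √n) * ∑ i, a i * gradM m (L i) b j‖ * l1 v := by
    rw [hgrad, ← abs_of_nonneg (Real.sqrt_nonneg n), ← abs_mul, abs_of_nonneg (Real.sqrt_nonneg n),
      Finset.mul_sum, l1, Finset.mul_sum]
    refine (Finset.abs_sum_le_sum_abs _ _).trans (Finset.sum_le_sum fun j _ => ?_)
    have h1 : √n * ((1 / (n : ℝ) * ∑ i, a i * gradM m (L i) b j) * v j)
        = ((1 / √n) * ∑ i, a i * gradM m (L i) b j) * v j := by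
      have : √(n : ℝ) * (1 / n) = 1 / √n := by
        rw [mul_one_div, Real.sqrt_div_self]
        simp
      rw [← this]
      ring
    rw [h1, abs_mul]
    exact mul_le_mul_of_nonneg_right
      (norm_le_pi_norm (fun j => (1 / √n) * ∑ i, a i * gradM m (L i) b j) j) (abs_nonneg _)
  rw [hFeq]
  have h3 : |F (b + v) - F b| ≤ |F (b + v) - F b - fderiv ℝ F b v| + |fderiv ℝ F b v| := by
    simpa using abs_add_le (F (b + v) - F b - fderiv ℝ F b v) (fderiv ℝ F b v)
  have h4 := mul_le_mul_of_nonneg_left (h3.trans (add_le_add_left hT _)) (Real.sqrt_nonneg n)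
  linarith

/-- Expansion of the mean of the products `(a - δ) (e - μ)` around the mean of the products `a e`.
The error `δ` is split into a linear part and a remainder `R` that is at most quadratic in `δ`,
and the factor `e` of the remainder into a bounded part `h` and the rest. -/
lemma sqrt_mul_abs_sampleMean_score_sub_le {a e μ δ h R : Fin n → ℝ} {c K : ℝ} (hc : 0 < c)
    (hδ : ∀ i, |δ i| ≤ 1) (hR : ∀ i, |R i| ≤ δ i ^ 2 / c) (hh : ∀ i, |h i| ≤ K) :
    √n * |(sampleMean fun i => (a i - δ i) * (e i - μ i)) - sampleMean fun i => a i * e i|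
      ≤ √n * |sampleMean fun i => a i * μ i|
        + √n * |sampleMean fun i => (δ i - R i) * (e i - μ i)|
        + √n * |sampleMean fun i => R i * (e i - h i)|
        + K / c * (√n * sampleMean fun i => δ i ^ 2)
        + 1 / c * (√n * (√(sampleMean fun i => δ i ^ 2) * √(sampleMean fun i => μ i ^ 2))) := by
  have hsq : ∀ i, δ i ^ 2 ≤ |δ i| := fun i => by
    rw [← sq_abs]
    nlinarith [hδ i, abs_nonneg (δ i)]
  have e1 : (sampleMean fun i => (a i - δ i) * (e i - μ i)) - (sampleMean fun i => a i * e i)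
      = -(sampleMean fun i => a i * μ i) - (sampleMean fun i => (δ i - R i) * (e i - μ i))
        - (sampleMean fun i => R i * (e i - h i)) - (sampleMean fun i => R i * h i)
        + sampleMean fun i => R i * μ i := by
    simp only [sampleMean, ← mul_neg, ← Finset.sum_neg_distrib, ← mul_sub, ← mul_add,
      ← Finset.sum_sub_distrib, ← Finset.sum_add_distrib]
    congr 1
    exact Finset.sum_congr rfl fun i _ => by ring
  have h4 : |sampleMean fun i => R i * h i| ≤ K / c * sampleMean fun i => δ i ^ 2 := by
    rw [← sampleMean_const_mul]
    refine (abs_sampleMean_le _).trans (sampleMean_mono fun i => ?_)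
    rw [abs_mul]
    calc |R i| * |h i| ≤ δ i ^ 2 / c * K :=
          mul_le_mul (hR i) (hh i) (abs_nonneg _) (by positivity)
      _ = K / c * δ i ^ 2 := by ring
  have h5 : |sampleMean fun i => R i * μ i|
      ≤ 1 / c * (√(sampleMean fun i => δ i ^ 2) * √(sampleMean fun i => μ i ^ 2)) := by
    refine (abs_sampleMean_le _).trans (le_trans ?_
      (mul_le_mul_of_nonneg_left (sampleMean_abs_mul_le δ μ) (by positivity)))
    rw [← sampleMean_const_mul]
    refine sampleMean_mono fun i => ?_
    rw [abs_mul, abs_mul]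
    calc |R i| * |μ i| ≤ |δ i| / c * |μ i| :=
          mul_le_mul_of_nonneg_right ((hR i).trans (by gcongr; exact hsq i)) (abs_nonneg _)
      _ = 1 / c * (|δ i| * |μ i|) := by ring
  have hs := Real.sqrt_nonneg (n : ℝ)
  rw [e1]
  have h6 : ∀ x1 x2 x3 x4 x5 : ℝ, |-x1 - x2 - x3 - x4 + x5| ≤ |x1| + |x2| + |x3| + |x4| + |x5| := by
    intro x1 x2 x3 x4 x5
    rw [← abs_neg x1, ← abs_neg x2, ← abs_neg x3, ← abs_neg x4]
    simp only [sub_eq_add_neg]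
    exact (abs_add_le _ _).trans (by
      gcongr
      exact (abs_add_le _ _).trans (by
        gcongr
        exact abs_add_three _ _ _))
  have h7 := mul_le_mul_of_nonneg_left (h6 (sampleMean fun i => a i * μ i)
    (sampleMean fun i => (δ i - R i) * (e i - μ i)) (sampleMean fun i => R i * (e i - h i))
    (sampleMean fun i => R i * h i) (sampleMean fun i => R i * μ i)) hs
  have h8 := mul_le_mul_of_nonneg_left h4 hs
  have h9 := mul_le_mul_of_nonneg_left h5 hs
  nlinarith

/-- The mean of the squares of `(a - δ) (e - μ)` is close to that of `a e`. -/
lemma abs_uncentredVariance_score_sub_le {a e μ δ : Fin n → ℝ}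
    (ha : ∀ i, |a i| ≤ 1) (hδ : ∀ i, |δ i| ≤ 1) :
    |(uncentredVariance fun i => (a i - δ i) * (e i - μ i)) - uncentredVariance fun i => a i * e i|
      ≤ 2 * √(uncentredVariance fun i => a i * e i)
          * √(6 * (sampleMean fun i => μ i ^ 2)
            + 3 * (√(sampleMean fun i => δ i ^ 2) * √(sampleMean fun i => e i ^ 4)))
        + (6 * (sampleMean fun i => μ i ^ 2)
            + 3 * (√(sampleMean fun i => δ i ^ 2) * √(sampleMean fun i => e i ^ 4))) := by
  set d : Fin n → ℝ := fun i => (a i - δ i) * (e i - μ i) - a i * e i with hd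
  set B := 6 * (sampleMean fun i => μ i ^ 2)
            + 3 * (√(sampleMean fun i => δ i ^ 2) * √(sampleMean fun i => e i ^ 4)) with hB
  have hdB : (sampleMean fun i => d i ^ 2) ≤ B := by
    have h1 := sampleMean_abs_mul_le δ (fun i => e i ^ 2)
    have h2 : (sampleMean fun i => d i ^ 2)
        ≤ sampleMean fun i => 6 * μ i ^ 2 + 3 * |δ i * e i ^ 2| := by
      refine sampleMean_mono fun i => ?_
      have hp : d i ^ 2 ≤ 3 * ((a i) ^ 2 * μ i ^ 2 + (δ i) ^ 2 * μ i ^ 2 + δ i ^ 2 * e i ^ 2) := by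
        simp only [hd]
        nlinarith [sq_nonneg (a i * μ i + δ i * μ i), sq_nonneg (-(a i * μ i) + δ i * e i),
          sq_nonneg (δ i * μ i + δ i * e i)]
      have ha2 : a i ^ 2 ≤ 1 := by rw [← sq_abs]; nlinarith [ha i, abs_nonneg (a i)]
      have hδ2 : δ i ^ 2 ≤ 1 := by rw [← sq_abs]; nlinarith [hδ i, abs_nonneg (δ i)]
      have hδ3 : δ i ^ 2 ≤ |δ i| := by rw [← sq_abs]; nlinarith [hδ i, abs_nonneg (δ i)]
      rw [abs_mul, abs_of_nonneg (sq_nonneg (e i))]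
      nlinarith [mul_le_mul_of_nonneg_right ha2 (sq_nonneg (μ i)),
        mul_le_mul_of_nonneg_right hδ2 (sq_nonneg (μ i)),
        mul_le_mul_of_nonneg_right hδ3 (sq_nonneg (e i))]
    rw [sampleMean_add, sampleMean_const_mul, sampleMean_const_mul] at h2
    simp only [← pow_mul, Nat.reduceMul] at h1
    linarith
  have e1 : (uncentredVariance fun i => (a i - δ i) * (e i - μ i))
        - (uncentredVariance fun i => a i * e i)
      = 2 * (sampleMean fun i => (a i * e i) * d i) + sampleMean fun i => d i ^ 2 := by
    simp only [uncentredVariance]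
    rw [← sampleMean_sub, ← sampleMean_const_mul, ← sampleMean_add]
    congr 1
    funext i
    simp only [hd]
    ring
  have h3 := (abs_sampleMean_le _).trans (sampleMean_abs_mul_le (fun i => a i * e i) d)
  have h4 := mul_le_mul_of_nonneg_left (Real.sqrt_le_sqrt hdB)
    (Real.sqrt_nonneg (uncentredVariance fun i => a i * e i))
  rw [e1]
  refine (abs_add_le _ _).trans ?_
  rw [abs_mul, abs_two, abs_of_nonneg (sampleMean_nonneg fun i => sq_nonneg (d i))]
  have h5 : (sampleMean fun i => (a i * e i) ^ 2) = uncentredVariance fun i => a i * e i := rfl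
  rw [h5] at h3
  linarith

end SampleMean

/-! ### A central limit theorem for triangular arrays -/

lemma norm_cexp_mul_I_sub_le (y : ℝ) :
    ‖Complex.exp (y * Complex.I) - (1 + y * Complex.I - (y : ℂ) ^ 2 / 2)‖ ≤ 4 * |y| ^ 3 := by
  have hy : ‖(y : ℂ) * Complex.I‖ = |y| := by simp
  rcases le_total |y| 1 with h | h
  · have := Complex.exp_bound (x := (y : ℂ) * Complex.I) (by rw [hy]; exact h) (n := 3)
      (by norm_num)
    rw [hy] at this
    have e : ∑ m ∈ Finset.range 3, ((y : ℂ) * Complex.I) ^ m / (m.factorial : ℂ)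
        = 1 + y * Complex.I - (y : ℂ) ^ 2 / 2 := by
      simp [Finset.sum_range_succ, mul_pow]
      ring
    rw [e] at this
    refine this.trans ?_
    rw [mul_comm]
    refine mul_le_mul_of_nonneg_right ?_ (by positivity)
    norm_num [Nat.factorial]
  · have h1 : ‖Complex.exp (y * Complex.I)‖ = 1 := Complex.norm_exp_ofReal_mul_I y
    have h2 : ‖(1 + y * Complex.I - (y : ℂ) ^ 2 / 2)‖ ≤ 1 + |y| + |y| ^ 2 / 2 := by
      refine (norm_sub_le _ _).trans (add_le_add ((norm_add_le _ _).trans ?_) ?_)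
      · simp
      · simp
    refine (norm_sub_le _ _).trans ?_
    rw [h1]
    have h3 : |y| ≤ |y| ^ 3 := le_self_pow₀ h (by norm_num)
    have h4 : |y| ^ 2 ≤ |y| ^ 3 := pow_le_pow_right₀ h (by norm_num)
    linarith

lemma abs_pow_three_le (x : ℝ) : |x| ^ 3 ≤ 1 + x ^ 4 := by
  have h : x ^ 4 = |x| ^ 4 := (Even.pow_abs (by decide) x).symm
  rw [h]
  rcases le_total |x| 1 with h1 | h1
  · have : |x| ^ 3 ≤ 1 := pow_le_one₀ (abs_nonneg x) h1
    have : 0 ≤ |x| ^ 4 := by positivity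
    linarith
  · linarith [pow_le_pow_right₀ h1 (show 3 ≤ 4 by norm_num)]

lemma sq_le_one_add_pow_four (x : ℝ) : x ^ 2 ≤ 1 + x ^ 4 := by
  nlinarith [sq_nonneg (x ^ 2 - 1), sq_nonneg (x ^ 2)]

lemma abs_le_one_add_pow_four (x : ℝ) : |x| ≤ 1 + x ^ 4 := by
  nlinarith [sq_nonneg (|x| - 1), sq_le_one_add_pow_four x, sq_abs x, sq_nonneg (x ^ 2 - 1)]

section MomentsOfOrderFour

variable {E : Type*} [MeasurableSpace E] {ν : Measure E} [IsProbabilityMeasure ν] {f : E → ℝ}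

lemma integrable_of_integrable_pow_four (hf : AEStronglyMeasurable f ν)
    (h4 : Integrable (fun x => f x ^ 4) ν) : Integrable f ν :=
  ((integrable_const (1 : ℝ)).add h4).mono' hf
    (ae_of_all _ fun x => by simpa using abs_le_one_add_pow_four (f x))

lemma integrable_sq_of_integrable_pow_four (hf : AEStronglyMeasurable f ν)
    (h4 : Integrable (fun x => f x ^ 4) ν) : Integrable (fun x => f x ^ 2) ν :=
  ((integrable_const (1 : ℝ)).add h4).mono' (hf.pow 2)
    (ae_of_all _ fun x => by simpa using sq_le_one_add_pow_four (f x))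

/-- Third order bound for the characteristic function of a standardised variable. -/
lemma norm_integral_cexp_sub_le (hf : AEStronglyMeasurable f ν)
    (h4 : Integrable (fun x => f x ^ 4) ν) (h0 : ∫ x, f x ∂ν = 0) (h1 : ∫ x, f x ^ 2 ∂ν = 1)
    (s : ℝ) :
    ‖(∫ x, Complex.exp ((s * f x : ℝ) * Complex.I) ∂ν) - (1 - (s : ℂ) ^ 2 / 2)‖
      ≤ 4 * |s| ^ 3 * (1 + ∫ x, f x ^ 4 ∂ν) := by
  have i1 := integrable_of_integrable_pow_four hf h4
  have i2 := integrable_sq_of_integrable_pow_four hf h4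
  have iexp : Integrable (fun x => Complex.exp ((s * f x : ℝ) * Complex.I)) ν := by
    refine (integrable_const (1 : ℝ)).mono' ?_ (ae_of_all _ fun x => ?_)
    · exact ((Complex.continuous_exp.comp (by fun_prop : Continuous fun y : ℝ =>
        ((s * y : ℝ) : ℂ) * Complex.I)).comp_aestronglyMeasurable hf)
    · rw [Complex.norm_exp_ofReal_mul_I]
  have iq : Integrable (fun x => ((1 - (s * f x) ^ 2 / 2 : ℝ) : ℂ)) ν := by
    have : Integrable (fun x => (1 - (s * f x) ^ 2 / 2 : ℝ)) ν := by
      simp only [mul_pow]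
      exact (integrable_const _).sub ((i2.const_mul _).div_const _)
    exact this.ofReal
  have il : Integrable (fun x => ((s * f x : ℝ) : ℂ) * Complex.I) ν :=
    ((i1.const_mul s).ofReal).mul_const _
  have e1 : (1 - (s : ℂ) ^ 2 / 2)
      = ∫ x, (((1 - (s * f x) ^ 2 / 2 : ℝ) : ℂ) + ((s * f x : ℝ) : ℂ) * Complex.I) ∂ν := by
    have h2 : ∫ x, ((s * f x : ℝ) : ℂ) ∂ν = ((∫ x, s * f x ∂ν : ℝ) : ℂ) := integral_ofReal
    have h3 : ∫ x, ((1 - (s * f x) ^ 2 / 2 : ℝ) : ℂ) ∂ν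
        = ((∫ x, (1 - (s * f x) ^ 2 / 2) ∂ν : ℝ) : ℂ) := integral_ofReal
    rw [integral_add iq il, integral_mul_const, h2, h3, integral_const_mul, h0]
    simp only [mul_pow]
    rw [integral_sub (integrable_const _) ((i2.const_mul _).div_const _), integral_div,
      integral_const_mul, h1]
    simp
  rw [e1, ← integral_sub iexp (by exact iq.add il)]
  refine (norm_integral_le_integral_norm _).trans ?_
  have hb : ∀ x, ‖Complex.exp ((s * f x : ℝ) * Complex.I)
      - (((1 - (s * f x) ^ 2 / 2 : ℝ) : ℂ) + ((s * f x : ℝ) : ℂ) * Complex.I)‖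
      ≤ 4 * |s| ^ 3 * (1 + f x ^ 4) := fun x => by
    have h := norm_cexp_mul_I_sub_le (s * f x)
    have e : (((1 - (s * f x) ^ 2 / 2 : ℝ) : ℂ) + ((s * f x : ℝ) : ℂ) * Complex.I)
        = 1 + ((s * f x : ℝ) : ℂ) * Complex.I - ((s * f x : ℝ) : ℂ) ^ 2 / 2 := by
      push_cast
      ring
    rw [e]
    refine h.trans ?_
    rw [abs_mul, mul_pow, ← mul_assoc]
    exact mul_le_mul_of_nonneg_left (abs_pow_three_le _) (by positivity)
  refine (integral_mono (iexp.sub (iq.add il)).norm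
    (by exact ((integrable_const (1 : ℝ)).add h4).const_mul _) hb).trans ?_
  rw [integral_const_mul, integral_add (integrable_const _) h4]
  simp

end MomentsOfOrderFour

lemma sqrt_mul_sampleMean {n : ℕ} (u : Fin n → ℝ) : √n * sampleMean u = ∑ i, 1 / √n * u i := by
  rw [sampleMean, ← mul_assoc, mul_one_div, Real.sqrt_div_self, ← Finset.mul_sum]
  simp

section Array

variable {E : ℕ → Type} [∀ n, MeasurableSpace (E n)] (ν : ∀ n, Measure (E n))
  [∀ n, IsProbabilityMeasure (ν n)] {f : ∀ n, E n → ℝ}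

/-- Lyapunov's central limit theorem for the row sums of a triangular array with independent and
identically distributed entries, for symmetric intervals. -/
lemma tendsto_measure_abs_sqrt_mul_sampleMean_le (hf : ∀ n, Measurable (f n))
    (h4 : ∀ n, Integrable (fun x => f n x ^ 4) (ν n)) {K : ℝ}
    (hK : ∀ᶠ n in atTop, ∫ x, f n x ^ 4 ∂ν n ≤ K) (h0 : ∀ᶠ n in atTop, ∫ x, f n x ∂ν n = 0)
    (h1 : ∀ᶠ n in atTop, ∫ x, f n x ^ 2 ∂ν n = 1) (s : ℝ) :
    Tendsto (fun n => (Measure.pi fun _ : Fin n => ν n).real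
      {D | |√n * sampleMean fun i => f n (D i)| ≤ s}) atTop
      (𝓝 ((gaussianReal 0 1).real {x | |x| ≤ s})) := by
  have hT : ∀ n, Measurable fun D : Fin n → E n => √n * sampleMean fun i => f n (D i) := fun n =>
    (measurable_sampleMean fun i => (hf n).comp (measurable_pi_apply i)).const_mul _
  let P : ℕ → ProbabilityMeasure ℝ := fun n =>
    ⟨(Measure.pi fun _ : Fin n => ν n).map fun D => √n * sampleMean fun i => f n (D i),
      Measure.isProbabilityMeasure_map (hT n).aemeasurable⟩
  let G : ProbabilityMeasure ℝ := ⟨gaussianReal 0 1, inferInstance⟩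
  have hchar : ∀ n t, charFun (P n : Measure ℝ) t
      = (∫ x, Complex.exp ((1 / √n * t * f n x : ℝ) * Complex.I) ∂ν n) ^ n := by
    intro n t
    have : charFun (P n : Measure ℝ) t
        = ∫ D, Complex.exp (t * (√n * sampleMean fun i => f n (D i) : ℝ)
        * Complex.I) ∂(Measure.pi fun _ : Fin n => ν n) := by
      rw [charFun_apply_real]
      exact integral_map (f := fun x : ℝ => Complex.exp (t * x * Complex.I)) (hT n).aemeasurable
        (by fun_prop : Continuous fun x : ℝ => Complex.exp (t * x * Complex.I)).aestronglyMeasurable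
    rw [this]
    have hpow := integral_fintype_prod_eq_pow (ι := Fin n) (μ := ν n)
      (fun x => Complex.exp ((1 / √n * t * f n x : ℝ) * Complex.I))
    rw [Fintype.card_fin] at hpow
    rw [← hpow]
    refine integral_congr_ae (ae_of_all _ fun D => ?_)
    simp only
    rw [← Complex.exp_sum, sqrt_mul_sampleMean, ← Finset.sum_mul]
    push_cast
    rw [Finset.mul_sum]
    congr 2
    exact Finset.sum_congr rfl fun i _ => by ring
  have hconv : Tendsto P atTop (𝓝 G) := by
    refine ProbabilityMeasure.tendsto_of_tendsto_charFun fun t => ?_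
    have hG : charFun (G : Measure ℝ) t = Complex.exp (-(t : ℂ) ^ 2 / 2) := by
      change charFun (gaussianReal 0 1) t = _
      rw [charFun_gaussianReal]
      congr 1
      push_cast
      ring
    rw [hG]
    simp only [hchar]
    refine Complex.tendsto_pow_exp_of_isLittleO_sub_add_div _ ?_
    have hlo : (fun n : ℕ => 1 / (√n : ℝ) * (1 / (n : ℝ))) =o[atTop] fun n : ℕ => 1 / (n : ℝ) := by
      have h : (fun n : ℕ => 1 / (√n : ℝ)) =o[atTop] fun _ => (1 : ℝ) := by
        rw [isLittleO_one_iff]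
        exact tendsto_const_nhds.div_atTop
          (Real.tendsto_sqrt_atTop.comp tendsto_natCast_atTop_atTop)
      simpa using h.mul_isBigO (isBigO_refl (fun n : ℕ => 1 / (n : ℝ)) atTop)
    have hbig : (fun n : ℕ => (∫ x, Complex.exp ((1 / √n * t * f n x : ℝ) * Complex.I) ∂ν n)
        - (1 + -(t : ℂ) ^ 2 / 2 / n)) =O[atTop] fun n : ℕ => 1 / (√n : ℝ) * (1 / (n : ℝ)) := by
      refine IsBigO.of_bound (4 * |t| ^ 3 * (1 + K)) ?_
      filter_upwards [hK, h0, h1] with n hK h0 h1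
      have h := norm_integral_cexp_sub_le (hf n).aestronglyMeasurable (h4 n) h0 h1 (1 / √n * t)
      have hsq : (√n : ℝ) ^ 2 = n := Real.sq_sqrt (by positivity)
      have e : (1 - (((1 / √n * t : ℝ)) : ℂ) ^ 2 / 2) = 1 + -(t : ℂ) ^ 2 / 2 / n := by
        have : ((1 / √n * t : ℝ)) ^ 2 = t ^ 2 / n := by
          rw [mul_pow, div_pow, hsq]
          ring
        rw [← Complex.ofReal_pow, this]
        push_cast
        ring
      rw [e] at h
      refine h.trans ?_
      have e2 : |1 / √n * t| ^ 3 = |t| ^ 3 * (1 / √n * (1 / n)) := by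
        rw [abs_mul, mul_pow, abs_of_nonneg (by positivity : (0 : ℝ) ≤ 1 / √n)]
        nth_rewrite 3 [← hsq]
        ring
      rw [e2, Real.norm_of_nonneg (by positivity)]
      have : 0 ≤ |t| ^ 3 * (1 / √(n : ℝ) * (1 / n)) := by positivity
      nlinarith
    have hfin := hbig.trans_isLittleO hlo
    rw [← isLittleO_norm_right] at hfin ⊢
    simpa using hfin
  have hfr : (G : Measure ℝ) (frontier {x : ℝ | |x| ≤ s}) = 0 := by
    change gaussianReal 0 1 _ = 0
    have := nullSingletonClass_gaussianReal (μ := 0) (v := 1) one_ne_zero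
    refine measure_mono_null (t := {s, -s}) ?_ (Set.Finite.measure_zero (Set.toFinite _) _)
    refine (frontier_le_subset_eq continuous_abs continuous_const).trans fun x hx => ?_
    rcases abs_choice x with h | h
    · left; exact h ▸ hx
    · right
      have hx' : |x| = s := hx
      rw [h] at hx'
      rw [Set.mem_singleton_iff]
      linarith
  have h := ProbabilityMeasure.tendsto_measure_of_null_frontier_of_tendsto' hconv hfr
  have h' := (ENNReal.tendsto_toReal (measure_ne_top _ _)).comp h
  refine h'.congr fun n => ?_
  simp only [Function.comp_apply, measureReal_def]
  congr 1
  exact Measure.map_apply (hT n) (measurableSet_le measurable_abs measurable_const)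

end Array

/-! ### The critical value -/

/-- The distribution function of the absolute value of a standard Gaussian is continuous. -/
lemma continuous_gaussian_abs_le : Continuous fun s => (gaussianReal 0 1).real {x | |x| ≤ s} := by
  have := nullSingletonClass_gaussianReal (μ := 0) (v := 1) one_ne_zero
  have hms : ∀ s : ℝ, MeasurableSet {x : ℝ | |x| ≤ s} := fun s =>
    measurableSet_le measurable_abs measurable_const
  have heq : (fun s => (gaussianReal 0 1).real {x | |x| ≤ s})
      = fun s => ∫ x, Set.indicator {x : ℝ | |x| ≤ s} (fun _ => (1 : ℝ)) x ∂gaussianReal 0 1 := by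
    funext s
    rw [integral_indicator_const _ (hms s)]
    simp
  rw [heq, continuous_iff_continuousAt]
  intro s
  have hnull : ∀ᵐ x ∂gaussianReal 0 1, |x| ≠ s := by
    rw [ae_iff]
    refine measure_mono_null (t := {s, -s}) ?_ (Set.Finite.measure_zero (Set.toFinite _) _)
    intro x hx
    have hx' : |x| = s := not_not.mp hx
    rcases abs_choice x with h | h
    · left; exact h ▸ hx'
    · right; rw [Set.mem_singleton_iff]; linarith
  refine continuousAt_of_dominated (bound := fun _ => 1)
    (Eventually.of_forall fun t => (measurable_const.indicator (hms t)).aestronglyMeasurable)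
    (Eventually.of_forall fun t => ae_of_all _ fun x => ?_) (integrable_const _) ?_
  · refine (norm_indicator_le_norm_self _ _).trans (by simp)
  · filter_upwards [hnull] with x hx
    rcases lt_or_gt_of_ne hx with h | h
    · refine (continuousAt_const (y := (1 : ℝ))).congr ?_
      filter_upwards [lt_mem_nhds h] with t ht
      rw [Set.indicator_of_mem (by exact ht.le)]
    · refine (continuousAt_const (y := (0 : ℝ))).congr ?_
      filter_upwards [gt_mem_nhds h] with t ht
      rw [Set.indicator_of_notMem (by simpa using ht)]

lemma chiSqOne_real_Ioi {c : ℝ} (hc : 0 ≤ c) :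
    chiSqOne.real (Set.Ioi c) = 1 - (gaussianReal 0 1).real {x | |x| ≤ √c} := by
  rw [← probReal_compl_eq_one_sub (measurableSet_le measurable_abs measurable_const), chiSqOne,
    map_measureReal_apply (by fun_prop) measurableSet_Ioi]
  congr 1
  ext x
  simp only [Set.mem_preimage, Set.mem_Ioi, Set.mem_compl_iff, Set.mem_ofPred_eq, not_le]
  rw [← Real.sqrt_sq_eq_abs, Real.sqrt_lt_sqrt_iff hc]

/-- The chi-squared critical value is positive, and its square root is the two-sided critical value
of the standard Gaussian distribution. -/
lemma chiSqCrit_spec {α : ℝ} (hα : α ∈ Set.Ioo (0 : ℝ) 1) :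
    0 < chiSqCrit α ∧ (gaussianReal 0 1).real {x | |x| ≤ √(chiSqCrit α)} = 1 - α := by
  have := nullSingletonClass_gaussianReal (μ := 0) (v := 1) one_ne_zero
  set F : ℝ → ℝ := fun s => (gaussianReal 0 1).real {x | |x| ≤ s} with hF
  have hFc : Continuous F := continuous_gaussian_abs_le
  have hF0 : F 0 = 0 := by
    have : {x : ℝ | |x| ≤ 0} = {0} := by
      ext x
      simp
    simp only [hF, this, measureReal_def, measure_singleton, ENNReal.toReal_zero]
  have hset : {c : ℝ | chiSqOne.real (Set.Ioi c) ≤ α} = {c : ℝ | 0 ≤ c ∧ 1 - α ≤ F (√c)} := by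
    ext c
    simp only [Set.mem_ofPred_eq]
    rcases le_or_gt 0 c with hc | hc
    · rw [chiSqOne_real_Ioi hc]
      simp only [hc, true_and, hF]
      constructor <;> intro h <;> linarith
    · have h1 : chiSqOne.real (Set.Ioi c) = 1 := by
        rw [chiSqOne, map_measureReal_apply (by fun_prop) measurableSet_Ioi]
        have : (fun x : ℝ => x ^ 2) ⁻¹' Set.Ioi c = Set.univ := by
          ext x
          simp only [Set.mem_preimage, Set.mem_Ioi, Set.mem_univ, iff_true]
          exact hc.trans_le (sq_nonneg x)
        rw [this, probReal_univ]
      rw [h1]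
      constructor
      · intro h; linarith [hα.2]
      · intro h; linarith [h.1]
  have hclosed : IsClosed {c : ℝ | 0 ≤ c ∧ 1 - α ≤ F (√c)} :=
    (isClosed_le continuous_const continuous_id).inter
      (isClosed_le continuous_const (hFc.comp Real.continuous_sqrt))
  have hne : {c : ℝ | 0 ≤ c ∧ 1 - α ≤ F (√c)}.Nonempty := by
    have hU : (⋃ k : ℕ, {x : ℝ | |x| ≤ k}) = Set.univ := by
      ext x
      simpa using exists_nat_ge |x|
    have hlim : Tendsto (fun k : ℕ => F k) atTop (𝓝 1) := by
      have h := tendsto_measure_iUnion_atTop (μ := gaussianReal 0 1)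
        (s := fun k : ℕ => {x : ℝ | |x| ≤ k})
        (fun i j hij x (hx : |x| ≤ i) => show |x| ≤ j from hx.trans (by exact_mod_cast hij))
      rw [hU, measure_univ] at h
      have h' := (ENNReal.tendsto_toReal ENNReal.one_ne_top).comp h
      rwa [ENNReal.toReal_one] at h'
    obtain ⟨k, hk⟩ := (hlim.eventually (lt_mem_nhds (show 1 - α < 1 by linarith [hα.1]))).exists
    exact ⟨(k : ℝ) ^ 2, by positivity, by rw [Real.sqrt_sq (by positivity)]; exact hk.le⟩
  have hbdd : BddBelow {c : ℝ | 0 ≤ c ∧ 1 - α ≤ F (√c)} := ⟨0, fun c hc => hc.1⟩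
  have hmem := hclosed.csInf_mem hne hbdd
  have hq : chiSqCrit α = sInf {c : ℝ | 0 ≤ c ∧ 1 - α ≤ F (√c)} := by rw [chiSqCrit, hset]
  rw [← hq] at hmem
  have hpos : 0 < chiSqCrit α := by
    refine lt_of_le_of_ne hmem.1 fun h => ?_
    have h2 := hmem.2
    rw [← h, Real.sqrt_zero, hF0] at h2
    linarith [hα.2]
  refine ⟨hpos, le_antisymm ?_ hmem.2⟩
  by_contra! hlt
  have hev : ∀ᶠ c in 𝓝 (chiSqCrit α), 1 - α < F (√c) ∧ 0 < c :=
    ((hFc.comp Real.continuous_sqrt).continuousAt.eventually (lt_mem_nhds hlt)).and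
      (lt_mem_nhds hpos)
  obtain ⟨c, ⟨hc1, hc2⟩, hc3⟩ := (hev.filter_mono nhdsWithin_le_nhds |>.and
    (self_mem_nhdsWithin : Set.Iio (chiSqCrit α) ∈ 𝓝[<] chiSqCrit α)).exists
  have : chiSqCrit α ≤ c := by
    rw [hq]
    exact csInf_le hbdd ⟨hc2.le, hc1.le⟩
  exact absurd hc3 (not_lt.mpr this)

/-! ### Orthogonality given the covariates of the whole sample -/

section Orthogonality

variable {E Z : Type*} [MeasurableSpace E] [MeasurableSpace Z]

/-- `ξ` has mean zero given `z`, in the form of orthogonality to bounded functions of `z`. -/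
def CondMeanZero (ν : Measure E) (z : E → Z) (ξ : E → ℝ) : Prop :=
  ∀ g : Z → ℝ, Measurable g → (∃ B, ∀ x, |g x| ≤ B) → ∫ x, g (z x) * ξ x ∂ν = 0

variable {ν : Measure E} [IsProbabilityMeasure ν] {z : E → Z} {ξ : E → ℝ} {n : ℕ}

lemma integrable_mul_mul (hz : Measurable z) (hξ : Measurable ξ)
    (hξ2 : Integrable (fun x => ξ x ^ 2) ν) {F : (Fin n → Z) → ℝ} (hF : Measurable F) {B : ℝ}
    (hB : ∀ x, |F x| ≤ B) (i j : Fin n) :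
    Integrable (fun D : Fin n → E => F (fun k => z (D k)) * (ξ (D i) * ξ (D j)))
      (Measure.pi fun _ => ν) := by
  have h2 : ∀ k : Fin n, Integrable (fun D : Fin n → E => ξ (D k) ^ 2) (Measure.pi fun _ => ν) :=
    fun k => integrable_comp_eval (μ := fun _ : Fin n => ν) (i := k) hξ2
  refine (((h2 i).add (h2 j)).const_mul B).mono' ?_ (ae_of_all _ fun D => ?_)
  · exact ((hF.comp (measurable_pi_lambda _ fun k => hz.comp (measurable_pi_apply k))).mul
      ((hξ.comp (measurable_pi_apply i)).mul
        (hξ.comp (measurable_pi_apply j)))).aestronglyMeasurable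
  · have h3 : |ξ (D i) * ξ (D j)| ≤ ξ (D i) ^ 2 + ξ (D j) ^ 2 := by
      rw [abs_le]
      constructor <;> nlinarith [sq_nonneg (ξ (D i) + ξ (D j)), sq_nonneg (ξ (D i) - ξ (D j)),
        sq_nonneg (ξ (D i)), sq_nonneg (ξ (D j))]
    rw [Real.norm_eq_abs, abs_mul]
    exact mul_le_mul (hB _) h3 (abs_nonneg _) ((abs_nonneg _).trans (hB fun k => z (D k)))

/-- Distinct observations are uncorrelated given `z` of the whole sample: the coordinate `i` is
integrated first. -/
lemma integral_mul_mul_eq_zero (hz : Measurable z) (hξ : Measurable ξ)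
    (hξ2 : Integrable (fun x => ξ x ^ 2) ν) (h0 : CondMeanZero ν z ξ) {F : (Fin n → Z) → ℝ}
    (hF : Measurable F) {B : ℝ} (hB : ∀ x, |F x| ≤ B) {i j : Fin n} (hij : i ≠ j) :
    ∫ D : Fin n → E, F (fun k => z (D k)) * (ξ (D i) * ξ (D j)) ∂(Measure.pi fun _ => ν) = 0 := by
  cases n with
  | zero => exact i.elim0
  | succ n =>
    obtain ⟨j', rfl⟩ := Fin.exists_succAbove_eq hij.symm
    have hint := integrable_mul_mul hz hξ hξ2 hF hB i (i.succAbove j')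
    have hmp := (measurePreserving_piFinSuccAbove (fun _ : Fin (n + 1) => ν) i).symm
    have hint' := (hmp.integrable_comp_emb (MeasurableEquiv.measurableEmbedding _)).mpr hint
    simp only [Function.comp_def] at hint'
    rw [← hmp.integral_comp', integral_prod_symm _ hint']
    refine integral_eq_zero_of_ae (ae_of_all _ fun y => ?_)
    simp only [MeasurableEquiv.piFinSuccAbove_symm_apply, Fin.insertNthEquiv, Equiv.coe_fn_mk,
      Fin.insertNth_apply_same, Fin.insertNth_apply_succAbove, Pi.zero_apply]
    have hfun : ∀ x : E, (fun k => z (Fin.insertNth (α := fun _ => E) i x y k))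
        = Fin.insertNth (α := fun _ => Z) i (z x) (fun k => z (y k)) := fun x => by
      funext k
      refine Fin.succAboveCases i ?_ (fun k => ?_) k <;> simp
    have hins : Measurable fun u : Z => Fin.insertNth (α := fun _ => Z) i u (fun k => z (y k)) := by
      refine measurable_pi_lambda _ fun k => ?_
      refine Fin.succAboveCases i ?_ (fun k => ?_) k
      · simpa using measurable_id'
      · simp
    have h := h0 (fun u => F (Fin.insertNth (α := fun _ => Z) i u (fun k => z (y k))))
      (hF.comp hins) ⟨B, fun _ => hB _⟩
    simp only [hfun]
    simp only [← mul_assoc]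
    rw [integral_mul_const, h, zero_mul]

/-- Conditional variance of a sum whose coefficients depend on `z` of the whole sample. -/
lemma integral_sq_sum_mul (hz : Measurable z) (hξ : Measurable ξ)
    (hξ2 : Integrable (fun x => ξ x ^ 2) ν) (h0 : CondMeanZero ν z ξ)
    {F : Fin n → (Fin n → Z) → ℝ} (hF : ∀ i, Measurable (F i)) {B : ℝ} (hB : ∀ i x, |F i x| ≤ B) :
    Integrable (fun D : Fin n → E => (∑ i, F i (fun k => z (D k)) * ξ (D i)) ^ 2)
        (Measure.pi fun _ => ν) ∧
      ∫ D : Fin n → E, (∑ i, F i (fun k => z (D k)) * ξ (D i)) ^ 2 ∂(Measure.pi fun _ => ν)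
        = ∫ D : Fin n → E, ∑ i, (F i (fun k => z (D k)) * ξ (D i)) ^ 2
            ∂(Measure.pi fun _ => ν) := by
  have hFF : ∀ i j, Measurable fun x => F i x * F j x := fun i j => (hF i).mul (hF j)
  have hBB : ∀ i j x, |F i x * F j x| ≤ B * B := fun i j x => by
    rw [abs_mul]
    exact mul_le_mul (hB i x) (hB j x) (abs_nonneg _) ((abs_nonneg _).trans (hB i x))
  have hint := fun i j => integrable_mul_mul hz hξ hξ2 (hFF i j) (hBB i j) i j
  have hexp : ∀ D : Fin n → E, (∑ i, F i (fun k => z (D k)) * ξ (D i)) ^ 2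
      = ∑ i, ∑ j, F i (fun k => z (D k)) * F j (fun k => z (D k)) * (ξ (D i) * ξ (D j)) := fun D => by
    rw [sq, Finset.sum_mul_sum]
    exact Finset.sum_congr rfl fun i _ => Finset.sum_congr rfl fun j _ => by ring
  simp only [hexp]
  refine ⟨integrable_finsetSum _ fun i _ => integrable_finsetSum _ fun j _ => hint i j, ?_⟩
  have hdiag : ∀ i, ∀ D : Fin n → E, (F i (fun k => z (D k)) * ξ (D i)) ^ 2
      = F i (fun k => z (D k)) * F i (fun k => z (D k)) * (ξ (D i) * ξ (D i)) := fun i D => by ring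
  simp only [hdiag]
  rw [integral_finsetSum _ fun i _ => integrable_finsetSum _ fun j _ => hint i j,
    integral_finsetSum _ fun i _ => hint i i]
  refine Finset.sum_congr rfl fun i _ => ?_
  rw [integral_finsetSum _ fun j _ => hint i j]
  refine Finset.sum_eq_single i (fun j _ hji => ?_) (by simp)
  exact integral_mul_mul_eq_zero hz hξ hξ2 h0 (hFF i j) (hBB i j) hji.symm

lemma integral_sampleMean_comp {f : E → ℝ} (hf : Integrable f ν) (hn : 0 < n) :
    Integrable (fun D : Fin n → E => sampleMean fun i => f (D i)) (Measure.pi fun _ => ν) ∧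
      ∫ D : Fin n → E, (sampleMean fun i => f (D i)) ∂(Measure.pi fun _ => ν) = ∫ x, f x ∂ν := by
  have hi : ∀ i : Fin n, Integrable (fun D : Fin n → E => f (D i)) (Measure.pi fun _ => ν) :=
    fun i => integrable_comp_eval (μ := fun _ : Fin n => ν) hf
  refine ⟨(integrable_finsetSum _ fun i _ => hi i).const_mul _, ?_⟩
  have hv : ∀ i : Fin n, ∫ D : Fin n → E, f (D i) ∂(Measure.pi fun _ => ν) = ∫ x, f x ∂ν :=
    fun i => integral_comp_eval (μ := fun _ : Fin n => ν) hf.aestronglyMeasurable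
  simp only [sampleMean]
  rw [integral_const_mul, integral_finsetSum _ fun i _ => hi i]
  simp only [hv]
  have : (n : ℝ) ≠ 0 := by positivity
  simp [this]

/-- The variance of a sample mean. -/
lemma integral_sq_sampleMean {f : E → ℝ} (hf : Measurable f)
    (hf2 : Integrable (fun x => f x ^ 2) ν) (h0 : ∫ x, f x ∂ν = 0) (hn : 0 < n) :
    Integrable (fun D : Fin n → E => (sampleMean fun i => f (D i)) ^ 2) (Measure.pi fun _ => ν) ∧
      ∫ D : Fin n → E, (sampleMean fun i => f (D i)) ^ 2 ∂(Measure.pi fun _ => ν)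
        = (∫ x, f x ^ 2 ∂ν) / n := by
  have hc : CondMeanZero ν (fun _ => ()) f := fun g _ _ => by rw [integral_const_mul, h0, mul_zero]
  obtain ⟨h1, h2⟩ := integral_sq_sum_mul (n := n) measurable_const hf hf2 hc
    (F := fun _ _ => 1 / (n : ℝ)) (fun _ => measurable_const) (B := |1 / (n : ℝ)|)
    (fun _ _ => le_rfl)
  simp only [← Finset.mul_sum] at h1 h2
  refine ⟨h1, h2.trans ?_⟩
  have h3 := (integral_sampleMean_comp (n := n) hf2 hn).2
  simp only [sampleMean] at h3
  simp only [mul_pow, ← Finset.mul_sum]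
  rw [← h3, integral_const_mul, integral_const_mul]
  ring

end Orthogonality

/-! ### Conditional moments of one observation -/

section Measurability

variable {q : ℕ}

lemma measurable_outcome : Measurable (outcome : Obs q → ℝ) := measurable_fst

lemma measurable_exposure : Measurable (exposure : Obs q → ℝ) := measurable_fst.comp measurable_snd

lemma measurable_covar : Measurable (covar : Obs q → Fin q → ℝ) :=
  measurable_snd.comp measurable_snd

lemma measurable_exposure_covar : Measurable fun o : Obs q => (exposure o, covar o) :=
  measurable_exposure.prodMk measurable_covar

lemma sigmaAL_le : sigmaAL q ≤ inferInstanceAs (MeasurableSpace (Obs q)) :=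
  measurable_exposure_covar.comap_le

lemma sigmaL_le : sigmaL q ≤ inferInstanceAs (MeasurableSpace (Obs q)) := measurable_covar.comap_le

lemma measurable_dotProduct (γ : Fin q → ℝ) : Measurable fun l : Fin q → ℝ => γ ⬝ᵥ l :=
  (Finset.measurable_fun_sum _ fun j _ => (measurable_pi_apply j).const_mul _)

lemma measurable_propensity (γ : Fin q → ℝ) : Measurable (propensity γ) :=
  Real.sigmoid_monotone.measurable.comp (measurable_dotProduct γ)

lemma measurable_blip (link : Link) (ψ : ℝ) : Measurable (link.blip ψ : Obs q → ℝ) := by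
  cases link with
  | identity => exact measurable_outcome.sub (measurable_exposure.const_mul ψ)
  | log => exact measurable_outcome.mul (measurable_exposure.const_mul ψ).neg.exp

lemma propensity_nonneg (γ l : Fin q → ℝ) : 0 ≤ propensity γ l := Real.sigmoid_nonneg _

lemma propensity_le_one (γ l : Fin q → ℝ) : propensity γ l ≤ 1 := Real.sigmoid_le_one _

lemma abs_sub_propensity_le {x : ℝ} (hx : x = 0 ∨ x = 1) (γ l : Fin q → ℝ) :
    |x - propensity γ l| ≤ 1 := by
  have h0 := propensity_nonneg γ l
  have h1 := propensity_le_one γ l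
  rw [abs_le]
  rcases hx with rfl | rfl <;> constructor <;> linarith

end Measurability

section CondExp

variable {Ω : Type*} {m m0 : MeasurableSpace Ω} {ν : Measure Ω} [IsProbabilityMeasure ν]

lemma integral_mul_condExp (hm : m ≤ m0) {X Y : Ω → ℝ} (hX : StronglyMeasurable[m] X)
    (hXY : Integrable (fun ω => X ω * Y ω) ν) (hY : Integrable Y ν) :
    ∫ ω, X ω * Y ω ∂ν = ∫ ω, X ω * (ν[Y | m]) ω ∂ν := by
  rw [← integral_condExp hm (f := fun ω => X ω * Y ω)]
  exact integral_congr_ae (condExp_mul_of_stronglyMeasurable_left hX hXY hY)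

lemma condExp_pow_four_le (hm : m ≤ m0) {X : Ω → ℝ} (hX : Integrable X ν)
    (hX4 : Integrable (fun ω => X ω ^ 4) ν) :
    ∀ᵐ ω ∂ν, (ν[X | m]) ω ^ 4 ≤ (ν[fun ω => X ω ^ 4 | m]) ω :=
  ConvexOn.map_condExp_le_univ (φ := fun x : ℝ => x ^ 4) hm (Even.convexOn_pow (by decide))
    (continuous_pow 4).lowerSemicontinuous hX hX4

end CondExp

namespace Dgp

variable {q : ℕ} {P : Dgp q} {link : Link} {m : (Fin q → ℝ) → (Fin q → ℝ) → ℝ}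

instance : IsProbabilityMeasure P.law := P.isProb

instance (n : ℕ) : IsProbabilityMeasure (P.sampleLaw n) := by
  unfold sampleLaw
  infer_instance

lemma ae_sampleLaw {Q : Obs q → Prop} (h : ∀ᵐ o ∂P.law, Q o) (n : ℕ) :
    ∀ᵐ D ∂P.sampleLaw n, ∀ i, Q (D i) :=
  eventually_all.mpr fun _ => Measure.tendsto_eval_ae_ae.eventually h

lemma measurable_resid (hm : ∀ β, Measurable fun l => m l β) : Measurable (P.resid link m) :=
  (measurable_blip link P.psi).sub ((hm P.bet).comp measurable_covar)

lemma measurable_noise : Measurable fun o : Obs q => exposure o - propensity P.gam (covar o) :=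
  measurable_exposure.sub ((measurable_propensity P.gam).comp measurable_covar)

lemma ae_abs_noise_le (hA : P.LogisticExposureModel) :
    ∀ᵐ o ∂P.law, |exposure o - propensity P.gam (covar o)| ≤ 1 := by
  filter_upwards [hA.1] with o ho using abs_sub_propensity_le ho _ _

lemma integrable_resid_pow_four (hm : ∀ β, Measurable fun l => m l β) {r : ℝ} (hr : 4 < r)
    (h : Integrable (fun o => |P.resid link m o| ^ r) P.law) :
    Integrable (fun o => P.resid link m o ^ 4) P.law ∧
      ∫ o, P.resid link m o ^ 4 ∂P.law ≤ 1 + ∫ o, |P.resid link m o| ^ r ∂P.law := by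
  have hb : ∀ x : ℝ, x ^ 4 ≤ 1 + |x| ^ r := fun x => by
    have hx : x ^ 4 = |x| ^ (4 : ℝ) := by
      rw [← Even.pow_abs (by decide : Even 4) x]
      norm_cast
    have hr0 : 0 ≤ |x| ^ r := Real.rpow_nonneg (abs_nonneg _) _
    rw [hx]
    rcases le_total |x| 1 with h1 | h1
    · linarith [Real.rpow_le_one (abs_nonneg x) h1 (by norm_num : (0 : ℝ) ≤ 4)]
    · linarith [Real.rpow_le_rpow_of_exponent_le h1 hr.le]
  have hint : Integrable (fun o => P.resid link m o ^ 4) P.law := by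
    refine ((integrable_const (1 : ℝ)).add h).mono'
      ((measurable_resid hm).pow_const 4).aestronglyMeasurable (ae_of_all _ fun o => ?_)
    rw [Real.norm_of_nonneg (by positivity)]
    exact hb _
  refine ⟨hint, (integral_mono hint (by exact (integrable_const (1 : ℝ)).add h)
    fun o => hb _).trans ?_⟩
  rw [integral_add (integrable_const _) h]
  simp

lemma integrable_exposure (hA : P.LogisticExposureModel) : Integrable exposure P.law := by
  refine Integrable.of_bound measurable_exposure.aestronglyMeasurable 1 ?_
  filter_upwards [hA.1] with o ho
  rcases ho with ho | ho <;> simp [ho]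

lemma stronglyMeasurable_exposure : StronglyMeasurable[sigmaAL q] (exposure : Obs q → ℝ) := by
  have : Measurable[sigmaAL q] (exposure : Obs q → ℝ) :=
    measurable_fst.comp (comap_measurable fun o : Obs q => (exposure o, covar o))
  exact this.stronglyMeasurable

lemma stronglyMeasurable_comp_exposure_covar {g : ℝ × (Fin q → ℝ) → ℝ} (hg : Measurable g) :
    StronglyMeasurable[sigmaAL q] fun o : Obs q => g (exposure o, covar o) := by
  have : Measurable[sigmaAL q] fun o : Obs q => g (exposure o, covar o) :=
    hg.comp (comap_measurable fun o : Obs q => (exposure o, covar o))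
  exact this.stronglyMeasurable

lemma stronglyMeasurable_comp_covar {g : (Fin q → ℝ) → ℝ} (hg : Measurable g) :
    StronglyMeasurable[sigmaL q] fun o : Obs q => g (covar o) := by
  have : Measurable[sigmaL q] fun o : Obs q => g (covar o) :=
    hg.comp (comap_measurable fun o : Obs q => covar o)
  exact this.stronglyMeasurable

/-- Removing the effect of the exposure leaves a conditional mean that depends on the covariates
only. -/
lemma condExp_blip (hM : P.OutcomeEffectModel link) (hA : P.LogisticExposureModel) :
    Integrable (link.blip P.psi) P.law ∧ ∃ k : (Fin q → ℝ) → ℝ, Measurable k ∧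
      P.law[link.blip P.psi | sigmaAL q] =ᵐ[P.law] fun o => k (covar o) := by
  obtain ⟨hY, f, hf, hcond, hmod⟩ := hM
  have hk : Measurable (f 0) := hf.comp (measurable_const.prodMk measurable_id)
  cases link with
  | identity =>
    have hAint := (integrable_exposure hA).const_mul P.psi
    refine ⟨hY.sub hAint, f 0, hk, ?_⟩
    have h1 := condExp_sub hY hAint (sigmaAL q)
    have h2 := condExp_of_stronglyMeasurable (μ := P.law) sigmaAL_le
      (f := fun o : Obs q => P.psi * exposure o) (stronglyMeasurable_exposure.const_mul _) hAint
    have h3 : P.law[Link.blip .identity P.psi | sigmaAL q] =ᵐ[P.law] _ := h1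
    filter_upwards [h3, hcond, hmod] with o h3 h4 h5
    rw [h3, Pi.sub_apply, h2, h4]
    have := h5.2.2
    simp only [Link.g] at this
    linarith
  | log =>
    have hE : StronglyMeasurable[sigmaAL q] fun o : Obs q => Real.exp (-(P.psi * exposure o)) :=
      Real.continuous_exp.comp_stronglyMeasurable
        (stronglyMeasurable_exposure.const_mul P.psi).neg
    have hint : Integrable ((outcome : Obs q → ℝ) * fun o => Real.exp (-(P.psi * exposure o)))
        P.law := by
      refine hY.mul_bdd (c := Real.exp |P.psi|) (hE.mono sigmaAL_le).aestronglyMeasurable ?_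
      filter_upwards [hA.1] with o ho
      rw [Real.norm_eq_abs, Real.abs_exp, Real.exp_le_exp]
      rcases ho with ho | ho
      · simp [ho]
      · rw [ho, mul_one]; exact neg_le_abs _
    refine ⟨hint, f 0, hk, ?_⟩
    have h1 : P.law[Link.blip .log P.psi | sigmaAL q] =ᵐ[P.law] _ :=
      condExp_mul_of_stronglyMeasurable_right hE hint hY
    filter_upwards [h1, hcond, hmod] with o h1 h2 h3
    rw [h1, Pi.mul_apply, h2]
    obtain ⟨h4, h5, h6⟩ := h3
    simp only [Link.g, Link.domain, Set.mem_Ioi] at h4 h5 h6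
    rw [← h6, neg_sub, Real.exp_sub, Real.exp_log h4, Real.exp_log h5]
    field_simp

/-- The score at the true parameters has mean zero. This needs only the models for the exposure and
for its effect: the working outcome model may be misspecified. -/
lemma integral_noise_mul_resid (hM : P.OutcomeEffectModel link) (hA : P.LogisticExposureModel)
    (hm : ∀ β, Measurable fun l => m l β) (hε : Integrable (P.resid link m) P.law) :
    ∫ o, (exposure o - propensity P.gam (covar o)) * P.resid link m o ∂P.law = 0 := by
  obtain ⟨hH, k, hk, hcond⟩ := condExp_blip hM hA
  have hmint : Integrable (fun o => m (covar o) P.bet) P.law := by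
    refine (hH.sub hε).congr (ae_of_all _ fun o => ?_)
    simp [Dgp.resid]
  have hmAL : StronglyMeasurable[sigmaAL q] fun o : Obs q => m (covar o) P.bet :=
    stronglyMeasurable_comp_exposure_covar ((hm P.bet).comp measurable_snd)
  have hcε : P.law[P.resid link m | sigmaAL q]
      =ᵐ[P.law] fun o => k (covar o) - m (covar o) P.bet := by
    have h1 : P.law[P.resid link m | sigmaAL q] =ᵐ[P.law] _ := condExp_sub hH hmint (sigmaAL q)
    have h2 := condExp_of_stronglyMeasurable (μ := P.law) sigmaAL_le hmAL hmint
    filter_upwards [h1, hcond] with o h1 h3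
    rw [h1, Pi.sub_apply, h2, h3]
  have hkint : Integrable (fun o => k (covar o) - m (covar o) P.bet) P.law :=
    integrable_condExp.congr hcε
  have hbd : ∀ᵐ o ∂P.law, ‖exposure o - propensity P.gam (covar o)‖ ≤ 1 := ae_abs_noise_le hA
  have haAL : StronglyMeasurable[sigmaAL q]
      fun o : Obs q => exposure o - propensity P.gam (covar o) :=
    stronglyMeasurable_comp_exposure_covar
      (measurable_fst.sub ((measurable_propensity P.gam).comp measurable_snd))
  have hamem := (measurable_noise (P := P)).aestronglyMeasurable (μ := P.law)
  have haint : Integrable (fun o : Obs q => exposure o - propensity P.gam (covar o)) P.law :=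
    Integrable.of_bound hamem 1 hbd
  rw [integral_mul_condExp sigmaAL_le haAL (hε.bdd_mul hamem hbd) hε]
  have h1 : ∫ o, (exposure o - propensity P.gam (covar o)) * (P.law[P.resid link m | sigmaAL q]) o
        ∂P.law
      = ∫ o, (k (covar o) - m (covar o) P.bet) * (exposure o - propensity P.gam (covar o))
        ∂P.law := by
    refine integral_congr_ae ?_
    filter_upwards [hcε] with o ho
    rw [ho, mul_comm]
  have hpint : Integrable (fun o : Obs q => propensity P.gam (covar o)) P.law :=
    Integrable.of_bound ((measurable_propensity _).comp measurable_covar).aestronglyMeasurable 1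
      (ae_of_all _ fun o => by
        rw [Real.norm_of_nonneg (propensity_nonneg _ _)]; exact propensity_le_one _ _)
  rw [h1, integral_mul_condExp sigmaL_le
    (stronglyMeasurable_comp_covar (g := fun l => k l - m l P.bet) (hk.sub (hm P.bet)))
      (hkint.mul_bdd hamem hbd) haint]
  refine integral_eq_zero_of_ae ?_
  have h2 : P.law[fun o : Obs q => exposure o - propensity P.gam (covar o) | sigmaL q]
      =ᵐ[P.law] _ := condExp_sub (integrable_exposure hA) hpint (sigmaL q)
  have h3 := condExp_of_stronglyMeasurable (μ := P.law) sigmaL_le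
    (stronglyMeasurable_comp_covar (measurable_propensity P.gam)) hpint
  filter_upwards [h2, hA.2] with o h2 h4
  rw [h2, Pi.sub_apply, h3, h4]
  simp

/-- The conditional variance of the exposure is the weight at `γ₀`. -/
lemma condExp_noise_sq (hA : P.LogisticExposureModel) :
    P.law[fun o => (exposure o - propensity P.gam (covar o)) ^ 2 | sigmaL q]
      =ᵐ[P.law] fun o => weight P.gam (covar o) := by
  have hp1 : Measurable fun l : Fin q → ℝ => 1 - 2 * propensity P.gam l :=
    measurable_const.sub ((measurable_propensity P.gam).const_mul 2)
  have hp2 : Measurable fun l : Fin q → ℝ => propensity P.gam l ^ 2 :=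
    (measurable_propensity P.gam).pow_const 2
  have hi1 : Integrable ((fun o : Obs q => 1 - 2 * propensity P.gam (covar o)) * exposure)
      P.law := by
    refine (integrable_exposure hA).bdd_mul (c := 1)
      (hp1.comp measurable_covar).aestronglyMeasurable (ae_of_all _ fun o => ?_)
    have h0 := propensity_nonneg P.gam (covar o)
    have h1 := propensity_le_one P.gam (covar o)
    rw [Real.norm_eq_abs, abs_le]
    constructor <;> linarith
  have hi2 : Integrable (fun o : Obs q => propensity P.gam (covar o) ^ 2) P.law :=
    Integrable.of_bound (hp2.comp measurable_covar).aestronglyMeasurable 1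
      (ae_of_all _ fun o => by
        rw [Real.norm_of_nonneg (by positivity)]
        exact pow_le_one₀ (propensity_nonneg _ _) (propensity_le_one _ _))
  have h1 : (fun o : Obs q => (exposure o - propensity P.gam (covar o)) ^ 2) =ᵐ[P.law]
      (fun o : Obs q => 1 - 2 * propensity P.gam (covar o)) * exposure
        + fun o => propensity P.gam (covar o) ^ 2 := by
    filter_upwards [hA.1] with o ho
    simp only [Pi.add_apply, Pi.mul_apply]
    rcases ho with ho | ho <;> rw [ho] <;> ring
  have h2 := condExp_add hi1 hi2 (sigmaL q)
  have h3 := condExp_mul_of_stronglyMeasurable_left (stronglyMeasurable_comp_covar hp1) hi1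
    (integrable_exposure hA)
  have h4 := condExp_of_stronglyMeasurable (μ := P.law) sigmaL_le
    (stronglyMeasurable_comp_covar hp2) hi2
  filter_upwards [condExp_congr_ae (m := sigmaL q) h1, h2, h3, hA.2] with o h1 h2 h3 h5
  rw [h1, h2, Pi.add_apply, h3, h4, Pi.mul_apply, h5, weight]
  ring

/-- The variance of the score is bounded below, up to the probabilities of the events on which the
conditional variances are small. -/
lemma le_integral_sq_noise_mul_resid (hA : P.LogisticExposureModel)
    (hm : ∀ β, Measurable fun l => m l β)
    (hε4 : Integrable (fun o => P.resid link m o ^ 4) P.law) {c : ℝ} (hc : 0 < c) :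
    c * (c * P.law.real {o | c < (P.law[fun o => (exposure o - propensity P.gam (covar o)) ^ 2 |
            sigmaL q]) o}
        - (1 - P.law.real {o | c < (P.law[fun o => P.resid link m o ^ 2 | sigmaAL q]) o}))
      ≤ ∫ o, ((exposure o - propensity P.gam (covar o)) * P.resid link m o) ^ 2 ∂P.law := by
  set a : Obs q → ℝ := fun o => exposure o - propensity P.gam (covar o) with ha
  have hε2 := integrable_sq_of_integrable_pow_four (measurable_resid hm).aestronglyMeasurable hε4
  have hbd : ∀ᵐ o ∂P.law, ‖a o ^ 2‖ ≤ 1 := by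
    filter_upwards [ae_abs_noise_le hA] with o ho
    rw [norm_pow]
    exact pow_le_one₀ (norm_nonneg _) ho
  have hamem : AEStronglyMeasurable (fun o => a o ^ 2) P.law :=
    ((measurable_noise (P := P)).pow_const 2).aestronglyMeasurable
  have ha2 : Integrable (fun o => a o ^ 2) P.law := Integrable.of_bound hamem 1 hbd
  set v := P.law[fun o => P.resid link m o ^ 2 | sigmaAL q] with hv
  set u := P.law[fun o => a o ^ 2 | sigmaL q] with hu
  have hvm : Measurable v := (stronglyMeasurable_condExp.mono sigmaAL_le).measurable
  have hum : Measurable u := (stronglyMeasurable_condExp.mono sigmaL_le).measurable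
  have haAL : StronglyMeasurable[sigmaAL q] fun o : Obs q => a o ^ 2 :=
    stronglyMeasurable_comp_exposure_covar (g := fun x => (x.1 - propensity P.gam x.2) ^ 2)
      ((measurable_fst.sub ((measurable_propensity P.gam).comp measurable_snd)).pow_const 2)
  have hV : MeasurableSet {o | c < v o} := measurableSet_lt measurable_const hvm
  have hU : MeasurableSet {o | c < u o} := measurableSet_lt measurable_const hum
  have e1 : ∫ o, (a o * P.resid link m o) ^ 2 ∂P.law = ∫ o, a o ^ 2 * v o ∂P.law := by
    simp only [mul_pow]
    exact integral_mul_condExp sigmaAL_le haAL (hε2.bdd_mul hamem hbd) hε2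
  have hv0 : ∀ᵐ o ∂P.law, 0 ≤ v o := condExp_nonneg (ae_of_all _ fun o => sq_nonneg _)
  have hu0 : ∀ᵐ o ∂P.law, 0 ≤ u o := condExp_nonneg (ae_of_all _ fun o => sq_nonneg _)
  have hind : Integrable (Set.indicator {o | c < v o}ᶜ fun _ => (1 : ℝ)) P.law :=
    (integrable_const _).indicator hV.compl
  have e2 : c * ((∫ o, a o ^ 2 ∂P.law) - P.law.real {o | c < v o}ᶜ)
      ≤ ∫ o, a o ^ 2 * v o ∂P.law := by
    have : c * ((∫ o, a o ^ 2 ∂P.law) - P.law.real {o | c < v o}ᶜ)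
        = ∫ o, c * (a o ^ 2 - Set.indicator {o | c < v o}ᶜ (fun _ => (1 : ℝ)) o) ∂P.law := by
      rw [integral_const_mul, integral_sub ha2 hind, integral_indicator_const _ hV.compl]
      simp
    rw [this]
    refine integral_mono_ae ((ha2.sub hind).const_mul c)
      (integrable_condExp.bdd_mul hamem hbd) ?_
    filter_upwards [hv0, hbd] with o ho hb
    rw [Real.norm_of_nonneg (sq_nonneg _)] at hb
    by_cases h : c < v o
    · rw [Set.indicator_of_notMem (by simpa using h)]
      nlinarith [sq_nonneg (a o)]
    · rw [Set.indicator_of_mem (by simpa using h)]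
      nlinarith [mul_nonneg (sq_nonneg (a o)) ho]
  have hindU : Integrable (Set.indicator {o | c < u o} fun _ => c) P.law :=
    (integrable_const _).indicator hU
  have e3 : c * P.law.real {o | c < u o} ≤ ∫ o, a o ^ 2 ∂P.law := by
    rw [← integral_condExp sigmaL_le (f := fun o => a o ^ 2)]
    have : c * P.law.real {o | c < u o}
        = ∫ o, Set.indicator {o | c < u o} (fun _ => c) o ∂P.law := by
      rw [integral_indicator_const _ hU, smul_eq_mul, mul_comm]
    rw [this]
    refine integral_mono_ae hindU integrable_condExp ?_
    filter_upwards [hu0] with o ho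
    by_cases h : c < u o
    · rw [Set.indicator_of_mem (by exact h)]
      exact h.le
    · rw [Set.indicator_of_notMem (by exact h)]
      exact ho
  rw [e1]
  refine le_trans (mul_le_mul_of_nonneg_left ?_ hc.le) e2
  rw [probReal_compl_eq_one_sub hV]
  linarith

/-- Given the exposure and the covariates, the residual minus its conditional mean is centred. -/
lemma condMeanZero_resid (hε : Integrable (P.resid link m) P.law) :
    CondMeanZero P.law (fun o => (exposure o, covar o))
      (fun o => P.resid link m o - (P.law[P.resid link m | sigmaAL q]) o) := by
  rintro g hg ⟨B, hB⟩
  have hgm := (hg.comp (measurable_exposure_covar (q := q))).aestronglyMeasurable (μ := P.law)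
  have hgb : ∀ᵐ o ∂P.law, ‖g (exposure o, covar o)‖ ≤ B := ae_of_all _ fun o => hB _
  have h1 := hε.bdd_mul hgm hgb
  have h2 := (integrable_condExp (μ := P.law) (m := sigmaAL q)
    (f := P.resid link m)).bdd_mul hgm hgb
  simp only [mul_sub]
  rw [integral_sub (by exact h1) (by exact h2), sub_eq_zero]
  exact integral_mul_condExp sigmaAL_le (stronglyMeasurable_comp_exposure_covar hg) h1 hε

end Dgp

/-! ### Expansion of the estimated scores -/

namespace NuisanceEstimator

variable {n q : ℕ} (est : NuisanceEstimator n q) (P : Dgp q)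

/-- The errors `π(Lᵢ; γ̂) - π(Lᵢ; γ₀)` of the fitted exposure probabilities. -/
noncomputable def propError (D : Fin n → Obs q) (i : Fin n) : ℝ :=
  propensity (est.gamHat D) (covar (D i)) - propensity P.gam (covar (D i))

/-- The errors of the linearisation of the exposure probabilities around `γ̂`. The weights of this
linearisation are those of the estimating equations of `β̂`. -/
noncomputable def propRemainder (D : Fin n → Obs q) (i : Fin n) : ℝ :=
  est.propError P D i
    - weight (est.gamHat D) (covar (D i)) * ((est.gamHat D - P.gam) ⬝ᵥ covar (D i))

/-- The errors `m(Lᵢ; β̂(ψ₀)) - m(Lᵢ; β₀)` of the fitted predictions. -/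
noncomputable def predError (m : (Fin q → ℝ) → (Fin q → ℝ) → ℝ) (D : Fin n → Obs q)
    (i : Fin n) : ℝ :=
  m (covar (D i)) (est.bet P.psi D) - m (covar (D i)) P.bet

/-- The scores `{Aᵢ - π(Lᵢ; γ₀)} εᵢ` at the true parameters. -/
noncomputable def _root_.ScoreCI.Dgp.trueScore (P : Dgp q) (link : Link)
    (m : (Fin q → ℝ) → (Fin q → ℝ) → ℝ) (o : Obs q) : ℝ :=
  (exposure o - propensity P.gam (covar o)) * P.resid link m o

variable {est P}

lemma abs_propError_le (D : Fin n → Obs q) (i : Fin n) : |est.propError P D i| ≤ 1 := by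
  unfold propError
  have h1 := propensity_nonneg (est.gamHat D) (covar (D i))
  have h2 := propensity_le_one (est.gamHat D) (covar (D i))
  have h3 := propensity_nonneg P.gam (covar (D i))
  have h4 := propensity_le_one P.gam (covar (D i))
  rw [abs_le]
  constructor <;> linarith

lemma propError_sq_le (D : Fin n → Obs q) (i : Fin n) : est.propError P D i ^ 2 ≤ 1 := by
  rw [← sq_abs]
  exact pow_le_one₀ (abs_nonneg _) (abs_propError_le D i)

lemma abs_propRemainder_le {c : ℝ} (hc : 0 < c) {D : Fin n → Obs q} {i : Fin n}
    (h : c < weight P.gam (covar (D i))) :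
    |est.propRemainder P D i| ≤ est.propError P D i ^ 2 / c := by
  have := abs_sigmoid_sub_sub_le hc h.le (est.gamHat D ⬝ᵥ covar (D i))
  rw [← sub_dotProduct] at this
  exact this

lemma scores_eq (link : Link) (m : (Fin q → ℝ) → (Fin q → ℝ) → ℝ) (D : Fin n → Obs q) :
    est.scores link m P.psi D = fun i =>
      ((exposure (D i) - propensity P.gam (covar (D i))) - est.propError P D i)
        * (P.resid link m (D i) - est.predError P m D i) := by
  funext i
  simp only [scores, score, propError, predError, Dgp.resid]
  ring

/-- By the estimating equations of `β̂`, the linear part of the error of `γ̂` contributes at most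
the penalty level times the `ℓ₁` error. -/
lemma abs_sampleMean_linear_le {link : Link} {m : (Fin q → ℝ) → (Fin q → ℝ) → ℝ}
    (hm : ∀ l, Continuous (m l)) {lam : ℝ} (hlam : 0 ≤ lam) {D : Fin n → Obs q}
    (h : IsBridgeLimit link m lam P.psi D (est.gamHat D) (est.bet P.psi D)) :
    |sampleMean fun i => (est.propError P D i - est.propRemainder P D i)
        * (P.resid link m (D i) - est.predError P m D i)|
      ≤ lam * l1 (est.gamHat D - P.gam) := by
  set Δ := est.gamHat D - P.gam with hΔ
  have e : (sampleMean fun i => (est.propError P D i - est.propRemainder P D i)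
        * (P.resid link m (D i) - est.predError P m D i))
      = ∑ j, ((1 / (n : ℝ)) * ∑ i, weight (est.gamHat D) (covar (D i))
          * (link.blip P.psi (D i) - m (covar (D i)) (est.bet P.psi D)) * covar (D i) j) * Δ j := by
    simp only [sampleMean, propRemainder, predError, Dgp.resid, sub_sub_cancel, dotProduct,
      Finset.mul_sum, Finset.sum_mul, ← hΔ]
    rw [Finset.sum_comm]
    exact Finset.sum_congr rfl fun j _ => Finset.sum_congr rfl fun i _ => by ring
  rw [e, l1, Finset.mul_sum]
  refine (Finset.abs_sum_le_sum_abs _ _).trans (Finset.sum_le_sum fun j _ => ?_)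
  rw [abs_mul]
  exact mul_le_mul_of_nonneg_right (h.abs_equation_le hm hlam j) (abs_nonneg _)

/-- The distance between the mean of the estimated scores and the mean of the true scores, on the
event that the conditional moments are well behaved at the sampled points. -/
lemma sqrt_mul_abs_sampleMean_scores_sub_le {link : Link} {m : (Fin q → ℝ) → (Fin q → ℝ) → ℝ}
    (hm : ∀ l, ContDiff ℝ 2 (m l)) {lam : ℝ} (hlam : 0 ≤ lam) {D : Fin n → Obs q}
    (h : IsBridgeLimit link m lam P.psi D (est.gamHat D) (est.bet P.psi D)) {c K : ℝ} (hc : 0 < c)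
    (hA : ∀ i, exposure (D i) = 0 ∨ exposure (D i) = 1)
    (hw : ∀ i, c < weight P.gam (covar (D i))) {g : Fin n → ℝ} (hg : ∀ i, |g i| ≤ K) :
    √n * |sampleMean (est.scores link m P.psi D) - sampleMean fun i => P.trueScore link m (D i)|
      ≤ (‖fun j => (1 / √n) * ∑ i, (exposure (D i) - propensity P.gam (covar (D i)))
              * gradM m (covar (D i)) P.bet j‖ * l1 (est.bet P.psi D - P.bet)
          + √n * ⨆ t : Set.Icc (0 : ℝ) 1, sampleMean fun i =>
              |curvM m (covar (D i)) (P.bet + (t : ℝ) • (est.bet P.psi D - P.bet))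
                (est.bet P.psi D - P.bet)|)
        + √n * (lam * l1 (est.gamHat D - P.gam))
        + √n * |sampleMean fun i => est.propRemainder P D i * (P.resid link m (D i) - g i)|
        + K / c * (√n * sampleMean fun i => est.propError P D i ^ 2)
        + 1 / c * (√n * (√(sampleMean fun i => est.propError P D i ^ 2)
            * √(sampleMean fun i => est.predError P m D i ^ 2))) := by
  have h1 := sqrt_mul_abs_sampleMean_score_sub_le
    (a := fun i => exposure (D i) - propensity P.gam (covar (D i)))
    (e := fun i => P.resid link m (D i)) (μ := est.predError P m D) hc
    (abs_propError_le (est := est) (P := P) D) (fun i => abs_propRemainder_le hc (hw i)) hg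
  have h2 := sqrt_mul_abs_sampleMean_prediction_le hm (fun i => covar (D i))
    (fun i => abs_sub_propensity_le (hA i) P.gam (covar (D i))) P.bet (est.bet P.psi D)
  have h3 := mul_le_mul_of_nonneg_left
    (abs_sampleMean_linear_le (fun l => (hm l).continuous) hlam h) (Real.sqrt_nonneg n)
  rw [scores_eq]
  refine h1.trans ?_
  gcongr
  exact h2

/-! ### The remainder of the exposure model -/

lemma measurable_dotProduct_comp {Ω : Type*} [MeasurableSpace Ω] {f g : Ω → Fin q → ℝ}
    (hf : Measurable f) (hg : Measurable g) : Measurable fun ω => f ω ⬝ᵥ g ω :=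
  Finset.measurable_fun_sum _ fun j _ =>
    ((measurable_pi_apply j).comp hf).mul ((measurable_pi_apply j).comp hg)

lemma measurable_propensity_comp {Ω : Type*} [MeasurableSpace Ω] {f g : Ω → Fin q → ℝ}
    (hf : Measurable f) (hg : Measurable g) : Measurable fun ω => propensity (f ω) (g ω) :=
  Real.sigmoid_monotone.measurable.comp (measurable_dotProduct_comp hf hg)

lemma measurable_gamHat : Measurable est.gamHat :=
  est.measurable_gam.comp (measurable_pi_lambda _ fun i =>
    measurable_exposure_covar.comp (measurable_pi_apply i))

lemma measurable_propError (i : Fin n) : Measurable fun D => est.propError P D i :=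
  (measurable_propensity_comp measurable_gamHat
    (measurable_covar.comp (measurable_pi_apply i))).sub
    ((measurable_propensity P.gam).comp (measurable_covar.comp (measurable_pi_apply i)))

lemma integrable_sampleMean_propError_sq :
    Integrable (fun D => sampleMean fun i => est.propError P D i ^ 2) (P.sampleLaw n) := by
  refine Integrable.of_bound
    (measurable_sampleMean fun i => (measurable_propError i).pow_const 2).aestronglyMeasurable 1
    (ae_of_all _ fun D => ?_)
  rw [Real.norm_of_nonneg (sampleMean_nonneg fun i => sq_nonneg _)]
  exact (sampleMean_mono fun i => propError_sq_le D i).trans (sampleMean_const_le zero_le_one)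

open Classical in
/-- The remainder, set to zero where the exposure is nearly deterministic. -/
noncomputable def truncRemainder (est : NuisanceEstimator n q) (P : Dgp q) (c : ℝ)
    (D : Fin n → Obs q) (i : Fin n) : ℝ :=
  if c < weight P.gam (covar (D i)) then est.propRemainder P D i else 0

lemma abs_truncRemainder_le {c : ℝ} (hc : 0 < c) (D : Fin n → Obs q) (i : Fin n) :
    |est.truncRemainder P c D i| ≤ est.propError P D i ^ 2 / c := by
  unfold truncRemainder
  split_ifs with h
  · exact abs_propRemainder_le hc h
  · rw [abs_zero]; positivity

/-- Mean square bound for the centred part of the remainder term. Since `γ̂` is a function of the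
exposures and covariates, the terms are uncorrelated; the parameter `κ` balances the two factors
of each term. -/
lemma integral_sq_truncRemainder_le {c κ : ℝ} (hc : 0 < c) (hκ : 0 < κ) (hn : 0 < n) {ξ : Obs q → ℝ}
    (hξ : Measurable ξ) (hξ4 : Integrable (fun o => ξ o ^ 4) P.law)
    (h0 : CondMeanZero P.law (fun o => (exposure o, covar o)) ξ) :
    Integrable (fun D => (√n * sampleMean fun i => est.truncRemainder P c D i * ξ (D i)) ^ 2)
        (P.sampleLaw n) ∧
      ∫ D, (√n * sampleMean fun i => est.truncRemainder P c D i * ξ (D i)) ^ 2 ∂P.sampleLaw n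
        ≤ (∫ D, (sampleMean fun i => est.propError P D i ^ 2) ∂P.sampleLaw n) / (2 * c ^ 4) / κ
          + κ / 2 * ∫ o, ξ o ^ 4 ∂P.law := by
  classical
  let δ : Fin n → (Fin n → ℝ × (Fin q → ℝ)) → ℝ := fun i z =>
    propensity (est.gam z) (z i).2 - propensity P.gam (z i).2
  let F : Fin n → (Fin n → ℝ × (Fin q → ℝ)) → ℝ := fun i z => 1 / √n *
    if c < weight P.gam (z i).2 then
      δ i z - weight (est.gam z) (z i).2 * ((est.gam z - P.gam) ⬝ᵥ (z i).2) else 0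
  have hL : ∀ i : Fin n, Measurable fun z : Fin n → ℝ × (Fin q → ℝ) => (z i).2 := fun i =>
    measurable_snd.comp (measurable_pi_apply i)
  have hF : ∀ i, Measurable (F i) := fun i => by
    have hp := measurable_propensity_comp est.measurable_gam (hL i)
    have hp0 := (measurable_propensity P.gam).comp (hL i)
    have hw0 : Measurable fun z : Fin n → ℝ × (Fin q → ℝ) => weight P.gam (z i).2 :=
      hp0.mul (measurable_const.sub hp0)
    refine Measurable.const_mul (Measurable.ite (measurableSet_lt measurable_const hw0) ?_
      measurable_const) _
    exact (hp.sub hp0).sub ((hp.mul (measurable_const.sub hp)).mul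
      (measurable_dotProduct_comp (est.measurable_gam.sub_const _) (hL i)))
  have hFeq : ∀ i (D : Fin n → Obs q), F i (fun k => (exposure (D k), covar (D k)))
      = 1 / √n * est.truncRemainder P c D i := fun i D => rfl
  have hFb : ∀ i z, |F i z| ≤ 1 / √n * (1 / c) := fun i z => by
    have := abs_truncRemainder_le (est := est) (P := P) hc (fun k => (0, (z k).1, (z k).2)) i
    have h2 := propError_sq_le (est := est) (P := P) (fun k => (0, (z k).1, (z k).2)) i
    have e : F i z = 1 / √n * est.truncRemainder P c (fun k => (0, (z k).1, (z k).2)) i := rfl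
    rw [e, abs_mul, abs_of_nonneg (by positivity : (0 : ℝ) ≤ 1 / √n)]
    exact mul_le_mul_of_nonneg_left (this.trans (div_le_div_of_nonneg_right h2 hc.le))
      (by positivity)
  obtain ⟨h1, h2⟩ := integral_sq_sum_mul measurable_exposure_covar hξ
    (integrable_sq_of_integrable_pow_four hξ.aestronglyMeasurable hξ4) h0 hF hFb
  have hsum : ∀ D : Fin n → Obs q,
      ∑ i, F i (fun k => (exposure (D k), covar (D k))) * ξ (D i)
        = √n * sampleMean fun i => est.truncRemainder P c D i * ξ (D i) := fun D => by
    rw [sqrt_mul_sampleMean]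
    exact Finset.sum_congr rfl fun i _ => by rw [hFeq, mul_assoc]
  simp only [hsum] at h1 h2
  refine ⟨h1, h2.le.trans ?_⟩
  obtain ⟨h3, h4⟩ := integral_sampleMean_comp (n := n) hξ4 hn
  have hδint := integrable_sampleMean_propError_sq (est := est) (P := P)
  have hbound : ∀ D : Fin n → Obs q,
      ∑ i, (F i (fun k => (exposure (D k), covar (D k))) * ξ (D i)) ^ 2
        ≤ 1 / (2 * c ^ 4) / κ * (sampleMean fun i => est.propError P D i ^ 2)
          + κ / 2 * sampleMean fun i => ξ (D i) ^ 4 := fun D => by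
    rw [← sampleMean_const_mul, ← sampleMean_const_mul, ← sampleMean_add, sampleMean,
      Finset.mul_sum]
    refine Finset.sum_le_sum fun i _ => ?_
    have hsq : (√n : ℝ) ^ 2 = n := Real.sq_sqrt (by positivity)
    rw [hFeq, mul_assoc, mul_pow, div_pow, hsq, one_pow]
    refine mul_le_mul_of_nonneg_left ?_ (by positivity)
    have hT := abs_truncRemainder_le (est := est) (P := P) hc D i
    have hδ1 := propError_sq_le (est := est) (P := P) D i
    set T := est.truncRemainder P c D i
    set d := est.propError P D i
    have hd4 : (d ^ 2) ^ 2 ≤ d ^ 2 := by nlinarith [sq_nonneg d]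
    have hT2 : T ^ 2 ≤ d ^ 2 / c ^ 2 := by
      rw [← sq_abs]
      refine (pow_le_pow_left₀ (abs_nonneg _) hT 2).trans ?_
      rw [div_pow]
      exact div_le_div_of_nonneg_right hd4 (sq_nonneg c)
    have hT4 : (T ^ 2) ^ 2 ≤ d ^ 2 / c ^ 4 := by
      refine (pow_le_pow_left₀ (sq_nonneg _) hT2 2).trans ?_
      rw [div_pow, ← pow_mul c]
      exact div_le_div_of_nonneg_right hd4 (by positivity)
    have hAG : T ^ 2 * ξ (D i) ^ 2 ≤ (T ^ 2) ^ 2 / (2 * κ) + κ / 2 * (ξ (D i) ^ 2) ^ 2 := by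
      have e : (T ^ 2) ^ 2 / (2 * κ) + κ / 2 * (ξ (D i) ^ 2) ^ 2 - T ^ 2 * ξ (D i) ^ 2
          = (T ^ 2 - κ * ξ (D i) ^ 2) ^ 2 / (2 * κ) := by
        field_simp
        ring
      have : 0 ≤ (T ^ 2 - κ * ξ (D i) ^ 2) ^ 2 / (2 * κ) := by positivity
      linarith
    rw [mul_pow]
    refine hAG.trans (add_le_add ?_ (le_of_eq (by ring)))
    calc (T ^ 2) ^ 2 / (2 * κ) ≤ d ^ 2 / c ^ 4 / (2 * κ) := by gcongr
      _ = _ := by field_simp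
  refine (integral_mono_of_nonneg (ae_of_all _ fun D => Finset.sum_nonneg fun i _ => sq_nonneg _)
    ((hδint.const_mul _).add (h3.const_mul _)) (ae_of_all _ hbound)).trans (le_of_eq ?_)
  rw [integral_add' (hδint.const_mul _) (h3.const_mul _), integral_const_mul, integral_const_mul,
    show ∫ D, (sampleMean fun i => ξ (D i) ^ 4) ∂P.sampleLaw n = ∫ o, ξ o ^ 4 ∂P.law from h4]
  ring

end NuisanceEstimator

/-! ### Negligibility of the remainder terms along a sequence of laws -/

/-- The conditions of the theorem along one sequence of laws. -/
structure RegularSequence {p : ℕ → ℕ} (link : Link)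
    (m : ∀ n, (Fin (p n) → ℝ) → (Fin (p n) → ℝ) → ℝ) (lamβ : ℕ → ℝ) (c C r : ℝ)
    (est : ∀ n, NuisanceEstimator n (p n)) (P : ∀ n, Dgp (p n)) : Prop where
  measurable_model : ∀ n β, Measurable fun l => m n l β
  contDiff_model : ∀ n l, ContDiff ℝ 2 (m n l)
  penalty_pos : ∀ n, 0 < lamβ n
  penalty_rate : lamβ =O[atTop] fun n : ℕ => Real.sqrt (logDim p n / n)
  outcomeModel : ∀ n, (P n).OutcomeEffectModel link
  exposureModel : ∀ n, (P n).LogisticExposureModel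
  bridge : ∀ n, ∀ᵐ D ∂((P n).sampleLaw n),
    IsBridgeLimit link (m n) (lamβ n) (P n).psi D ((est n).gamHat D) ((est n).bet (P n).psi D)
  c_pos : 0 < c
  c_lt : c < C
  lt_r : 4 < r
  moments : MomentConditions link m c C r P
  concentration : ConcentrationBound m P
  rates : EstimationRates est P
  predictions : PredictionRates m est P
  smoothness : QuadraticSmoothness m est P
  sparsity : UltraSparsity P

section Rates

variable {p : ℕ → ℕ} {P : ∀ n, Dgp (p n)}

lemma logDim_nonneg (p : ℕ → ℕ) (n : ℕ) : 0 ≤ logDim p n := Real.log_natCast_nonneg _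

lemma sGam_nonneg (n : ℕ) : 0 ≤ sGam P n := Nat.cast_nonneg _

lemma sGam_le_sStar (n : ℕ) : sGam P n ≤ sStar P n := le_max_left _ _

lemma sStar_nonneg (n : ℕ) : 0 ≤ sStar P n := (sGam_nonneg n).trans (sGam_le_sStar n)

lemma UltraSparsity.tendsto_sStar (h : UltraSparsity P) :
    Tendsto (fun n => sStar P n * logDim p n / √n) atTop (𝓝 0) := by
  have h1 := (IsLittleO.tendsto_div_nhds_zero h).sqrt
  rw [Real.sqrt_zero] at h1
  refine squeeze_zero (fun n => ?_) (fun n => ?_) h1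
  · have := sStar_nonneg (P := P) n
    have := logDim_nonneg p n
    positivity
  · refine Real.le_sqrt_of_sq_le ?_
    rw [div_pow, Real.sq_sqrt (by positivity), mul_pow]
    have : sStar P n ^ 2 ≤ sGam P n ^ 2 + sBet P n ^ 2 := by
      rcases max_choice (sGam P n) (sBet P n) with h | h <;>
        · rw [sStar, h]
          nlinarith [sq_nonneg (sGam P n), sq_nonneg (sBet P n)]
    gcongr

lemma UltraSparsity.tendsto_sGam (h : UltraSparsity P) :
    Tendsto (fun n => sGam P n * logDim p n / √n) atTop (𝓝 0) := by
  refine squeeze_zero (fun n => ?_) (fun n => ?_) h.tendsto_sStar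
  · have := sGam_nonneg (P := P) n
    have := logDim_nonneg p n
    positivity
  · have := logDim_nonneg p n
    gcongr
    exact sGam_le_sStar n

lemma tendsto_div_natCast_of_tendsto_div_sqrt {u : ℕ → ℝ} (hu : ∀ n, 0 ≤ u n)
    (h : Tendsto (fun n : ℕ => u n / √n) atTop (𝓝 0)) :
    Tendsto (fun n : ℕ => u n / n) atTop (𝓝 0) := by
  refine squeeze_zero (fun n => div_nonneg (hu n) (by positivity)) (fun n => ?_) h
  rcases Nat.eq_zero_or_pos n with rfl | hn
  · simp
  · have h1 : (1 : ℝ) ≤ n := by exact_mod_cast hn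
    refine div_le_div_of_nonneg_left (hu n) (by positivity) ?_
    exact (Real.sqrt_le_left (by positivity)).mpr (by nlinarith)

lemma sqrt_mul_div_natCast (n : ℕ) (u : ℝ) : √n * (u / n) = u / √n := by
  rw [mul_div_left_comm, Real.sqrt_div_self, ← div_eq_mul_inv]

lemma sqrt_logDim_mul (n : ℕ) (s : ℝ) :
    √(logDim p n) * (s * √(logDim p n / n)) = s * logDim p n / √n := by
  rw [Real.sqrt_div (logDim_nonneg p n), mul_left_comm, ← mul_div_assoc,
    Real.mul_self_sqrt (logDim_nonneg p n), mul_div_assoc]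

lemma sqrt_logDim_div_mul (n : ℕ) (s : ℝ) :
    √(logDim p n / n) * (s * √(logDim p n / n)) = s * logDim p n / n := by
  rw [mul_left_comm, Real.mul_self_sqrt (div_nonneg (logDim_nonneg p n) (by positivity)),
    mul_div_assoc]

end Rates

namespace RegularSequence

variable {p : ℕ → ℕ} {link : Link} {m : ∀ n, (Fin (p n) → ℝ) → (Fin (p n) → ℝ) → ℝ}
  {lamβ : ℕ → ℝ} {c C r : ℝ} {est : ∀ n, NuisanceEstimator n (p n)} {P : ∀ n, Dgp (p n)}

lemma integrable_resid_pow_four (H : RegularSequence link m lamβ c C r est P) (n : ℕ) :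
    Integrable (fun o => (P n).resid link (m n) o ^ 4) (P n).law :=
  (Dgp.integrable_resid_pow_four (H.measurable_model n) H.lt_r (H.moments.2.1 n).1).1

lemma integral_resid_pow_four_le (H : RegularSequence link m lamβ c C r est P) (n : ℕ) :
    ∫ o, (P n).resid link (m n) o ^ 4 ∂(P n).law ≤ 1 + C :=
  (Dgp.integrable_resid_pow_four (H.measurable_model n) H.lt_r (H.moments.2.1 n).1).2.trans
    (by linarith [(H.moments.2.1 n).2])

lemma integrable_resid (H : RegularSequence link m lamβ c C r est P) (n : ℕ) :
    Integrable ((P n).resid link (m n)) (P n).law :=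
  integrable_of_integrable_pow_four
    (Dgp.measurable_resid (H.measurable_model n)).aestronglyMeasurable
    (H.integrable_resid_pow_four n)

lemma eventually_exposure (H : RegularSequence link m lamβ c C r est P) :
    ∀ᶠ x in inProb (fun n => (P n).sampleLaw n),
      ∀ i, exposure (x.2 i) = 0 ∨ exposure (x.2 i) = 1 :=
  eventually_inProb_of_ae (Q := fun n (D : Fin n → Obs (p n)) =>
    ∀ i, exposure (D i) = 0 ∨ exposure (D i) = 1)
    fun n => Dgp.ae_sampleLaw (H.exposureModel n).1 n

lemma eventually_weight (H : RegularSequence link m lamβ c C r est P) :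
    ∀ᶠ x in inProb (fun n => (P n).sampleLaw n),
      ∀ i, c < weight (P x.1).gam (covar (x.2 i)) := by
  have h1 := H.moments.2.2.1.eventually fun n => by
    rw [Set.ofPred_forall]
    exact MeasurableSet.iInter fun i => measurableSet_lt measurable_const
      ((stronglyMeasurable_condExp.mono sigmaL_le).measurable.comp (measurable_pi_apply i))
  have h2 := eventually_inProb_of_ae (μ := fun n => (P n).sampleLaw n)
    (Q := fun n (D : Fin n → Obs (p n)) => ∀ i,
      ((P n).law[fun o => (exposure o - propensity (P n).gam (covar o)) ^ 2 | sigmaL (p n)]) (D i)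
        = weight (P n).gam (covar (D i)))
    fun n => Dgp.ae_sampleLaw (Dgp.condExp_noise_sq (H.exposureModel n)) n
  filter_upwards [h1, h2] with x h1 h2 i
  rw [← h2 i]
  exact h1 i

lemma eventually_condExp_resid (H : RegularSequence link m lamβ c C r est P) :
    ∀ᶠ x in inProb (fun n => (P n).sampleLaw n),
      ∀ i, |((P x.1).law[(P x.1).resid link (m x.1) | sigmaAL (p x.1)]) (x.2 i)| ≤ 1 + C := by
  have h1 := H.moments.1.eventually fun n => by
    rw [Set.ofPred_forall]
    exact MeasurableSet.iInter fun i => measurableSet_lt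
      ((stronglyMeasurable_condExp.mono sigmaAL_le).measurable.comp (measurable_pi_apply i))
      measurable_const
  have h2 := eventually_inProb_of_ae (μ := fun n => (P n).sampleLaw n)
    (Q := fun n (D : Fin n → Obs (p n)) => ∀ i,
      ((P n).law[(P n).resid link (m n) | sigmaAL (p n)]) (D i) ^ 4
        ≤ ((P n).law[fun o => (P n).resid link (m n) o ^ 4 | sigmaAL (p n)]) (D i))
    fun n => Dgp.ae_sampleLaw (condExp_pow_four_le sigmaAL_le (H.integrable_resid n)
      (H.integrable_resid_pow_four n)) n
  filter_upwards [h1, h2] with x h1 h2 i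
  have h3 : ((P x.1).law[fun o => (P x.1).resid link (m x.1) o ^ 4 | sigmaAL (p x.1)]) (x.2 i)
      < C :=
    h1 i
  linarith [abs_le_one_add_pow_four
    (((P x.1).law[(P x.1).resid link (m x.1) | sigmaAL (p x.1)]) (x.2 i)), h2 i]

lemma eventually_bridge (H : RegularSequence link m lamβ c C r est P) :
    ∀ᶠ x in inProb (fun n => (P n).sampleLaw n),
      IsBridgeLimit link (m x.1) (lamβ x.1) (P x.1).psi x.2 ((est x.1).gamHat x.2)
        ((est x.1).bet (P x.1).psi x.2) :=
  eventually_inProb_of_ae (Q := fun n (D : Fin n → Obs (p n)) =>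
    IsBridgeLimit link (m n) (lamβ n) (P n).psi D ((est n).gamHat D) ((est n).bet (P n).psi D))
    H.bridge

lemma isBigOP_sampleMean_propError (H : RegularSequence link m lamβ c C r est P) :
    IsBigOP (fun n => (P n).sampleLaw n)
      (fun n D => sampleMean fun i => (est n).propError (P n) D i ^ 2)
      (fun n _ => sGam P n * logDim p n / n) := by
  have h := H.predictions.1
  simpa only [NuisanceEstimator.propError, sub_sq_comm] using h

lemma isBigOP_sampleMean_predError (H : RegularSequence link m lamβ c C r est P) :
    IsBigOP (fun n => (P n).sampleLaw n)
      (fun n D => sampleMean fun i => (est n).predError (P n) (m n) D i ^ 2)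
      (fun n _ => sStar P n * logDim p n / n) := by
  have h := H.predictions.2
  simpa only [NuisanceEstimator.predError, sub_sq_comm] using h

lemma isBigOP_sqrt : IsBigOP (fun n => (P n).sampleLaw n) (fun n _ => √(n : ℝ))
    (fun n _ => √(n : ℝ)) :=
  isBigOP_of_isBigO (isBigO_refl _ _) fun _ => Real.sqrt_nonneg _

lemma tendsto_sampleMean_propError (H : RegularSequence link m lamβ c C r est P) :
    Tendsto (fun x : Σ n, Fin n → Obs (p n) =>
        sampleMean fun i => (est x.1).propError (P x.1) x.2 i ^ 2)
      (inProb fun n => (P n).sampleLaw n) (𝓝 0) :=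
  H.isBigOP_sampleMean_propError.tendsto_zero
    (tendsto_div_natCast_of_tendsto_div_sqrt
      (fun n => mul_nonneg (sGam_nonneg n) (logDim_nonneg p n)) H.sparsity.tendsto_sGam)

lemma tendsto_sampleMean_predError (H : RegularSequence link m lamβ c C r est P) :
    Tendsto (fun x : Σ n, Fin n → Obs (p n) =>
        sampleMean fun i => (est x.1).predError (P x.1) (m x.1) x.2 i ^ 2)
      (inProb fun n => (P n).sampleLaw n) (𝓝 0) :=
  H.isBigOP_sampleMean_predError.tendsto_zero
    (tendsto_div_natCast_of_tendsto_div_sqrt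
      (fun n => mul_nonneg (sStar_nonneg n) (logDim_nonneg p n)) H.sparsity.tendsto_sStar)

lemma tendsto_gradient_term (H : RegularSequence link m lamβ c C r est P) :
    Tendsto (fun x : Σ n, Fin n → Obs (p n) =>
        ‖fun j => (1 / √x.1) * ∑ i, (exposure (x.2 i) - propensity (P x.1).gam (covar (x.2 i)))
              * gradM (m x.1) (covar (x.2 i)) (P x.1).bet j‖
          * l1 ((est x.1).bet (P x.1).psi x.2 - (P x.1).bet))
      (inProb fun n => (P n).sampleLaw n) (𝓝 0) := by
  refine (IsBigOP.mul H.concentration H.rates.2.2.1 (fun n _ => Real.sqrt_nonneg _) (fun n _ =>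
    mul_nonneg (sStar_nonneg n) (Real.sqrt_nonneg _))).tendsto_zero ?_
  simp only [sqrt_logDim_mul]
  exact H.sparsity.tendsto_sStar

lemma tendsto_curvature_term (H : RegularSequence link m lamβ c C r est P) :
    Tendsto (fun x : Σ n, Fin n → Obs (p n) =>
        √x.1 * ⨆ t : Set.Icc (0 : ℝ) 1, sampleMean fun i =>
          |curvM (m x.1) (covar (x.2 i))
            ((P x.1).bet + (t : ℝ) • ((est x.1).bet (P x.1).psi x.2 - (P x.1).bet))
            ((est x.1).bet (P x.1).psi x.2 - (P x.1).bet)|)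
      (inProb fun n => (P n).sampleLaw n) (𝓝 0) := by
  have h1 := IsBigOP.mul H.rates.2.2.2 H.rates.2.2.2 (fun n _ => Real.sqrt_nonneg _)
    (fun n _ => Real.sqrt_nonneg _)
  simp only [← pow_two] at h1
  have h2 := IsBigOP.trans H.smoothness h1 (fun n _ => sq_nonneg _)
  refine (IsBigOP.mul isBigOP_sqrt h2 (fun _ _ => Real.sqrt_nonneg _)
    (fun _ _ => sq_nonneg _)).tendsto_zero ?_
  have e : ∀ n : ℕ, √(n : ℝ) * √(sStar P n * logDim p n / n) ^ 2 = sStar P n * logDim p n / √n :=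
    fun n => by
      rw [Real.sq_sqrt (div_nonneg (mul_nonneg (sStar_nonneg n) (logDim_nonneg p n))
        (by positivity)), sqrt_mul_div_natCast]
  simp only [e]
  exact H.sparsity.tendsto_sStar

lemma tendsto_penalty_term (H : RegularSequence link m lamβ c C r est P) :
    Tendsto (fun x : Σ n, Fin n → Obs (p n) =>
        √x.1 * (lamβ x.1 * l1 ((est x.1).gamHat x.2 - (P x.1).gam)))
      (inProb fun n => (P n).sampleLaw n) (𝓝 0) := by
  have h1 : IsBigOP (fun n => (P n).sampleLaw n) (fun n _ => lamβ n) _ :=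
    isBigOP_of_isBigO H.penalty_rate fun n => Real.sqrt_nonneg _
  have h2 := IsBigOP.mul h1 H.rates.1 (fun n _ => Real.sqrt_nonneg _)
    (fun n _ => mul_nonneg (sGam_nonneg n) (Real.sqrt_nonneg _))
  refine (IsBigOP.mul isBigOP_sqrt h2 (fun n _ => Real.sqrt_nonneg _) (fun n _ =>
    mul_nonneg (Real.sqrt_nonneg _) (mul_nonneg (sGam_nonneg n) (Real.sqrt_nonneg _)))).tendsto_zero
      ?_
  simp only [sqrt_logDim_div_mul, sqrt_mul_div_natCast]
  exact H.sparsity.tendsto_sGam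

lemma tendsto_sqrt_mul_sampleMean_propError (H : RegularSequence link m lamβ c C r est P) :
    Tendsto (fun x : Σ n, Fin n → Obs (p n) =>
        √x.1 * sampleMean fun i => (est x.1).propError (P x.1) x.2 i ^ 2)
      (inProb fun n => (P n).sampleLaw n) (𝓝 0) := by
  refine (IsBigOP.mul isBigOP_sqrt H.isBigOP_sampleMean_propError (fun n _ => Real.sqrt_nonneg _)
    (fun n _ => div_nonneg (mul_nonneg (sGam_nonneg n) (logDim_nonneg p n))
      (by positivity))).tendsto_zero ?_
  simp only [sqrt_mul_div_natCast]
  exact H.sparsity.tendsto_sGam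

lemma tendsto_sqrt_mul_propError_mul_predError (H : RegularSequence link m lamβ c C r est P) :
    Tendsto (fun x : Σ n, Fin n → Obs (p n) =>
        √x.1 * (√(sampleMean fun i => (est x.1).propError (P x.1) x.2 i ^ 2)
          * √(sampleMean fun i => (est x.1).predError (P x.1) (m x.1) x.2 i ^ 2)))
      (inProb fun n => (P n).sampleLaw n) (𝓝 0) := by
  have h1 := IsBigOP.mul isBigOP_sqrt H.isBigOP_sampleMean_propError
    (fun n _ => Real.sqrt_nonneg _)
    (fun n _ => div_nonneg (mul_nonneg (sGam_nonneg n) (logDim_nonneg p n)) (by positivity))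
  have h2 := IsBigOP.mul isBigOP_sqrt H.isBigOP_sampleMean_predError
    (fun n _ => Real.sqrt_nonneg _)
    (fun n _ => div_nonneg (mul_nonneg (sStar_nonneg n) (logDim_nonneg p n)) (by positivity))
  simp only [sqrt_mul_div_natCast] at h1 h2
  have h3 := ((h1.tendsto_zero H.sparsity.tendsto_sGam).mul
    (h2.tendsto_zero H.sparsity.tendsto_sStar)).sqrt
  rw [mul_zero, Real.sqrt_zero] at h3
  refine h3.congr fun x => ?_
  have ha := sampleMean_nonneg fun i => sq_nonneg ((est x.1).propError (P x.1) x.2 i)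
  rw [mul_mul_mul_comm, Real.mul_self_sqrt (by positivity), Real.sqrt_mul (by positivity),
    Real.sqrt_mul ha]

/-- The residual minus its conditional mean given exposure and covariates. -/
noncomputable def centredResid {q : ℕ} (P : Dgp q) (link : Link)
    (m : (Fin q → ℝ) → (Fin q → ℝ) → ℝ) (o : Obs q) : ℝ :=
  P.resid link m o - (P.law[P.resid link m | sigmaAL q]) o

lemma measurable_centredResid (H : RegularSequence link m lamβ c C r est P) (n : ℕ) :
    Measurable (centredResid (P n) link (m n)) :=
  (Dgp.measurable_resid (H.measurable_model n)).sub
    (stronglyMeasurable_condExp.mono sigmaAL_le).measurable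

lemma centredResid_pow_four (H : RegularSequence link m lamβ c C r est P) (n : ℕ) :
    Integrable (fun o => centredResid (P n) link (m n) o ^ 4) (P n).law ∧
      ∫ o, centredResid (P n) link (m n) o ^ 4 ∂(P n).law ≤ 16 * (1 + C) := by
  set e := (P n).resid link (m n)
  set h := (P n).law[(P n).resid link (m n) | sigmaAL (p n)] with hh
  set g := (P n).law[fun o => (P n).resid link (m n) o ^ 4 | sigmaAL (p n)] with hgdef
  have hg : Integrable g (P n).law := integrable_condExp
  have he4 := H.integrable_resid_pow_four n
  have hgi : ∫ o, g o ∂(P n).law ≤ 1 + C := by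
    rw [hgdef, integral_condExp sigmaAL_le]
    exact H.integral_resid_pow_four_le n
  have hb : ∀ᵐ o ∂(P n).law, centredResid (P n) link (m n) o ^ 4 ≤ 8 * (e o ^ 4 + g o) := by
    filter_upwards [condExp_pow_four_le sigmaAL_le (H.integrable_resid n)
      (H.integrable_resid_pow_four n)] with o ho
    have h1 : (e o - h o) ^ 4 ≤ 8 * (e o ^ 4 + h o ^ 4) := by
      nlinarith [sq_nonneg (e o ^ 2 - h o ^ 2), sq_nonneg (e o + h o), sq_nonneg (e o - h o),
        mul_nonneg (sq_nonneg (e o + h o)) (sq_nonneg (e o + h o)),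
        mul_nonneg (sq_nonneg (e o + h o)) (sq_nonneg (e o - h o)), sq_nonneg (e o * h o),
        sq_nonneg (e o ^ 2 + h o ^ 2)]
    exact h1.trans (by gcongr)
  have hint : Integrable (fun o => centredResid (P n) link (m n) o ^ 4) (P n).law := by
    refine ((he4.add hg).const_mul 8).mono'
      ((H.measurable_centredResid n).pow_const 4).aestronglyMeasurable ?_
    filter_upwards [hb] with o ho
    rw [Real.norm_of_nonneg (by positivity)]
    exact ho
  refine ⟨hint, (integral_mono_ae hint ((he4.add hg).const_mul 8) hb).trans ?_⟩
  rw [integral_const_mul, integral_add' he4 hg]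
  linarith [H.integral_resid_pow_four_le n]

/-- The remainder term against the centred residuals vanishes. Consistency of the fitted exposure
probabilities is enough here, at any rate. -/
lemma tendsto_truncRemainder (H : RegularSequence link m lamβ c C r est P) :
    Tendsto (fun x : Σ n, Fin n → Obs (p n) =>
        √x.1 * sampleMean fun i => (est x.1).truncRemainder (P x.1) c x.2 i
          * centredResid (P x.1) link (m x.1) (x.2 i))
      (inProb fun n => (P n).sampleLaw n) (𝓝 0) := by
  set d : ℕ → ℝ := fun n => ∫ D, (sampleMean fun i => (est n).propError (P n) D i ^ 2)
    ∂(P n).sampleLaw n with hd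
  have hd0 : ∀ n, 0 ≤ d n := fun n =>
    integral_nonneg fun D => sampleMean_nonneg fun i => sq_nonneg _
  have hdlim : Tendsto d atTop (𝓝 0) :=
    tendsto_integral_of_tendsto_inProb
      (X := fun n D => sampleMean fun i => (est n).propError (P n) D i ^ 2)
      (fun n => measurable_sampleMean fun i =>
        (NuisanceEstimator.measurable_propError i).pow_const 2)
      (fun n D => sampleMean_nonneg fun i => sq_nonneg _)
      (fun n D => (sampleMean_mono fun i => NuisanceEstimator.propError_sq_le D i).trans
        (sampleMean_const_le zero_le_one))
      H.tendsto_sampleMean_propError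
  -- The choice of `κ` makes both summands of the mean square bound vanish.
  set κ : ℕ → ℝ := fun n => √(d n) + 1 / ((n : ℝ) + 1) with hκ
  have hκpos : ∀ n, 0 < κ n := fun n => by positivity
  have hsd : Tendsto (fun n => √(d n)) atTop (𝓝 0) := by simpa using hdlim.sqrt
  have hκlim : Tendsto κ atTop (𝓝 0) := by
    simpa only [add_zero] using hsd.add (tendsto_one_div_add_atTop_nhds_zero_nat (𝕜 := ℝ))
  have hbound : ∀ n : ℕ, 0 < n → Integrable (fun D => (√n * sampleMean fun i =>
        (est n).truncRemainder (P n) c D i * centredResid (P n) link (m n) (D i)) ^ 2)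
        ((P n).sampleLaw n) ∧
      ∫ D, (√n * sampleMean fun i => (est n).truncRemainder (P n) c D i
          * centredResid (P n) link (m n) (D i)) ^ 2 ∂(P n).sampleLaw n
        ≤ √(d n) / (2 * c ^ 4) + κ n / 2 * (16 * (1 + C)) := by
    intro n hn
    obtain ⟨hξ4, hξb⟩ := H.centredResid_pow_four n
    obtain ⟨h1, h2⟩ := NuisanceEstimator.integral_sq_truncRemainder_le (est := est n) H.c_pos
      (hκpos n) hn (H.measurable_centredResid n) hξ4 (Dgp.condMeanZero_resid (H.integrable_resid n))
    refine ⟨h1, h2.trans (add_le_add ?_ ?_)⟩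
    · rw [div_right_comm]
      refine div_le_div_of_nonneg_right ?_ (by have := H.c_pos; positivity)
      rw [div_le_iff₀ (hκpos n)]
      have h3 : d n = √(d n) * √(d n) := (Real.mul_self_sqrt (hd0 n)).symm
      have h4 : 0 ≤ √(d n) * (1 / ((n : ℝ) + 1)) := by positivity
      change d n ≤ √(d n) * (√(d n) + 1 / ((n : ℝ) + 1))
      nlinarith
    · exact mul_le_mul_of_nonneg_left hξb (by have := hκpos n; positivity)
  refine tendsto_zero_inProb_of_integral_sq (X := fun n (D : Fin n → Obs (p n)) =>
    √n * sampleMean fun i => (est n).truncRemainder (P n) c D i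
      * centredResid (P n) link (m n) (D i)) (fun n => ?_) ?_
  · rcases Nat.eq_zero_or_pos n with rfl | hn
    · simp
    · exact (hbound n hn).1
  · have hlim : Tendsto (fun n => √(d n) / (2 * c ^ 4) + κ n / 2 * (16 * (1 + C))) atTop (𝓝 0) := by
      simpa using (hsd.div_const (2 * c ^ 4)).add ((hκlim.div_const 2).mul_const (16 * (1 + C)))
    refine squeeze_zero' (Eventually.of_forall fun n => integral_nonneg fun D => sq_nonneg _) ?_
      hlim
    filter_upwards [eventually_gt_atTop 0] with n hn using (hbound n hn).2

/-- The scores at the estimated and at the true parameters have the same mean up to an error of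
smaller order than `n^(-1/2)`. -/
lemma tendsto_sqrt_mul_sampleMean_scores_sub (H : RegularSequence link m lamβ c C r est P) :
    Tendsto (fun x : Σ n, Fin n → Obs (p n) =>
        √x.1 * (sampleMean ((est x.1).scores link (m x.1) (P x.1).psi x.2)
          - sampleMean fun i => (P x.1).trueScore link (m x.1) (x.2 i)))
      (inProb fun n => (P n).sampleLaw n) (𝓝 0) := by
  have hlim := ((((H.tendsto_gradient_term.add H.tendsto_curvature_term).add
    H.tendsto_penalty_term).add H.tendsto_truncRemainder.abs).add
    (H.tendsto_sqrt_mul_sampleMean_propError.const_mul ((1 + C) / c))).add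
    (H.tendsto_sqrt_mul_propError_mul_predError.const_mul (1 / c))
  simp only [abs_zero, add_zero, mul_zero] at hlim
  refine squeeze_zero_norm' ?_ hlim
  filter_upwards [H.eventually_exposure, H.eventually_weight, H.eventually_condExp_resid,
    H.eventually_bridge] with x hA hw hh hb
  have h := NuisanceEstimator.sqrt_mul_abs_sampleMean_scores_sub_le (H.contDiff_model x.1)
    (H.penalty_pos x.1).le hb H.c_pos hA hw hh
  rw [Real.norm_eq_abs, abs_mul, abs_of_nonneg (Real.sqrt_nonneg _)]
  refine h.trans (le_of_eq ?_)
  have e : √(x.1 : ℝ) * |sampleMean fun i => (est x.1).propRemainder (P x.1) x.2 i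
        * ((P x.1).resid link (m x.1) (x.2 i)
          - ((P x.1).law[(P x.1).resid link (m x.1) | sigmaAL (p x.1)]) (x.2 i))|
      = |√x.1 * sampleMean fun i => (est x.1).truncRemainder (P x.1) c x.2 i
          * centredResid (P x.1) link (m x.1) (x.2 i)| := by
    rw [abs_mul, abs_of_nonneg (Real.sqrt_nonneg _)]
    congr 3
    funext i
    rw [NuisanceEstimator.truncRemainder, if_pos (hw i), centredResid]
  rw [e]

end RegularSequence

/-! ### Consistency of the variance estimators -/

namespace RegularSequence

variable {p : ℕ → ℕ} {link : Link} {m : ∀ n, (Fin (p n) → ℝ) → (Fin (p n) → ℝ) → ℝ}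
  {lamβ : ℕ → ℝ} {c C r : ℝ} {est : ∀ n, NuisanceEstimator n (p n)} {P : ∀ n, Dgp (p n)}

lemma measurable_trueScore (H : RegularSequence link m lamβ c C r est P) (n : ℕ) :
    Measurable ((P n).trueScore link (m n)) :=
  Dgp.measurable_noise.mul (Dgp.measurable_resid (H.measurable_model n))

lemma trueScore_pow_four (H : RegularSequence link m lamβ c C r est P) (n : ℕ) :
    Integrable (fun o => (P n).trueScore link (m n) o ^ 4) (P n).law ∧
      ∫ o, (P n).trueScore link (m n) o ^ 4 ∂(P n).law ≤ 1 + C := by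
  have hb : ∀ᵐ o ∂(P n).law,
      (P n).trueScore link (m n) o ^ 4 ≤ (P n).resid link (m n) o ^ 4 := by
    filter_upwards [Dgp.ae_abs_noise_le (H.exposureModel n)] with o ho
    rw [Dgp.trueScore, mul_pow]
    refine mul_le_of_le_one_left (by positivity) ?_
    rw [← Even.pow_abs (by decide : Even 4)]
    exact pow_le_one₀ (abs_nonneg _) ho
  have he := H.integrable_resid_pow_four n
  have hint : Integrable (fun o => (P n).trueScore link (m n) o ^ 4) (P n).law := by
    refine he.mono' ((H.measurable_trueScore n).pow_const 4).aestronglyMeasurable ?_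
    filter_upwards [hb] with o ho
    rwa [Real.norm_of_nonneg (by positivity)]
  exact ⟨hint, (integral_mono_ae hint he hb).trans (H.integral_resid_pow_four_le n)⟩

lemma integral_trueScore (H : RegularSequence link m lamβ c C r est P) (n : ℕ) :
    ∫ o, (P n).trueScore link (m n) o ∂(P n).law = 0 :=
  Dgp.integral_noise_mul_resid (H.outcomeModel n) (H.exposureModel n) (H.measurable_model n)
    (H.integrable_resid n)

/-- The variance of the score at the true parameters. -/
noncomputable def _root_.ScoreCI.Dgp.scoreVar {q : ℕ} (P : Dgp q) (link : Link)
    (m : (Fin q → ℝ) → (Fin q → ℝ) → ℝ) : ℝ :=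
  ∫ o, P.trueScore link m o ^ 2 ∂P.law

lemma integrable_trueScore_sq (H : RegularSequence link m lamβ c C r est P) (n : ℕ) :
    Integrable (fun o => (P n).trueScore link (m n) o ^ 2) (P n).law :=
  integrable_sq_of_integrable_pow_four (H.measurable_trueScore n).aestronglyMeasurable
    (H.trueScore_pow_four n).1

lemma scoreVar_nonneg (n : ℕ) : 0 ≤ (P n).scoreVar link (m n) :=
  integral_nonneg fun _ => sq_nonneg _

lemma scoreVar_le (H : RegularSequence link m lamβ c C r est P) (n : ℕ) :
    (P n).scoreVar link (m n) ≤ 2 + C := by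
  obtain ⟨h1, h2⟩ := H.trueScore_pow_four n
  have h3 : (P n).scoreVar link (m n) ≤ ∫ o, (1 + (P n).trueScore link (m n) o ^ 4) ∂(P n).law :=
    integral_mono (H.integrable_trueScore_sq n) ((integrable_const 1).add h1)
      fun o => sq_le_one_add_pow_four _
  rw [integral_add (integrable_const _) h1] at h3
  simp only [integral_const, probReal_univ, smul_eq_mul, one_mul] at h3
  linarith

/-- An event that holds at all sampled points with probability tending to one holds for one
observation with probability tending to one. -/
lemma tendsto_law_of_forall_sample {S : ∀ n, Set (Obs (p n))} (hS : ∀ n, MeasurableSet (S n))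
    (h : WithProbToOne (fun n => (P n).sampleLaw n) fun n => {D | ∀ i, D i ∈ S n}) :
    Tendsto (fun n => (P n).law.real (S n)) atTop (𝓝 1) := by
  refine tendsto_of_tendsto_of_tendsto_of_le_of_le' h tendsto_const_nhds ?_
    (Eventually.of_forall fun n => measureReal_le_one)
  filter_upwards [eventually_gt_atTop 0] with n hn
  have hmp := measurePreserving_eval (fun _ : Fin n => (P n).law) ⟨0, hn⟩
  have e : (P n).law.real (S n)
      = ((P n).sampleLaw n).real (Function.eval (⟨0, hn⟩ : Fin n) ⁻¹' S n) :=
    (hmp.measureReal_preimage (hS n).nullMeasurableSet).symm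
  rw [e]
  exact measureReal_mono fun D hD => hD ⟨0, hn⟩

lemma eventually_le_scoreVar (H : RegularSequence link m lamβ c C r est P) :
    ∀ᶠ n in atTop, c ^ 2 / 2 ≤ (P n).scoreVar link (m n) := by
  have hm1 (n : ℕ) : Measurable ((P n).law[fun o =>
      (exposure o - propensity (P n).gam (covar o)) ^ 2 | sigmaL (p n)]) :=
    (stronglyMeasurable_condExp.mono sigmaL_le).measurable
  have hm2 (n : ℕ) : Measurable ((P n).law[fun o =>
      (P n).resid link (m n) o ^ 2 | sigmaAL (p n)]) :=
    (stronglyMeasurable_condExp.mono sigmaAL_le).measurable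
  have h1 := tendsto_law_of_forall_sample (S := fun n => {o | c < ((P n).law[fun o =>
      (exposure o - propensity (P n).gam (covar o)) ^ 2 | sigmaL (p n)]) o})
    (fun n => measurableSet_lt measurable_const (hm1 n)) H.moments.2.2.1
  have h2 := tendsto_law_of_forall_sample (S := fun n => {o | c < ((P n).law[fun o =>
      (P n).resid link (m n) o ^ 2 | sigmaAL (p n)]) o})
    (fun n => measurableSet_lt measurable_const (hm2 n)) H.moments.2.2.2
  have hlim := ((h1.const_mul c).sub (h2.const_sub 1)).const_mul c
  have hc := H.c_pos
  have hlt : c ^ 2 / 2 < c * (c * 1 - (1 - 1)) := by nlinarith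
  filter_upwards [hlim.eventually (lt_mem_nhds hlt)] with n hn
  exact hn.le.trans (Dgp.le_integral_sq_noise_mul_resid (H.exposureModel n) (H.measurable_model n)
    (H.integrable_resid_pow_four n) hc)

lemma tendsto_sampleMean_trueScore (H : RegularSequence link m lamβ c C r est P) :
    Tendsto (fun x : Σ n, Fin n → Obs (p n) =>
        sampleMean fun i => (P x.1).trueScore link (m x.1) (x.2 i))
      (inProb fun n => (P n).sampleLaw n) (𝓝 0) := by
  have h := fun n (hn : 0 < n) => integral_sq_sampleMean (n := n) (H.measurable_trueScore n)
    (H.integrable_trueScore_sq n) (H.integral_trueScore n) hn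
  refine tendsto_zero_inProb_of_integral_sq (X := fun n (D : Fin n → Obs (p n)) =>
    sampleMean fun i => (P n).trueScore link (m n) (D i)) (fun n => ?_) ?_
  · rcases Nat.eq_zero_or_pos n with rfl | hn
    · simp [sampleMean]
    · exact (h n hn).1
  · refine squeeze_zero' (Eventually.of_forall fun n => integral_nonneg fun D => sq_nonneg _) ?_
      (tendsto_const_div_atTop_nhds_zero_nat (2 + C))
    filter_upwards [eventually_gt_atTop 0] with n hn
    refine (h n hn).2.le.trans (div_le_div_of_nonneg_right (H.scoreVar_le n) (by positivity))

/-- The law of large numbers for the squared scores. -/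
lemma tendsto_uncentredVariance_trueScore (H : RegularSequence link m lamβ c C r est P) :
    Tendsto (fun x : Σ n, Fin n → Obs (p n) =>
        (uncentredVariance fun i => (P x.1).trueScore link (m x.1) (x.2 i))
          - (P x.1).scoreVar link (m x.1))
      (inProb fun n => (P n).sampleLaw n) (𝓝 0) := by
  set f : ∀ n, Obs (p n) → ℝ := fun n o =>
    (P n).trueScore link (m n) o ^ 2 - (P n).scoreVar link (m n) with hf
  have hfm : ∀ n, Measurable (f n) := fun n =>
    ((H.measurable_trueScore n).pow_const 2).sub_const _
  have hb : ∀ n o, f n o ^ 2 ≤ 2 * (P n).trueScore link (m n) o ^ 4 + 2 * (2 + C) ^ 2 :=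
    fun n o => by
      have h1 := scoreVar_nonneg (P := P) (link := link) (m := m) n
      have h2 : (P n).scoreVar link (m n) ^ 2 ≤ (2 + C) ^ 2 :=
        pow_le_pow_left₀ h1 (H.scoreVar_le n) 2
      simp only [hf]
      nlinarith [sq_nonneg ((P n).trueScore link (m n) o ^ 2 + (P n).scoreVar link (m n))]
  have hbi : ∀ n, Integrable (fun o => 2 * (P n).trueScore link (m n) o ^ 4 + 2 * (2 + C) ^ 2)
      (P n).law := fun n => ((H.trueScore_pow_four n).1.const_mul 2).add (integrable_const _)
  have hf2 : ∀ n, Integrable (fun o => f n o ^ 2) (P n).law := fun n =>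
    (hbi n).mono' ((hfm n).pow_const 2).aestronglyMeasurable (ae_of_all _ fun o => by
      rw [Real.norm_of_nonneg (sq_nonneg _)]
      exact hb n o)
  have hK : ∀ n, ∫ o, f n o ^ 2 ∂(P n).law ≤ 2 * (1 + C) + 2 * (2 + C) ^ 2 := fun n => by
    refine (integral_mono (hf2 n) (hbi n) (hb n)).trans ?_
    rw [integral_add ((H.trueScore_pow_four n).1.const_mul 2) (integrable_const _),
      integral_const_mul]
    simp only [integral_const, probReal_univ, smul_eq_mul, one_mul]
    linarith [(H.trueScore_pow_four n).2]
  have hf0 : ∀ n, ∫ o, f n o ∂(P n).law = 0 := fun n => by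
    simp only [hf]
    rw [integral_sub (H.integrable_trueScore_sq n) (integrable_const _)]
    simp [Dgp.scoreVar]
  have h := fun n (hn : 0 < n) => integral_sq_sampleMean (n := n) (hfm n) (hf2 n) (hf0 n) hn
  have hlim := tendsto_zero_inProb_of_integral_sq (μ := fun n => (P n).sampleLaw n)
    (X := fun n (D : Fin n → Obs (p n)) => sampleMean fun i => f n (D i)) (fun n => by
      rcases Nat.eq_zero_or_pos n with rfl | hn
      · simp [sampleMean]
      · exact (h n hn).1) (by
      refine squeeze_zero' (Eventually.of_forall fun n => integral_nonneg fun D => sq_nonneg _) ?_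
        (tendsto_const_div_atTop_nhds_zero_nat (2 * (1 + C) + 2 * (2 + C) ^ 2))
      filter_upwards [eventually_gt_atTop 0] with n hn
      exact (h n hn).2.le.trans (div_le_div_of_nonneg_right (hK n) (by positivity)))
  refine hlim.congr' ?_
  filter_upwards [tendsto_fst_inProb.eventually (eventually_gt_atTop 0)] with x hx
  simp only [hf]
  rw [sampleMean_sub, uncentredVariance]
  congr 1
  have : (x.1 : ℝ) ≠ 0 := by positivity
  simp [sampleMean, this]

lemma isBigOP_sampleMean_resid (H : RegularSequence link m lamβ c C r est P) :
    IsBigOP (fun n => (P n).sampleLaw n)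
      (fun n D => sampleMean fun i => (P n).resid link (m n) (D i) ^ 4) (fun _ _ => 1) := by
  have h := fun n (hn : 0 < n) => integral_sampleMean_comp (n := n)
    (H.integrable_resid_pow_four n) hn
  refine isBigOP_one_of_integral_le (fun n => ?_)
    (fun n D => sampleMean_nonneg fun i => by positivity) (K := 1 + C) ?_
  · rcases Nat.eq_zero_or_pos n with rfl | hn
    · simp [sampleMean]
    · exact (h n hn).1
  · filter_upwards [eventually_gt_atTop 0] with n hn
    exact (h n hn).2.le.trans (H.integral_resid_pow_four_le n)

/-- The uncentred variance estimator is consistent. -/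
lemma tendsto_uncentredVariance_scores (H : RegularSequence link m lamβ c C r est P) :
    Tendsto (fun x : Σ n, Fin n → Obs (p n) =>
        uncentredVariance ((est x.1).scores link (m x.1) (P x.1).psi x.2)
          - (P x.1).scoreVar link (m x.1))
      (inProb fun n => (P n).sampleLaw n) (𝓝 0) := by
  have h1 := (((IsBigOP.mul H.isBigOP_sampleMean_propError H.isBigOP_sampleMean_resid
    (fun n _ => div_nonneg (mul_nonneg (sGam_nonneg n) (logDim_nonneg p n)) (by positivity))
    (fun _ _ => zero_le_one)).tendsto_zero (by
      simp only [mul_one]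
      exact tendsto_div_natCast_of_tendsto_div_sqrt
        (fun n => mul_nonneg (sGam_nonneg n) (logDim_nonneg p n)) H.sparsity.tendsto_sGam)).sqrt)
  rw [Real.sqrt_zero] at h1
  have hB := (H.tendsto_sampleMean_predError.const_mul 6).add (h1.const_mul 3)
  simp only [mul_zero, add_zero] at hB
  have hB2 := ((hB.sqrt.const_mul (2 * √(3 + C))).add hB)
  simp only [Real.sqrt_zero, mul_zero, add_zero] at hB2
  have hdiff : Tendsto (fun x : Σ n, Fin n → Obs (p n) =>
        uncentredVariance ((est x.1).scores link (m x.1) (P x.1).psi x.2)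
          - uncentredVariance fun i => (P x.1).trueScore link (m x.1) (x.2 i))
      (inProb fun n => (P n).sampleLaw n) (𝓝 0) := by
    refine squeeze_zero_norm' ?_ hB2
    filter_upwards [H.eventually_exposure, H.tendsto_uncentredVariance_trueScore.eventually
      (gt_mem_nhds one_pos)] with x hA hV
    have h := abs_uncentredVariance_score_sub_le
      (a := fun i => exposure (x.2 i) - propensity (P x.1).gam (covar (x.2 i)))
      (e := fun i => (P x.1).resid link (m x.1) (x.2 i))
      (μ := (est x.1).predError (P x.1) (m x.1) x.2) (δ := (est x.1).propError (P x.1) x.2)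
      (fun i => abs_sub_propensity_le (hA i) _ _)
      (NuisanceEstimator.abs_propError_le x.2)
    rw [NuisanceEstimator.scores_eq, Real.norm_eq_abs]
    refine h.trans ?_
    rw [← Real.sqrt_mul (sampleMean_nonneg fun i => sq_nonneg _)]
    gcongr
    change uncentredVariance (fun i => (P x.1).trueScore link (m x.1) (x.2 i)) ≤ 3 + C
    linarith [H.scoreVar_le x.1]
  simpa using hdiff.add H.tendsto_uncentredVariance_trueScore

lemma tendsto_sampleMean_scores (H : RegularSequence link m lamβ c C r est P) :
    Tendsto (fun x : Σ n, Fin n → Obs (p n) =>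
        sampleMean ((est x.1).scores link (m x.1) (P x.1).psi x.2))
      (inProb fun n => (P n).sampleLaw n) (𝓝 0) := by
  have h : Tendsto (fun x : Σ n, Fin n → Obs (p n) =>
        sampleMean ((est x.1).scores link (m x.1) (P x.1).psi x.2)
          - sampleMean fun i => (P x.1).trueScore link (m x.1) (x.2 i))
      (inProb fun n => (P n).sampleLaw n) (𝓝 0) := by
    have h1 := H.tendsto_sqrt_mul_sampleMean_scores_sub.abs
    rw [abs_zero] at h1
    refine squeeze_zero_norm' ?_ h1
    filter_upwards [tendsto_fst_inProb.eventually (eventually_gt_atTop 0)] with x hx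
    rw [Real.norm_eq_abs, abs_mul]
    refine le_mul_of_one_le_left (abs_nonneg _) ?_
    rw [abs_of_nonneg (Real.sqrt_nonneg _), Real.one_le_sqrt]
    exact_mod_cast hx
  simpa using h.add H.tendsto_sampleMean_trueScore

/-- The centred variance estimator is consistent. -/
lemma tendsto_centredVariance_scores (H : RegularSequence link m lamβ c C r est P) :
    Tendsto (fun x : Σ n, Fin n → Obs (p n) =>
        centredVariance ((est x.1).scores link (m x.1) (P x.1).psi x.2)
          - (P x.1).scoreVar link (m x.1))
      (inProb fun n => (P n).sampleLaw n) (𝓝 0) := by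
  have h := H.tendsto_uncentredVariance_scores.sub (H.tendsto_sampleMean_scores.pow 2)
  simp only [ne_eq, OfNat.ofNat_ne_zero, not_false_eq_true, zero_pow, sub_zero] at h
  refine h.congr' ?_
  filter_upwards [tendsto_fst_inProb.eventually (eventually_gt_atTop 0)] with x hx
  rw [centredVariance_eq hx]
  ring

end RegularSequence

/-! ### Coverage -/

/-- If the events `E n` are asymptotically squeezed between `|W n| ≤ s - η` and `|W n| ≤ s + η`,
then their probabilities have the limit that those of `|W n| ≤ s` have. -/
lemma tendsto_measure_of_squeeze {Ω : ℕ → Type} [∀ n, MeasurableSpace (Ω n)]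
    {μ : ∀ n, Measure (Ω n)} [∀ n, IsProbabilityMeasure (μ n)] {E : ∀ n, Set (Ω n)}
    {W : ∀ n, Ω n → ℝ} {G : ℝ → ℝ} {s : ℝ} (hG : ContinuousAt G s)
    (hW : ∀ s, Tendsto (fun n => (μ n).real {ω | |W n ω| ≤ s}) atTop (𝓝 (G s)))
    (hE : ∀ η > 0, ∀ᶠ x in inProb μ, (|W x.1 x.2| ≤ s - η → x.2 ∈ E x.1) ∧
      (x.2 ∈ E x.1 → |W x.1 x.2| ≤ s + η)) :
    Tendsto (fun n => (μ n).real (E n)) atTop (𝓝 (G s)) := by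
  refine Metric.tendsto_nhds.mpr fun ε hε => ?_
  obtain ⟨η₀, hη₀, hη⟩ := Metric.continuousAt_iff.mp hG (ε / 3) (by positivity)
  set η := η₀ / 2 with hηdef
  have hηpos : 0 < η := by positivity
  have hlo := hη (x := s - η) (by rw [Real.dist_eq]; rw [abs_lt]; constructor <;> linarith)
  have hhi := hη (x := s + η) (by rw [Real.dist_eq]; rw [abs_lt]; constructor <;> linarith)
  have hbad := (eventually_inProb (μ := μ) (Q := fun n ω => (|W n ω| ≤ s - η → ω ∈ E n) ∧
      (ω ∈ E n → |W n ω| ≤ s + η))).mp (hE η hηpos)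
  filter_upwards [Metric.tendsto_nhds.mp (hW (s - η)) (ε / 3) (by positivity),
    Metric.tendsto_nhds.mp (hW (s + η)) (ε / 3) (by positivity),
    hbad.eventually (gt_mem_nhds (show 0 < ε / 3 by positivity))] with n h1 h2 h3
  set B := {ω | ¬ ((|W n ω| ≤ s - η → ω ∈ E n) ∧ (ω ∈ E n → |W n ω| ≤ s + η))}
  have i1 : {ω | |W n ω| ≤ s - η} ⊆ E n ∪ B := fun ω hω => by
    by_cases hB : ω ∈ B
    · exact Or.inr hB
    · exact Or.inl ((not_not.mp hB).1 hω)
  have i2 : E n ⊆ {ω | |W n ω| ≤ s + η} ∪ B := fun ω hω => by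
    by_cases hB : ω ∈ B
    · exact Or.inr hB
    · exact Or.inl ((not_not.mp hB).2 hω)
  have j1 := (measureReal_mono (μ := μ n) i1).trans (measureReal_union_le _ _)
  have j2 := (measureReal_mono (μ := μ n) i2).trans (measureReal_union_le _ _)
  rw [Real.dist_eq, abs_lt] at *
  constructor <;> linarith [h1.1, h1.2, h2.1, h2.2, hlo.1, hlo.2, hhi.1, hhi.2]

/-- The test `a ^ 2 ≤ s ^ 2 * v` lies between the tests `|b| ≤ (s ∓ η) * σ` when `a` is close to
`b` and `v` is close to `σ ^ 2`. -/
lemma abs_le_iff_sq_le_of_perturbation {a b v s σ θ η : ℝ} (hs : 0 < s) (hθ : 0 < θ)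
    (hθs : θ ≤ s / 2) (hθη : θ ≤ η / 2) (hσ : 0 < σ) (hab : |a - b| ≤ θ * σ)
    (hv : |s ^ 2 * (v - σ ^ 2)| ≤ θ * s * σ ^ 2) :
    (|b| ≤ (s - η) * σ → a ^ 2 ≤ s ^ 2 * v) ∧ (a ^ 2 ≤ s ^ 2 * v → |b| ≤ (s + η) * σ) := by
  have hη : 2 * θ * σ ≤ η * σ := mul_le_mul_of_nonneg_right (by linarith) hσ.le
  have ha : |a| ≤ |b| + θ * σ := by linarith [abs_sub_abs_le_abs_sub a b]
  have hb : |b| ≤ |a| + θ * σ := by linarith [abs_sub_abs_le_abs_sub b a, abs_sub_comm a b]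
  have hθ2 : θ ^ 2 ≤ θ * s := by
    rw [sq]
    exact mul_le_mul_of_nonneg_left (by linarith) hθ.le
  rw [abs_le] at hv
  constructor
  · intro h
    have h6 : |a| ^ 2 ≤ ((s - θ) * σ) ^ 2 :=
      pow_le_pow_left₀ (abs_nonneg _) (by linarith) 2
    rw [sq_abs, mul_pow] at h6
    have h7 : (s - θ) ^ 2 ≤ s ^ 2 - θ * s := by linarith [sub_sq s θ]
    have h8 := mul_le_mul_of_nonneg_right h7 (sq_nonneg σ)
    linarith [hv.1]
  · intro h
    have h7 : s ^ 2 + θ * s ≤ (s + θ) ^ 2 := by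
      linarith [add_sq s θ, mul_pos hθ hs, sq_nonneg θ]
    have h8 := mul_le_mul_of_nonneg_right h7 (sq_nonneg σ)
    have h9 : |a| ≤ (s + θ) * σ := by
      refine abs_le_of_sq_le_sq ?_ (by positivity)
      rw [mul_pow]
      linarith [hv.2]
    linarith

namespace RegularSequence

variable {p : ℕ → ℕ} {link : Link} {m : ∀ n, (Fin (p n) → ℝ) → (Fin (p n) → ℝ) → ℝ}
  {lamβ : ℕ → ℝ} {c C r : ℝ} {est : ∀ n, NuisanceEstimator n (p n)} {P : ∀ n, Dgp (p n)}

/-- Asymptotic normality of the studentised true score. -/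
lemma tendsto_measure_studentised (H : RegularSequence link m lamβ c C r est P) (s : ℝ) :
    Tendsto (fun n => ((P n).sampleLaw n).real {D | |√n * sampleMean fun i =>
        (P n).trueScore link (m n) (D i) / √((P n).scoreVar link (m n))| ≤ s}) atTop
      (𝓝 ((gaussianReal 0 1).real {x | |x| ≤ s})) := by
  have hc := H.c_pos
  have hpos : ∀ᶠ n in atTop, 0 < (P n).scoreVar link (m n) :=
    H.eventually_le_scoreVar.mono fun n hn => lt_of_lt_of_le (by positivity) hn
  refine tendsto_measure_abs_sqrt_mul_sampleMean_le (fun n => (P n).law)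
    (f := fun n o => (P n).trueScore link (m n) o / √((P n).scoreVar link (m n)))
    (fun n => (H.measurable_trueScore n).div_const _) (fun n => ?_)
    (K := (1 + C) / (c ^ 2 / 2) ^ 2) ?_ ?_ ?_ s
  · simp only [div_pow]
    exact (H.trueScore_pow_four n).1.div_const _
  · filter_upwards [H.eventually_le_scoreVar] with n hn
    have h4 : √((P n).scoreVar link (m n)) ^ 4 = (P n).scoreVar link (m n) ^ 2 := by
      rw [show 4 = 2 * 2 from rfl, pow_mul, Real.sq_sqrt (scoreVar_nonneg n)]
    have hC : 0 ≤ 1 + C := by linarith [H.c_lt]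
    have hle : (c ^ 2 / 2) ^ 2 ≤ (P n).scoreVar link (m n) ^ 2 :=
      pow_le_pow_left₀ (by positivity) hn 2
    simp only [div_pow (Dgp.trueScore _ _ _ _)]
    rw [integral_div, h4]
    exact div_le_div₀ hC (H.trueScore_pow_four n).2 (by positivity) hle
  · refine Eventually.of_forall fun n => ?_
    rw [integral_div, H.integral_trueScore, zero_div]
  · filter_upwards [hpos] with n hn
    simp only [div_pow]
    rw [integral_div, Real.sq_sqrt hn.le]
    exact div_self hn.ne'

/-- The coverage along a sequence of laws, for a consistent variance estimator. -/
lemma tendsto_coverage (H : RegularSequence link m lamβ c C r est P) {α : ℝ}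
    (hα : α ∈ Set.Ioo (0 : ℝ) 1) {V : ∀ n, (Fin n → ℝ) → ℝ}
    (hV : Tendsto (fun x : Σ n, Fin n → Obs (p n) =>
        V x.1 ((est x.1).scores link (m x.1) (P x.1).psi x.2) - (P x.1).scoreVar link (m x.1))
      (inProb fun n => (P n).sampleLaw n) (𝓝 0)) :
    Tendsto (fun n => (est n).coverage link (m n) (V n) α (P n)) atTop (𝓝 (1 - α)) := by
  obtain ⟨hq, hG⟩ := chiSqCrit_spec hα
  set q := chiSqCrit α
  have hc := H.c_pos
  rw [← hG]
  refine tendsto_measure_of_squeeze (μ := fun n => (P n).sampleLaw n)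
    (W := fun n D => √n * sampleMean fun i =>
        (P n).trueScore link (m n) (D i) / √((P n).scoreVar link (m n)))
    continuous_gaussian_abs_le.continuousAt H.tendsto_measure_studentised fun η hη => ?_
  have hs : 0 < √q := Real.sqrt_pos.mpr hq
  have hsq : √q ^ 2 = q := Real.sq_sqrt hq.le
  -- The tolerance `η` is split evenly between the numerator and the variance estimate.
  set θ := min (√q / 2) (η / 2) with hθ
  have hθ0 : 0 < θ := lt_min (by positivity) (by positivity)
  have hθ1 : θ ≤ √q / 2 := min_le_left _ _
  have hθ2 : θ ≤ η / 2 := min_le_right _ _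
  have hκ : 0 < θ * √q * (c ^ 2 / 2) / q := by positivity
  have h1 := (Metric.tendsto_nhds.mp H.tendsto_sqrt_mul_sampleMean_scores_sub)
    (θ * √(c ^ 2 / 2)) (by positivity)
  have h2 := (Metric.tendsto_nhds.mp hV) _ hκ
  filter_upwards [h1, h2, tendsto_fst_inProb.eventually H.eventually_le_scoreVar,
    tendsto_fst_inProb.eventually (eventually_gt_atTop 0)] with x h1 h2 h3 h4
  have hmem : (P x.1).psi ∈ (est x.1).confidenceSet link (m x.1) (V x.1) α x.2 ↔
      sampleMean ((est x.1).scores link (m x.1) (P x.1).psi x.2) ^ 2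
        - q / (x.1 : ℝ) * V x.1 ((est x.1).scores link (m x.1) (P x.1).psi x.2) ≤ 0 := Iff.rfl
  rw [hmem]
  have hW : (√x.1 * sampleMean fun i =>
        (P x.1).trueScore link (m x.1) (x.2 i) / √((P x.1).scoreVar link (m x.1)))
      = √x.1 * (sampleMean fun i => (P x.1).trueScore link (m x.1) (x.2 i))
        / √((P x.1).scoreVar link (m x.1)) := by
    simp only [sampleMean, ← Finset.sum_div]
    ring
  rw [hW]
  rw [Real.dist_eq, sub_zero] at h1 h2
  have hn : (0 : ℝ) < x.1 := by exact_mod_cast h4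
  generalize (V x.1 ((est x.1).scores link (m x.1) (P x.1).psi x.2)) = v at *
  generalize (sampleMean ((est x.1).scores link (m x.1) (P x.1).psi x.2)) = t at *
  generalize (sampleMean fun i => (P x.1).trueScore link (m x.1) (x.2 i)) = u at *
  generalize (P x.1).scoreVar link (m x.1) = σ2 at *
  have hσ2 : 0 < σ2 := lt_of_lt_of_le (by positivity) h3
  set σ := √σ2 with hσdef
  have hσ : 0 < σ := Real.sqrt_pos.mpr hσ2
  have hσsq : σ ^ 2 = σ2 := Real.sq_sqrt hσ2.le
  have hnsq : √(x.1 : ℝ) ^ 2 = x.1 := Real.sq_sqrt hn.le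
  set N := √(x.1 : ℝ) with hN
  have hN0 : 0 < N := Real.sqrt_pos.mpr hn
  have hd : |N * (t - u)| ≤ θ * σ :=
    h1.le.trans (mul_le_mul_of_nonneg_left (Real.sqrt_le_sqrt h3) hθ0.le)
  have hv : |√q ^ 2 * (v - σ ^ 2)| ≤ θ * √q * σ ^ 2 := by
    rw [hsq, hσsq, abs_mul, abs_of_pos hq]
    have h5 := mul_le_mul_of_nonneg_left h2.le hq.le
    rw [mul_div_cancel₀ _ hq.ne'] at h5
    exact h5.trans (mul_le_mul_of_nonneg_left h3 (by positivity))
  have hiff : t ^ 2 - q / (x.1 : ℝ) * v ≤ 0 ↔ (N * t) ^ 2 ≤ q * v := by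
    rw [mul_pow, hnsq, sub_nonpos, div_mul_eq_mul_div, le_div_iff₀ hn, mul_comm]
  rw [hiff, abs_div, abs_of_pos hσ, div_le_iff₀ hσ, div_le_iff₀ hσ]
  have hdab : |N * t - N * u| ≤ θ * σ := by rwa [← mul_sub]
  have h := abs_le_iff_sq_le_of_perturbation hs hθ0 hθ1 hθ2 hσ hdab hv
  rwa [hsq] at h

end RegularSequence

/-- Uniform convergence over nonempty index sets follows from convergence along all sequences of
elements: compare with elements that nearly attain the suprema. -/
lemma tendsto_iSup_of_forall_seq {X : ℕ → Type*} {S : ∀ n, Set (X n)} (hS : ∀ n, (S n).Nonempty)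
    {F : ∀ n, X n → ℝ} (h0 : ∀ n x, 0 ≤ F n x)
    (h : ∀ x : ∀ n, X n, (∀ n, x n ∈ S n) → Tendsto (fun n => F n (x n)) atTop (𝓝 0)) :
    Tendsto (fun n => ⨆ x : S n, F n x) atTop (𝓝 0) := by
  have hex : ∀ n : ℕ, ∃ x ∈ S n, (⨆ x : S n, F n x) - 1 / ((n : ℝ) + 1) < F n x := fun n => by
    have := (hS n).to_subtype
    obtain ⟨x, hx⟩ := exists_lt_of_lt_ciSup (f := fun x : S n => F n x)
      (sub_lt_self _ (by positivity : (0 : ℝ) < 1 / ((n : ℝ) + 1)))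
    exact ⟨x, x.2, hx⟩
  choose x hx hlt using hex
  have hlim := (h x hx).add (tendsto_one_div_add_atTop_nhds_zero_nat (𝕜 := ℝ))
  rw [add_zero] at hlim
  refine squeeze_zero (fun n => Real.iSup_nonneg fun y => h0 n y) (fun n => ?_) hlim
  linarith [hlt n]

end ScoreCI

theorem theorem1
    (p : ℕ → ℕ) (link : Link)
    (m : ∀ n, (Fin (p n) → ℝ) → (Fin (p n) → ℝ) → ℝ)
    (hm_meas : ∀ n β, Measurable fun l => m n l β)
    (hm_smooth : ∀ n l, ContDiff ℝ 2 (m n l))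
    (α : ℝ) (hα : α ∈ Set.Ioo (0 : ℝ) 1)
    (lamγ lamβ : ℕ → ℝ) (hlamγ : ∀ n, 0 < lamγ n) (hlamβ : ∀ n, 0 < lamβ n)
    (hlamβ_rate : lamβ =O[atTop] fun n : ℕ => Real.sqrt (logDim p n / n))
    (est : ∀ n, NuisanceEstimator n (p n))
    (Laws : ∀ n, Set (Dgp (p n))) (hLaws : ∀ n, (Laws n).Nonempty)
    (hM : ∀ n, ∀ P ∈ Laws n, P.OutcomeEffectModel link)
    (hA : ∀ n, ∀ P ∈ Laws n, P.LogisticExposureModel)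
    (hβ : ∀ n, ∀ P ∈ Laws n, P.PopulationEquation link (m n))
    (hest : ∀ n, ∀ P ∈ Laws n, (est n).IsLassoBridge link (m n) (lamγ n) (lamβ n) P)
    (c C r : ℝ) (hc : 0 < c) (hcC : c < C) (hr : 4 < r)
    (hmoment : ∀ P : ∀ n, Dgp (p n), (∀ n, P n ∈ Laws n) → MomentConditions link m c C r P)
    (hconc : ∀ P : ∀ n, Dgp (p n), (∀ n, P n ∈ Laws n) → ConcentrationBound m P)
    (hrates : ∀ P : ∀ n, Dgp (p n), (∀ n, P n ∈ Laws n) → EstimationRates est P)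
    (hpred : ∀ P : ∀ n, Dgp (p n), (∀ n, P n ∈ Laws n) → PredictionRates m est P)
    (hsmooth : ∀ P : ∀ n, Dgp (p n), (∀ n, P n ∈ Laws n) → QuadraticSmoothness m est P)
    (hsparse : ∀ P : ∀ n, Dgp (p n), (∀ n, P n ∈ Laws n) → UltraSparsity P) :
    Tendsto (fun n => ⨆ P : Laws n,
        |(est n).coverage link (m n) uncentredVariance α (P : Dgp (p n)) - (1 - α)|)
      atTop (𝓝 0) ∧
    Tendsto (fun n => ⨆ P : Laws n,
        |(est n).coverage link (m n) centredVariance α (P : Dgp (p n)) - (1 - α)|)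
      atTop (𝓝 0) := by
  have hreg (P : ∀ n, Dgp (p n)) (hP : ∀ n, P n ∈ Laws n) :
      RegularSequence link m lamβ c C r est P :=
    { measurable_model := hm_meas
      contDiff_model := hm_smooth
      penalty_pos := hlamβ
      penalty_rate := hlamβ_rate
      outcomeModel := fun n => hM n _ (hP n)
      exposureModel := fun n => hA n _ (hP n)
      bridge := fun n => (hest n _ (hP n)).2 _
      c_pos := hc
      c_lt := hcC
      lt_r := hr
      moments := hmoment P hP
      concentration := hconc P hP
      rates := hrates P hP
      predictions := hpred P hP
      smoothness := hsmooth P hP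
      sparsity := hsparse P hP }
  refine ⟨tendsto_iSup_of_forall_seq hLaws (F := fun n P =>
      |(est n).coverage link (m n) uncentredVariance α P - (1 - α)|)
    (fun _ _ => abs_nonneg _) fun P hP => ?_, tendsto_iSup_of_forall_seq hLaws (F := fun n P =>
      |(est n).coverage link (m n) centredVariance α P - (1 - α)|)
    (fun _ _ => abs_nonneg _) fun P hP => ?_⟩
  · simpa using (((hreg P hP).tendsto_coverage hα
      (V := fun n => uncentredVariance) (hreg P hP).tendsto_uncentredVariance_scores).sub_const
        (1 - α)).abs
  · simpa using (((hreg P hP).tendsto_coverage hα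
      (V := fun n => centredVariance) (hreg P hP).tendsto_centredVariance_scores).sub_const
        (1 - α)).abs
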